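/- **Setting.** Let $\mathcal A$ be an abelian category with small products and enough projective objects, $\Phi:\mathcal A\to\mathcal A$ an autoequivalence, and $w:\mathrm{Id}\to\Phi$ a natural transformation with $w_{\Phi(X)}=\Phi(w_X)$ for all $X$. We identify $\Phi^i\Phi^j$ with $\Phi^{i+j}$ and write $w$ also for $\Phi^{-1}(w_X):\Phi^{-1}(X)\to X$. A *factorization* $E=(E^{-1},E^0,\phi^{-1}_E,\phi^0_E)$ consists of morphisms $\phi^{-1}_E:\Phi^{-1}(E^0)\to E^{-1}$ and $\phi^0_E:E^{-1}\to E^0$ with $\phi^0_E\phi^{-1}_E=\Phi^{-1}(w_{E^0})$ and $\Phi(\phi^{-1}_E)\phi^0_E=w_{E^{-1}}$. A morphism $g:E\to F$ is a pair $g^{-1}:E^{-1}\to F^{-1}$, $g^0:E^0\to F^0$ with $g^{-1}\phi^{-1}_E=\phi^{-1}_F\Phi^{-1}(g^0)$ and $g^0\phi^0_E=\phi^0_Fg^{-1}$. This gives an abelian category $\mathrm{Fact}(w)$. Its homotopy category $K$ identifies $g_1,g_2:E\to F$ when there are $h^{-1}:E^{-1}\to\Phi^{-1}(F^0)$ and $h^0:E^0\to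 F^{-1}$ with $g_1^{-1}-g_2^{-1}=h^0\phi^0_E+\phi^{-1}_Fh^{-1}$ and $g_1^0-g_2^0=\phi^0_Fh^0+\Phi(h^{-1})\Phi(\phi^{-1}_E)$. It is triangulated, with shift $E[1]=(E^0,\Phi(E^{-1}),-\phi^0_E,-\Phi(\phi^{-1}_E))$ and cones $$C(g)=\left(E^0\oplus F^{-1},\ \Phi(E^{-1})\oplus F^0,\ \begin{pmatrix}-\phi^0_E&0\\ g^{-1}&\phi^{-1}_F\end{pmatrix},\ \begin{pmatrix}-\Phi(\phi^{-1}_E)&0\\ g^0&\phi^0_F\end{pmatrix}\right).$$ For a pair of $\mathbb Z$-indexed families (in particular complexes) $A^{-1}_\bullet,A^0_\bullet$ in $\mathcal A$ put $$\mathrm{tot}^{\prod}(A_\bullet)^{-1}=\prod_{l}\Phi^{-l}(A^{-1}_{2l})\times\prod_l\Phi^{-l-1}(A^0_{2l+1}),\qquad \mathrm{tot}^{\prod}(A_\bullet)^{0}=\prod_{l}\Phi^{-l}(A^{0}_{2l})\times\prod_l\Phi^{-l}(A^{-1}_{2l+1}),$$ the factors being indexed by $2l$ and $2l+1$, $l\in\mathbb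 Z$. The *totalization* $T$ of a bounded complex $(E_\bullet,g)$ of factorizations, with $g_n:E_{n-1}\to E_n$, has components $T^i=\mathrm{tot}^{\prod}(E_\bullet)^i$ and structure morphisms whose only nonzero components (from index $p$ to index $q$) are: in $\phi^{-1}_T$, $\Phi^{-l}(\phi^{-1}_{E_{2l}})$ ($2l\to 2l$), $-\Phi^{-l-1}(\phi^0_{E_{2l+1}})$ ($2l+1\to2l+1$), $\Phi^{-l-1}(g^0_{2l+1})$ ($2l\to2l+1$), $\Phi^{-l}(g^{-1}_{2l})$ ($2l-1\to 2l$); in $\phi^0_T$, $\Phi^{-l}(\phi^0_{E_{2l}})$ ($2l\to 2l$), $-\Phi^{-l}(\phi^{-1}_{E_{2l+1}})$ ($2l+1\to2l+1$), $\Phi^{-l}(g^{-1}_{2l+1})$ ($2l\to2l+1$), $\Phi^{-l}(g^{0}_{2l})$ ($2l-1\to2l$). The *totally acyclic* (resp. *contra-acyclic*) factorizations form the smallest thick subcategory of $K$ that contains the totalizations of all bounded exact complexes in $\mathrm{Fact}(w)$ (resp. and is also closed under small products). A morphism of factorizations is a *quasi-isomorphism* (resp. *contra-quasi-isomorphism*)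 if it becomes an isomorphism in the Verdier quotient of $K$ by the totally acyclic (resp. contra-acyclic) factorizations. If the components of a factorization $P$ are $\mathrm{tot}^{\prod}(A_\bullet)^{-1}$ and $\mathrm{tot}^{\prod}(A_\bullet)^0$, write $\phi^i_{p,q}$ for the composition of $\phi^i_P$ with the inclusion of the factor of index $p$ of its source ($\Phi^{-1}(\mathrm{tot}^{\prod}(A_\bullet)^0)$ for $i=-1$, $\mathrm{tot}^{\prod}(A_\bullet)^{-1}$ for $i=0$) and the projection to the factor of index $q$ of its target. For complexes $A^{-1}_\bullet,A^0_\bullet$ with differentials $d^i_n:A^i_{n-1}\to A^i_n$, such a $P$ is a *$\prod$-folding* of $(A^{-1}_\bullet,A^0_\bullet)$ if $\phi^{-1}_{p,q}=\phi^0_{p,q}=0$ for $q>p+1$ and $$\phi^{-1}_{2l+1,2l+2}=\Phi^{-l-1}(d^{-1}_{2l+2}),\quad \phi^{-1}_{2l,2l+1}=-\Phi^{-l-1}(d^0_{2l+1}),\quad \phi^{0}_{2l+1,2l+2}=-\Phi^{-l-1}(d^0_{2l+2}),\quad \phi^0_{2l,2l+1}=\Phi^{-l}(d^{-1}_{2l+1}).$$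 **Choices.** Let $E$ be a factorization. Choose projective resolutions $\cdots\to P^{i}_{-1}\to P^{i}_0\xrightarrow{d^i_0}E^i\to0$ for $i=-1,0$ (with $P^i_n=0$ for $n>0$), chain maps $\phi^{-1}_\bullet:\Phi^{-1}(P^0_\bullet)\to P^{-1}_\bullet$ and $\phi^0_\bullet:P^{-1}_\bullet\to P^0_\bullet$ lifting $\phi^{-1}_E$ and $\phi^0_E$, a null-homotopy $h^0_j:\Phi^{-1}(P^0_{j+1})\to P^0_j$ of the chain map $w_{\Phi^{-1}(P^0_j)}-\phi^0_j\phi^{-1}_j$ from $\Phi^{-1}(P^0_\bullet)$ to $P^0_\bullet$, and a null-homotopy $h^{-1}_j:P^{-1}_{j+1}\to\Phi(P^{-1}_j)$ of the chain map $w_{P^{-1}_j}-\Phi(\phi^{-1}_j)\phi^0_j$ from $P^{-1}_\bullet$ to $\Phi(P^{-1}_\bullet)$. **Theorem.** For all such choices there exist a $\prod$-folding $P$ of $(P^{-1}_\bullet,P^0_\bullet)$ and a contra-quasi-isomorphism $d_0:P\to E$ such that the following hold. 1. For all $l\in\mathbb Z$, $$\phi^{-1}_{2l+1,2l+1}=\Phi^{-l-1}(\phi^0_{2l+1}),\quad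 \phi^{-1}_{2l,2l}=\Phi^{-l}(\phi^{-1}_{2l}),\quad \phi^0_{2l+1,2l+1}=\Phi^{-l}(\phi^{-1}_{2l+1}),\quad \phi^0_{2l,2l}=\Phi^{-l}(\phi^0_{2l}),$$ $$\phi^{-1}_{2l+1,2l}=\Phi^{-l-1}(h^{-1}_{2l}),\quad \phi^{-1}_{2l,2l-1}=-\Phi^{-l}(h^0_{2l-1}),\quad \phi^0_{2l+1,2l}=-\Phi^{-l}(h^0_{2l}),\quad \phi^0_{2l,2l-1}=\Phi^{-l}(h^{-1}_{2l-1}).$$ 2. $\phi^{-1}_P$ and $\phi^0_P$ are given by the matrices of their components: for every $q$, their projections to the factor of index $q$ depend only on the finitely many coordinates of index $p$ with $q-1\le p\le 0$. 3. $d_0^{-1}$ and $d_0^0$ are the projections to the factors $P^{-1}_0$ and $P^0_0$ of index $0$ followed by the augmentations $P^{-1}_0\to E^{-1}$ and $P^0_0\to E^0$. 4. $d_0$ is a quasi-isomorphism when both projective resolutions are finite. Furthermore, if for all $p$ $$h^{-1}_p\phi^{-1}_{p+1}=\Phi(\phi^{-1}_p)h^0_p,\qquad \Phi(h^0_p)\phi^0_{p+1}=\Phi(\phi^0_p)h^{-1}_p,\qquad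 \Phi(h^{-1}_{p-1})h^{-1}_p=0,\qquad \Phi(h^0_{p-1})h^0_p=0,$$ then $P$ and $d_0$ with all these properties can be chosen such that moreover $\phi^{-1}_{p,q}=\phi^0_{p,q}=0$ for all $q<p-1$. -/

import Mathlib

open CategoryTheory CategoryTheory.Limits
universe v u
noncomputable section
namespace Factorizations
variable {A : Type u} [Category.{v} A]

/-! ### Integral powers of an autoequivalence

The powers `Φ ^ j` (`j : ℤ`) are those of Mathlib. The following natural isomorphisms, all built
from the unit and the counit of `Φ`, realise the identifications `Φ^j Φ = Φ^(j+1)`,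
`Φ Φ^j = Φ^(j+1)`, `Φ^(j+1) Φ⁻¹ = Φ^j` and `Φ⁻¹ Φ^(j+1) = Φ^j`. -/

def powNatAfter (Φ : A ≌ A) :
    ∀ n : ℕ, (Φ.powNat n).functor ⋙ Φ.functor ≅ (Φ.powNat (n + 1)).functor
  | 0 => Functor.leftUnitor _
  | 1 => Iso.refl _
  | n + 2 => Functor.associator _ _ _ ≪≫ Functor.isoWhiskerLeft Φ.functor (powNatAfter Φ (n + 1))

def powNatBefore (Φ : A ≌ A) :
    ∀ n : ℕ, Φ.functor ⋙ (Φ.powNat n).functor ≅ (Φ.powNat (n + 1)).functor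
  | 0 => Functor.rightUnitor _
  | _ + 1 => Iso.refl _

def powNegAfter (Φ : A ≌ A) :
    ∀ n : ℕ, (Φ.symm.powNat (n + 1)).functor ⋙ Φ.functor ≅ (Φ.symm.powNat n).functor
  | 0 => Φ.counitIso
  | 1 => Functor.associator _ _ _ ≪≫ Functor.isoWhiskerLeft Φ.inverse Φ.counitIso ≪≫ 
      Functor.rightUnitor _
  | n + 2 => Functor.associator _ _ _ ≪≫ Functor.isoWhiskerLeft Φ.inverse (powNegAfter Φ (n + 1))

def powNegBefore (Φ : A ≌ A) :
    ∀ n : ℕ, Φ.functor ⋙ (Φ.symm.powNat (n + 1)).functor ≅ (Φ.symm.powNat n).functor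
  | 0 => Φ.unitIso.symm
  | n + 1 => (Functor.associator _ _ _).symm ≪≫
      Functor.isoWhiskerRight Φ.unitIso.symm (Φ.symm.powNat (n + 1)).functor ≪≫ Functor.leftUnitor _

theorem powNat_coh (Φ : A ≌ A) (n : ℕ) (X : A) :
   Φ.functor.map ((powNatBefore Φ n).hom.app X) ≫ (powNatAfter Φ (n+1)).hom.app X =
   (powNatAfter Φ n).hom.app (Φ.functor.obj X) ≫ (powNatBefore Φ (n+1)).hom.app X := by
  cases n with
  | zero =>
    change Φ.functor.map (𝟙 _) ≫ 𝟙 _ = 𝟙 _ ≫ 𝟙 _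
    simp
  | succ n =>
    change Φ.functor.map (𝟙 _) ≫ (𝟙 _ ≫ (powNatAfter Φ (n+1)).hom.app (Φ.functor.obj X)) =
      (powNatAfter Φ (n+1)).hom.app (Φ.functor.obj X) ≫ 𝟙 _
    rw [CategoryTheory.Functor.map_id, Category.id_comp, Category.comp_id]
    exact Category.id_comp _

theorem powNeg_coh (Φ : A ≌ A) (n : ℕ) (X : A) :
   Φ.functor.map ((powNegBefore Φ (n+1)).hom.app X) ≫ (powNegAfter Φ n).hom.app X =
   (powNegAfter Φ (n+1)).hom.app (Φ.functor.obj X) ≫ (powNegBefore Φ n).hom.app X := by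
  cases n with
  | zero =>
    change Φ.functor.map (𝟙 _ ≫ Φ.inverse.map (Φ.unitIso.inv.app X) ≫ 𝟙 _) ≫ Φ.counitIso.hom.app X =
      (𝟙 _ ≫ Φ.counitIso.hom.app (Φ.inverse.obj (Φ.functor.obj X)) ≫ 𝟙 _) ≫ Φ.unitIso.inv.app X
    simp only [Category.id_comp, Category.comp_id]
    exact Φ.counitIso.hom.naturality (Φ.unitIso.inv.app X)
  | succ n =>
    change Φ.functor.map (𝟙 _ ≫ (Φ.symm.powNat (n+2)).functor.map (Φ.unitIso.inv.app X) ≫ 𝟙 _) ≫ (powNegAfter Φ (n+1)).hom.app X =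
      (𝟙 _ ≫ (powNegAfter Φ (n+1)).hom.app (Φ.inverse.obj (Φ.functor.obj X))) ≫ (𝟙 _ ≫ (Φ.symm.powNat (n+1)).functor.map (Φ.unitIso.inv.app X) ≫ 𝟙 _)
    simp only [Category.id_comp, Category.comp_id]
    exact (powNegAfter Φ (n+1)).hom.naturality (Φ.unitIso.inv.app X)

theorem powNat_w (Φ : A ≌ A) (w : 𝟭 A ⟶ Φ.functor)
    (hw : ∀ X, w.app (Φ.functor.obj X) = Φ.functor.map (w.app X)) : ∀ (n : ℕ) (X : A),
    (Φ.powNat n).functor.map (w.app X) ≫ (powNatBefore Φ n).hom.app X =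
      w.app ((Φ.powNat n).functor.obj X) ≫ (powNatAfter Φ n).hom.app X
  | 0, _ => rfl
  | 1, X => by
    change Φ.functor.map (w.app X) ≫ 𝟙 _ = w.app (Φ.functor.obj X) ≫ 𝟙 _
    rw [hw]
  | n + 2, X => by
    have := powNat_w Φ w hw (n + 1) (Φ.functor.obj X)
    change (Φ.powNat (n+1)).functor.map (Φ.functor.map (w.app X)) ≫ 𝟙 _ = w.app ((Φ.powNat (n+1)).functor.obj (Φ.functor.obj X)) ≫ (𝟙 _ ≫ (powNatAfter Φ (n+1)).hom.app (Φ.functor.obj X))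
    rw [← hw, Category.id_comp]
    exact this

theorem powNeg_w (Φ : A ≌ A) (w : 𝟭 A ⟶ Φ.functor)
    (hw : ∀ X, w.app (Φ.functor.obj X) = Φ.functor.map (w.app X)) : ∀ (n : ℕ) (X : A),
    (Φ.symm.powNat (n+1)).functor.map (w.app X) ≫ (powNegBefore Φ n).hom.app X =
      w.app ((Φ.symm.powNat (n+1)).functor.obj X) ≫ (powNegAfter Φ n).hom.app X
  | 0, X => by
    change Φ.inverse.map (w.app X) ≫ Φ.unitIso.inv.app X = w.app (Φ.inverse.obj X) ≫ Φ.counitIso.hom.app X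
    apply Φ.functor.map_injective
    have h1 := w.naturality (Φ.counitIso.hom.app X)
    have h2 := Φ.counitIso.hom.naturality (w.app X)
    simp only [Functor.id_obj, Functor.comp_obj, Functor.id_map, Functor.comp_map, hw, Functor.map_comp] at h1 h2 ⊢
    rw [← h1, ← h2]
    simp
  | 1, X => by
    have h := powNeg_w Φ w hw 0 (Φ.inverse.obj X)
    have h0 := powNeg_w Φ w hw 0 X
    change Φ.inverse.map (w.app X) ≫ Φ.unitIso.inv.app X =
      w.app (Φ.inverse.obj X) ≫ Φ.counitIso.hom.app X at h0
    change Φ.inverse.map (Φ.inverse.map (w.app X)) ≫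
      (𝟙 _ ≫ Φ.inverse.map (Φ.unitIso.inv.app X) ≫ 𝟙 _) =
        w.app (Φ.inverse.obj (Φ.inverse.obj X)) ≫
          (𝟙 _ ≫ Φ.counitIso.hom.app (Φ.inverse.obj X) ≫ 𝟙 _)
    change Φ.inverse.map (w.app (Φ.inverse.obj X)) ≫ Φ.unitIso.inv.app (Φ.inverse.obj X) =
      w.app (Φ.inverse.obj (Φ.inverse.obj X)) ≫ Φ.counitIso.hom.app (Φ.inverse.obj X) at h
    rw [Category.id_comp, Category.comp_id, Category.id_comp, Category.comp_id, ← h,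
      ← Functor.map_comp, h0, Functor.map_comp]
    exact congrArg _ (Φ.unitInv_app_inverse X).symm
  | n + 2, X => by
    have h := powNeg_w Φ w hw (n + 1) (Φ.inverse.obj X)
    have h0 := powNeg_w Φ w hw 0 X
    change Φ.inverse.map (w.app X) ≫ Φ.unitIso.inv.app X =
      w.app (Φ.inverse.obj X) ≫ Φ.counitIso.hom.app X at h0
    change (Φ.symm.powNat (n + 1)).functor.map (Φ.inverse.map (Φ.inverse.map (w.app X))) ≫
      (𝟙 _ ≫ (Φ.symm.powNat (n + 1)).functor.map
        (Φ.inverse.map (Φ.unitIso.inv.app X)) ≫ 𝟙 _) =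
        w.app _ ≫ (𝟙 _ ≫ (powNegAfter Φ (n + 1)).hom.app (Φ.inverse.obj X))
    change (Φ.symm.powNat (n + 1)).functor.map (Φ.inverse.map (w.app (Φ.inverse.obj X))) ≫
      (𝟙 _ ≫ (Φ.symm.powNat (n + 1)).functor.map
        (Φ.unitIso.inv.app (Φ.inverse.obj X)) ≫ 𝟙 _) =
        w.app _ ≫ (powNegAfter Φ (n + 1)).hom.app (Φ.inverse.obj X) at h
    rw [Category.id_comp, Category.comp_id] at h
    rw [Category.id_comp, Category.comp_id, Category.id_comp, ← Functor.map_comp,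
      ← Functor.map_comp, h0]
    refine Eq.trans ?_ h
    rw [← Functor.map_comp, Functor.map_comp]
    congr 2
    exact (Φ.unitInv_app_inverse X).symm

/-- `Φ ∘ Φ^j ≅ Φ^(j+1)`. -/
def powAfter (Φ : A ≌ A) : ∀ j : ℤ, (Φ ^ j).functor ⋙ Φ.functor ≅ (Φ ^ (j + 1)).functor
  | Int.ofNat n => powNatAfter Φ n
  | Int.negSucc 0 => powNegAfter Φ 0
  | Int.negSucc (n + 1) => powNegAfter Φ (n + 1)

/-- `Φ^j ∘ Φ ≅ Φ^(j+1)`. -/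
def powBefore (Φ : A ≌ A) : ∀ j : ℤ, Φ.functor ⋙ (Φ ^ j).functor ≅ (Φ ^ (j + 1)).functor
  | Int.ofNat n => powNatBefore Φ n
  | Int.negSucc 0 => powNegBefore Φ 0
  | Int.negSucc (n + 1) => powNegBefore Φ (n + 1)

theorem pow_coh (Φ : A ≌ A) : ∀ (j : ℤ) (X : A),
   Φ.functor.map ((powBefore Φ j).hom.app X) ≫ (powAfter Φ (j+1)).hom.app X =
   (powAfter Φ j).hom.app (Φ.functor.obj X) ≫ (powBefore Φ (j+1)).hom.app X 
  | Int.ofNat n, X => powNat_coh Φ n X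
  | Int.negSucc 0, X => by
    change Φ.functor.map (Φ.unitIso.inv.app X) ≫ 𝟙 _ = Φ.counitIso.hom.app _ ≫ 𝟙 _
    rw [Category.comp_id]
    refine Eq.trans ?_ (Category.comp_id _).symm
    exact Equivalence.counit_app_functor Φ X |>.symm
  | Int.negSucc 1, X => powNeg_coh Φ 0 X
  | Int.negSucc (n + 2), X => powNeg_coh Φ (n + 1) X

theorem pow_w (Φ : A ≌ A) (w : 𝟭 A ⟶ Φ.functor)
    (hw : ∀ X, w.app (Φ.functor.obj X) = Φ.functor.map (w.app X)) : ∀ (j : ℤ) (X : A),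
    (Φ ^ j).functor.map (w.app X) ≫ (powBefore Φ j).hom.app X =
      w.app ((Φ ^ j).functor.obj X) ≫ (powAfter Φ j).hom.app X
  | Int.ofNat n, X => powNat_w Φ w hw n X
  | Int.negSucc 0, X => powNeg_w Φ w hw 0 X
  | Int.negSucc (n + 1), X => powNeg_w Φ w hw (n + 1) X


/-- `Φ^a ≅ Φ^b` for `a = b`. -/
def powEq (Φ : A ≌ A) {a b : ℤ} (h : a = b) : (Φ ^ a).functor ≅ (Φ ^ b).functor :=
  eqToIso (by rw [h])

/-- `Φ^j(Φ(X)) ≅ Φ^k(X)` for `k = j + 1`. -/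
def mulIso (Φ : A ≌ A) {j k : ℤ} (h : j + 1 = k) : Φ.functor ⋙ (Φ ^ j).functor ≅ (Φ ^ k).functor :=
  powBefore Φ j ≪≫ powEq Φ h

/-- `Φ^k(Φ⁻¹(X)) ≅ Φ^j(X)` for `k = j + 1`. -/
def invMulIso (Φ : A ≌ A) {j k : ℤ} (h : j + 1 = k) : Φ.inverse ⋙ (Φ ^ k).functor ≅ (Φ ^ j).functor :=
  Functor.isoWhiskerLeft Φ.inverse (mulIso Φ h).symm ≪≫ (Functor.associator _ _ _).symm ≪≫
    Functor.isoWhiskerRight Φ.counitIso _ ≪≫ Functor.leftUnitor _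

/-- `Φ⁻¹(Φ^k(X)) ≅ Φ^j(X)` for `k = j + 1`. -/
def mulInvIso (Φ : A ≌ A) {j k : ℤ} (h : j + 1 = k) : (Φ ^ k).functor ⋙ Φ.inverse ≅ (Φ ^ j).functor :=
  Functor.isoWhiskerRight ((powEq Φ h).symm ≪≫ (powAfter Φ j).symm) Φ.inverse ≪≫
    Functor.associator _ _ _ ≪≫ Functor.isoWhiskerLeft _ Φ.unitIso.symm ≪≫ Functor.rightUnitor _

theorem inv_coh (Φ : A ≌ A) {i j k : ℤ} (h : i + 1 = j) (h' : j + 1 = k) (X : A) :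
    Φ.inverse.map ((invMulIso Φ h').hom.app X) ≫ (mulInvIso Φ h).hom.app X =
      (mulInvIso Φ h').hom.app (Φ.inverse.obj X) ≫ (invMulIso Φ h).hom.app X := by
  subst h; subst h'
  have h1 := pow_coh Φ i (Φ.inverse.obj X)
  have h2 := Φ.unitIso.inv.naturality ((powBefore Φ i).inv.app (Φ.inverse.obj X) ≫
    (Φ ^ i).functor.map (Φ.counitIso.hom.app X))
  have h3 := (powAfter Φ i).inv.naturality (Φ.counitIso.hom.app X)
  have h4 : (powBefore Φ (i + 1)).inv.app (Φ.inverse.obj X) ≫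
      (powAfter Φ i).inv.app (Φ.functor.obj (Φ.inverse.obj X)) =
      (powAfter Φ (i + 1)).inv.app (Φ.inverse.obj X) ≫
        Φ.functor.map ((powBefore Φ i).inv.app (Φ.inverse.obj X)) := by
    rw [← cancel_epi ((powBefore Φ (i + 1)).hom.app (Φ.inverse.obj X)), Iso.hom_inv_id_app_assoc,
      ← cancel_epi ((powAfter Φ i).hom.app (Φ.functor.obj (Φ.inverse.obj X))),
      Iso.hom_inv_id_app, ← reassoc_of% h1, Iso.hom_inv_id_app_assoc, ← Functor.map_comp,
      Iso.hom_inv_id_app]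
    exact (Φ.functor.map_id _).symm
  simp only [Functor.comp_obj, Functor.id_obj, Functor.comp_map, Functor.id_map] at h2 h3
  simp only [mulInvIso, invMulIso, mulIso, powEq, eqToIso_refl, Iso.trans_hom, Iso.symm_hom,
    Functor.isoWhiskerLeft_hom, Functor.isoWhiskerRight_hom, NatTrans.comp_app,
    Functor.whiskerLeft_app, Functor.whiskerRight_app, Functor.associator_hom_app,
    Functor.associator_inv_app, Functor.leftUnitor_hom_app, Functor.rightUnitor_hom_app,
    Category.comp_id, Category.id_comp, Iso.trans_inv, Iso.refl_inv,
    Functor.comp_obj, Functor.id_obj]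
  simp only [Functor.map_comp, Category.assoc] at h2 ⊢
  rw [← h2]
  simp only [← Functor.map_comp_assoc]
  congr 2
  rw [h3, reassoc_of% h4]

/-- `Φ⁻¹(w_X) : Φ⁻¹ X ⟶ Φ⁻¹ Φ X ≅ X`. -/
def wInv (Φ : A ≌ A) (w : 𝟭 A ⟶ Φ.functor) (X : A) : Φ.inverse.obj X ⟶ X :=
  Φ.inverse.map (w.app X) ≫ Φ.unitIso.inv.app X

theorem wInv_naturality (Φ : A ≌ A) (w : 𝟭 A ⟶ Φ.functor) {X Y : A} (f : X ⟶ Y) :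
    wInv Φ w X ≫ f = Φ.inverse.map f ≫ wInv Φ w Y := by
  have h1 := w.naturality f
  have h2 := Φ.unitIso.inv.naturality f
  simp only [Functor.comp_obj, Functor.id_obj, Functor.comp_map, Functor.id_map] at h1 h2
  simp only [wInv, Category.assoc, ← Functor.map_comp_assoc, h1]
  rw [← h2, Functor.map_comp_assoc]

theorem wInv_pow (Φ : A ≌ A) (w : 𝟭 A ⟶ Φ.functor)
    (hw : ∀ X, w.app (Φ.functor.obj X) = Φ.functor.map (w.app X)) {j k : ℤ} (h : j + 1 = k)
    (X : A) : wInv Φ w ((Φ ^ k).functor.obj X) =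
      (mulInvIso Φ h).hom.app X ≫ (invMulIso Φ h).inv.app X ≫
        (Φ ^ k).functor.map (wInv Φ w X) := by
  subst h
  have h1 := pow_w Φ w hw j X
  have h2 := (powBefore Φ j).hom.naturality (wInv Φ w X)
  have h3 : Φ.counitIso.inv.app X ≫ Φ.functor.map (wInv Φ w X) = w.app X := by
    have := Φ.counitIso.inv.naturality (w.app X)
    simp only [wInv, Functor.map_comp, Functor.comp_obj, Functor.id_obj, Functor.comp_map,
      Functor.id_map] at this ⊢
    rw [← reassoc_of% this]
    simp
  have h4 := w.naturality ((powAfter Φ j).hom.app X)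
  have h5 := Φ.unitIso.inv.naturality (w.app ((Φ ^ j).functor.obj X) ≫ (powAfter Φ j).hom.app X)
  simp only [Functor.comp_obj, Functor.id_obj, Functor.comp_map, Functor.id_map] at h2 h4 h5
  simp only [mulInvIso, invMulIso, mulIso, powEq, eqToIso_refl, Iso.trans_hom, Iso.symm_hom,
    Functor.isoWhiskerLeft_hom, Functor.isoWhiskerRight_hom, Iso.refl_hom, NatTrans.comp_app,
    Functor.whiskerLeft_app, Functor.whiskerRight_app, Functor.associator_hom_app,
    Functor.leftUnitor_inv_app, Functor.rightUnitor_hom_app,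
    Category.comp_id, Category.id_comp, Iso.trans_inv, Iso.refl_inv,
    Functor.comp_obj, Functor.id_obj, Iso.symm_inv, Functor.isoWhiskerLeft_inv,
    Functor.isoWhiskerRight_inv, Category.assoc]
  rw [← h2, ← Functor.map_comp_assoc, h3, h1, ← h5, ← Functor.map_comp_assoc, wInv]
  congr 2
  rw [Functor.map_comp, ← hw, ← h4, Iso.inv_hom_id_app_assoc]


theorem mulInv_powEq (Φ : A ≌ A) {j j' k : ℤ} (h : j + 1 = k) (e : j = j') (h' : j' + 1 = k)
    (X : A) : (mulInvIso Φ h).hom.app X ≫ (powEq Φ e).hom.app X = (mulInvIso Φ h').hom.app X := by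
  subst e
  exact Category.comp_id _

theorem inv_coh' (Φ : A ≌ A) {i j j' k : ℤ} (e : j' = j) (h : i + 1 = j) (h' : j' + 1 = k)
    (h'' : j + 1 = k) (X : A) :
    Φ.inverse.map ((invMulIso Φ h').inv.app X) ≫ (mulInvIso Φ h'').hom.app (Φ.inverse.obj X) =
      Φ.inverse.map ((powEq Φ e).hom.app X) ≫ (mulInvIso Φ h).hom.app X ≫
        (invMulIso Φ h).inv.app X := by
  subst e
  have h1 := inv_coh Φ h h' X
  have h2 : Φ.inverse.map ((powEq Φ (Eq.refl j')).hom.app X) = 𝟙 _ :=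
    Φ.inverse.map_id _
  rw [h2, Category.id_comp,
    ← cancel_mono ((invMulIso Φ h).hom.app X), Category.assoc, ← h1, Category.assoc,
    Iso.inv_hom_id_app, Category.comp_id, ← Functor.map_comp_assoc, Iso.inv_hom_id_app,
    Φ.inverse.map_id, Category.id_comp]

/-! ### Factorizations -/

/-- An autoequivalence `Φ` of `A` with a natural transformation `w : Id ⟶ Φ` such that
`w_{Φ(X)} = Φ(w_X)`. -/
structure Potential (A : Type u) [Category.{v} A] where
  Φ : A ≌ A
  w : 𝟭 A ⟶ Φ.functor
  w_comm : ∀ X : A, w.app (Φ.functor.obj X) = Φ.functor.map (w.app X)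

/-- A factorization `Φ⁻¹(E⁰) ⟶ E⁻¹ ⟶ E⁰` of `w`; here `neg` is `E⁻¹` and `zero` is `E⁰`. The
canonical isomorphisms `Φ⁻¹(Φ(E⁰)) ≅ E⁰` and `E⁰ ≅ Φ(Φ⁻¹(E⁰))` are inserted where needed. -/
structure Factorization (W : Potential A) where
  neg : A
  zero : A
  φneg : W.Φ.inverse.obj zero ⟶ neg
  φzero : neg ⟶ zero
  φneg_φzero : φneg ≫ φzero = W.Φ.inverse.map (W.w.app zero) ≫ W.Φ.unitIso.inv.app zero
  φzero_φneg : φzero ≫ W.Φ.counitIso.inv.app zero ≫ W.Φ.functor.map φneg = W.w.app neg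

variable {W : Potential A}

theorem Factorization.inverse_map_mate {X Y : A} (f : W.Φ.inverse.obj Y ⟶ X) :
    W.Φ.inverse.map (W.Φ.counitIso.inv.app Y ≫ W.Φ.functor.map f) ≫
      W.Φ.unitIso.inv.app X = f := by
  have h2 := W.Φ.unitIso.inv.naturality f
  simp only [Functor.comp_obj, Functor.id_obj, Functor.comp_map, Functor.id_map] at h2
  have h3 : W.Φ.inverse.map (W.Φ.counitIso.inv.app Y) ≫
      W.Φ.unitIso.inv.app (W.Φ.inverse.obj Y) = 𝟙 _ := by
    simp
  simp only [Functor.map_comp, Category.assoc]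
  rw [h2, reassoc_of% h3]

theorem Factorization.φzero_φneg_iff {X Y : A} (f : W.Φ.inverse.obj Y ⟶ X) (g : X ⟶ Y) :
    g ≫ W.Φ.counitIso.inv.app Y ≫ W.Φ.functor.map f = W.w.app X ↔
      W.Φ.inverse.map g ≫ f = wInv W.Φ W.w X := by
  rw [← Factorization.inverse_map_mate f, ← Functor.map_comp_assoc, Factorization.inverse_map_mate, wInv, cancel_mono]
  exact W.Φ.inverse.map_injective.eq_iff.symm

namespace Factorization

/-- Morphisms of factorizations. -/
@[ext]
structure Hom (E F : Factorization W) where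
  neg : E.neg ⟶ F.neg
  zero : E.zero ⟶ F.zero
  comm_neg : E.φneg ≫ neg = W.Φ.inverse.map zero ≫ F.φneg
  comm_zero : E.φzero ≫ zero = neg ≫ F.φzero

instance : Category (Factorization W) where
  Hom := Hom
  id E := { neg := 𝟙 _, zero := 𝟙 _, comm_neg := by simp, comm_zero := by simp }
  comp f g :=
    { neg := f.neg ≫ g.neg
      zero := f.zero ≫ g.zero
      comm_neg := by
        rw [← Category.assoc, f.comm_neg, Category.assoc, g.comm_neg, Functor.map_comp,
          Category.assoc]
      comm_zero := by
        rw [← Category.assoc, f.comm_zero, Category.assoc, g.comm_zero, Category.assoc] }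
  id_comp f := by apply Hom.ext <;> exact Category.id_comp _
  comp_id f := by apply Hom.ext <;> exact Category.comp_id _
  assoc f g h := by apply Hom.ext <;> exact Category.assoc _ _ _

end Factorization

section Abelian
variable [Abelian A]

instance additive_functor (e : A ≌ A) : e.functor.Additive :=
  Functor.additive_of_preserves_binary_products _

instance additive_inverse (e : A ≌ A) : e.inverse.Additive :=
  Functor.additive_of_preserves_binary_products _

instance : HasZeroMorphisms (Factorization W) where
  zero E F := ⟨{ neg := 0, zero := 0, comm_neg := by simp, comm_zero := by simp }⟩
  comp_zero f G := by apply Factorization.Hom.ext <;> exact comp_zero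
  zero_comp E F G f := by apply Factorization.Hom.ext <;> exact zero_comp

namespace Factorization

/-- The shift `E[1] = (E⁰, Φ(E⁻¹), -φ⁰, -Φ(φ⁻¹))`. -/
def shift (E : Factorization W) : Factorization W where
  neg := E.zero
  zero := W.Φ.functor.obj E.neg
  φneg := -(W.Φ.unitIso.inv.app E.neg ≫ E.φzero)
  φzero := -(W.Φ.counitIso.inv.app E.zero ≫ W.Φ.functor.map E.φneg)
  φneg_φzero := by
    rw [Preadditive.neg_comp, Preadditive.comp_neg, neg_neg, Category.assoc, E.φzero_φneg]
    exact (W.Φ.unitIso.inv.naturality (W.w.app E.neg)).symm.trans (by rw [W.w_comm]; rfl)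
  φzero_φneg := by
    rw [Factorization.φzero_φneg_iff]
    have h := Factorization.inverse_map_mate E.φneg
    rw [Functor.map_neg, Preadditive.neg_comp, Preadditive.comp_neg, neg_neg, reassoc_of% h,
      E.φneg_φzero]
    rfl

/-- The cone `C(g) = (E⁰ ⊕ F⁻¹, Φ(E⁻¹) ⊕ F⁰)` of a morphism `g : E ⟶ F`. -/
def cone {E F : Factorization W} (g : E ⟶ F) : Factorization W where
  neg := E.zero ⊞ F.neg
  zero := W.Φ.functor.obj E.neg ⊞ F.zero
  φneg := biprod.lift
    (W.Φ.inverse.map biprod.fst ≫ (-(W.Φ.unitIso.inv.app E.neg ≫ E.φzero)))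
    (W.Φ.inverse.map biprod.fst ≫ W.Φ.unitIso.inv.app E.neg ≫ g.neg +
      W.Φ.inverse.map biprod.snd ≫ F.φneg)
  φzero := biprod.lift
    (biprod.fst ≫ (-(W.Φ.counitIso.inv.app E.zero ≫ W.Φ.functor.map E.φneg)))
    (biprod.fst ≫ g.zero + biprod.snd ≫ F.φzero)
  φneg_φzero := by
    change _ = wInv W.Φ W.w _
    have h1 : (-(W.Φ.unitIso.inv.app E.neg ≫ E.φzero)) ≫
      (-(W.Φ.counitIso.inv.app E.zero ≫ W.Φ.functor.map E.φneg)) = wInv W.Φ W.w _ :=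
      E.shift.φneg_φzero
    have h2 : F.φneg ≫ F.φzero = wInv W.Φ W.w _ := F.φneg_φzero
    have h := g.comm_zero
    ext
    · rw [Category.assoc, biprod.lift_fst, biprod.lift_fst_assoc, Category.assoc, h1,
        wInv_naturality]
    · rw [Category.assoc, biprod.lift_snd, Preadditive.comp_add, biprod.lift_fst_assoc,
        biprod.lift_snd_assoc, Preadditive.add_comp, Category.assoc, Category.assoc,
        Category.assoc, Category.assoc, h2, wInv_naturality, ← h]
      simp
  φzero_φneg := by
    rw [Factorization.φzero_φneg_iff]
    have h1 : W.Φ.inverse.map (-(W.Φ.counitIso.inv.app E.zero ≫ W.Φ.functor.map E.φneg)) ≫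
      (-(W.Φ.unitIso.inv.app E.neg ≫ E.φzero)) = wInv W.Φ W.w _ :=
      (Factorization.φzero_φneg_iff _ _).1 E.shift.φzero_φneg
    have h2 := (Factorization.φzero_φneg_iff _ _).1 F.φzero_φneg
    have h := g.comm_neg
    have h3 := Factorization.inverse_map_mate E.φneg
    ext
    · rw [Category.assoc, biprod.lift_fst, ← Functor.map_comp_assoc, biprod.lift_fst,
        Functor.map_comp, Category.assoc, h1, wInv_naturality]
      rfl
    · rw [Category.assoc, biprod.lift_snd, Preadditive.comp_add, ← Functor.map_comp_assoc,
        biprod.lift_fst, ← Functor.map_comp_assoc, biprod.lift_snd, Functor.map_add,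
        Preadditive.add_comp, Functor.map_comp, Functor.map_comp, Functor.map_comp,
        Category.assoc, Category.assoc, Category.assoc, h2, wInv_naturality, ← h,
        Functor.map_neg, Preadditive.neg_comp, reassoc_of% h3]
      simp

end Factorization

theorem d_neg_comp (K : CochainComplex (Factorization W) ℤ) (i j k : ℤ) : (K.d i j).neg ≫ (K.d j k).neg = 0 :=
  congrArg Factorization.Hom.neg (K.d_comp_d i j k)
theorem d_zero_comp (K : CochainComplex (Factorization W) ℤ) (i j k : ℤ) : (K.d i j).zero ≫ (K.d j k).zero = 0 :=
  congrArg Factorization.Hom.zero (K.d_comp_d i j k)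

section Products
variable [HasProducts.{v} A]

instance hasProductsOfShape_int : HasProductsOfShape ℤ A :=
  has_smallest_products_of_hasProducts.{v} ℤ

/-- `tot^∏(X)⁻¹ = ∏_l Φ^(-l)(X⁻¹_{2l}) × ∏_l Φ^(-l-1)(X⁰_{2l+1})` for two families `Xn = X⁻¹` and
`Xz = X⁰` of objects indexed by `ℤ`. -/
def totNeg (W : Potential A) (Xn Xz : ℤ → A) : A :=
  (∏ᶜ fun l : ℤ => (W.Φ ^ (-l)).functor.obj (Xn (2 * l))) ⊞
    (∏ᶜ fun l : ℤ => (W.Φ ^ (-l - 1)).functor.obj (Xz (2 * l + 1)))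

/-- `tot^∏(X)⁰ = ∏_l Φ^(-l)(X⁰_{2l}) × ∏_l Φ^(-l)(X⁻¹_{2l+1})`. -/
def totZero (W : Potential A) (Xn Xz : ℤ → A) : A :=
  (∏ᶜ fun l : ℤ => (W.Φ ^ (-l)).functor.obj (Xz (2 * l))) ⊞
    (∏ᶜ fun l : ℤ => (W.Φ ^ (-l)).functor.obj (Xn (2 * l + 1)))

section
variable (W) (Xn Xz : ℤ → A) (l : ℤ)

/-! Projections onto, and inclusions of, the factors of even (`E`) index `2l` and of odd (`O`)
index `2l + 1`. -/

def πnegE : totNeg W Xn Xz ⟶ (W.Φ ^ (-l)).functor.obj (Xn (2 * l)) :=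
  biprod.fst ≫ Pi.π _ l

def πnegO : totNeg W Xn Xz ⟶ (W.Φ ^ (-l - 1)).functor.obj (Xz (2 * l + 1)) :=
  biprod.snd ≫ Pi.π _ l

def πzeroE : totZero W Xn Xz ⟶ (W.Φ ^ (-l)).functor.obj (Xz (2 * l)) :=
  biprod.fst ≫ Pi.π _ l

def πzeroO : totZero W Xn Xz ⟶ (W.Φ ^ (-l)).functor.obj (Xn (2 * l + 1)) :=
  biprod.snd ≫ Pi.π _ l

def ιnegE : (W.Φ ^ (-l)).functor.obj (Xn (2 * l)) ⟶ totNeg W Xn Xz :=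
  Pi.ι (fun l : ℤ => (W.Φ ^ (-l)).functor.obj (Xn (2 * l))) l ≫ biprod.inl

def ιnegO : (W.Φ ^ (-l - 1)).functor.obj (Xz (2 * l + 1)) ⟶ totNeg W Xn Xz :=
  Pi.ι (fun l : ℤ => (W.Φ ^ (-l - 1)).functor.obj (Xz (2 * l + 1))) l ≫ biprod.inr

def ιzeroE : (W.Φ ^ (-l)).functor.obj (Xz (2 * l)) ⟶ totZero W Xn Xz :=
  Pi.ι (fun l : ℤ => (W.Φ ^ (-l)).functor.obj (Xz (2 * l))) l ≫ biprod.inl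

def ιzeroO : (W.Φ ^ (-l)).functor.obj (Xn (2 * l + 1)) ⟶ totZero W Xn Xz :=
  Pi.ι (fun l : ℤ => (W.Φ ^ (-l)).functor.obj (Xn (2 * l + 1))) l ≫ biprod.inr
end

def totNegLift {Xn Xz : ℤ → A} {Z : A} (fE : ∀ l : ℤ, Z ⟶ (W.Φ ^ (-l)).functor.obj (Xn (2 * l)))
    (fO : ∀ l : ℤ, Z ⟶ (W.Φ ^ (-l - 1)).functor.obj (Xz (2 * l + 1))) : Z ⟶ totNeg W Xn Xz :=
  biprod.lift (Pi.lift fE) (Pi.lift fO)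

def totZeroLift {Xn Xz : ℤ → A} {Z : A} (fE : ∀ l : ℤ, Z ⟶ (W.Φ ^ (-l)).functor.obj (Xz (2 * l)))
    (fO : ∀ l : ℤ, Z ⟶ (W.Φ ^ (-l)).functor.obj (Xn (2 * l + 1))) : Z ⟶ totZero W Xn Xz :=
  biprod.lift (Pi.lift fE) (Pi.lift fO)

section
variable {Xn Xz : ℤ → A} {Z : A}

theorem totNegLift_πE (fE : ∀ l : ℤ, Z ⟶ (W.Φ ^ (-l)).functor.obj (Xn (2 * l)))
    (fO : ∀ l : ℤ, Z ⟶ (W.Φ ^ (-l - 1)).functor.obj (Xz (2 * l + 1))) (l : ℤ) :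
    totNegLift fE fO ≫ πnegE W Xn Xz l = fE l := by
  have h : biprod.lift (Pi.lift fE) (Pi.lift fO) ≫ biprod.fst ≫ Pi.π _ l = fE l := by simp
  exact h

theorem totNegLift_πO (fE : ∀ l : ℤ, Z ⟶ (W.Φ ^ (-l)).functor.obj (Xn (2 * l)))
    (fO : ∀ l : ℤ, Z ⟶ (W.Φ ^ (-l - 1)).functor.obj (Xz (2 * l + 1))) (l : ℤ) :
    totNegLift fE fO ≫ πnegO W Xn Xz l = fO l := by
  have h : biprod.lift (Pi.lift fE) (Pi.lift fO) ≫ biprod.snd ≫ Pi.π _ l = fO l := by simp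
  exact h

theorem totZeroLift_πE (fE : ∀ l : ℤ, Z ⟶ (W.Φ ^ (-l)).functor.obj (Xz (2 * l)))
    (fO : ∀ l : ℤ, Z ⟶ (W.Φ ^ (-l)).functor.obj (Xn (2 * l + 1))) (l : ℤ) :
    totZeroLift fE fO ≫ πzeroE W Xn Xz l = fE l := by
  have h : biprod.lift (Pi.lift fE) (Pi.lift fO) ≫ biprod.fst ≫ Pi.π _ l = fE l := by simp
  exact h

theorem totZeroLift_πO (fE : ∀ l : ℤ, Z ⟶ (W.Φ ^ (-l)).functor.obj (Xz (2 * l)))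
    (fO : ∀ l : ℤ, Z ⟶ (W.Φ ^ (-l)).functor.obj (Xn (2 * l + 1))) (l : ℤ) :
    totZeroLift fE fO ≫ πzeroO W Xn Xz l = fO l := by
  have h : biprod.lift (Pi.lift fE) (Pi.lift fO) ≫ biprod.snd ≫ Pi.π _ l = fO l := by simp
  exact h

theorem totNeg_ext {f g : Z ⟶ totNeg W Xn Xz}
    (hE : ∀ l, f ≫ πnegE W Xn Xz l = g ≫ πnegE W Xn Xz l)
    (hO : ∀ l, f ≫ πnegO W Xn Xz l = g ≫ πnegO W Xn Xz l) : f = g := by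
  apply biprod.hom_ext <;> apply Pi.hom_ext <;> intro l <;>
    refine (Category.assoc _ _ _).trans (Eq.trans ?_ (Category.assoc _ _ _).symm)
  · exact hE l
  · exact hO l

theorem totZero_ext {f g : Z ⟶ totZero W Xn Xz}
    (hE : ∀ l, f ≫ πzeroE W Xn Xz l = g ≫ πzeroE W Xn Xz l)
    (hO : ∀ l, f ≫ πzeroO W Xn Xz l = g ≫ πzeroO W Xn Xz l) : f = g := by
  apply biprod.hom_ext <;> apply Pi.hom_ext <;> intro l <;>
    refine (Category.assoc _ _ _).trans (Eq.trans ?_ (Category.assoc _ _ _).symm)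
  · exact hE l
  · exact hO l

end

section
variable (K : CochainComplex (Factorization W) ℤ)

/-- The morphism `φ⁻¹` of the `∏`-totalization of a complex of factorizations. -/
def totφneg :
    W.Φ.inverse.obj (totZero W (fun n => (K.X n).neg) (fun n => (K.X n).zero)) ⟶
      totNeg W (fun n => (K.X n).neg) (fun n => (K.X n).zero) :=
  totNegLift
    (fun l =>
      W.Φ.inverse.map (πzeroE W _ _ l) ≫
          (mulInvIso W.Φ (show -l - 1 + 1 = -l by lia)).hom.app _ ≫
          (invMulIso W.Φ (show -l - 1 + 1 = -l by lia)).inv.app _ ≫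
          (W.Φ ^ (-l)).functor.map (K.X (2 * l)).φneg +
        W.Φ.inverse.map (πzeroO W _ _ (l - 1)) ≫
          (mulInvIso W.Φ (show -l + 1 = -(l - 1) by lia)).hom.app _ ≫
          (W.Φ ^ (-l)).functor.map (K.d (2 * (l - 1) + 1) (2 * l)).neg)
    (fun l =>
      -(W.Φ.inverse.map (πzeroO W _ _ l) ≫
          (mulInvIso W.Φ (show -l - 1 + 1 = -l by lia)).hom.app _ ≫
          (W.Φ ^ (-l - 1)).functor.map (K.X (2 * l + 1)).φzero) +
        W.Φ.inverse.map (πzeroE W _ _ l) ≫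
          (mulInvIso W.Φ (show -l - 1 + 1 = -l by lia)).hom.app _ ≫
          (W.Φ ^ (-l - 1)).functor.map (K.d (2 * l) (2 * l + 1)).zero)

/-- The morphism `φ⁰` of the `∏`-totalization of a complex of factorizations. -/
def totφzero :
    totNeg W (fun n => (K.X n).neg) (fun n => (K.X n).zero) ⟶
      totZero W (fun n => (K.X n).neg) (fun n => (K.X n).zero) :=
  totZeroLift
    (fun l =>
      πnegE W _ _ l ≫ (W.Φ ^ (-l)).functor.map (K.X (2 * l)).φzero +
        πnegO W _ _ (l - 1) ≫ (powEq W.Φ (show -(l - 1) - 1 = -l by lia)).hom.app _ ≫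
          (W.Φ ^ (-l)).functor.map (K.d (2 * (l - 1) + 1) (2 * l)).zero)
    (fun l =>
      -(πnegO W _ _ l ≫ (invMulIso W.Φ (show -l - 1 + 1 = -l by lia)).inv.app _ ≫
          (W.Φ ^ (-l)).functor.map (K.X (2 * l + 1)).φneg) +
        πnegE W _ _ l ≫ (W.Φ ^ (-l)).functor.map (K.d (2 * l) (2 * l + 1)).neg)

theorem totφneg_πE (l : ℤ) : totφneg K ≫ πnegE W _ _ l =
    W.Φ.inverse.map (πzeroE W _ _ l) ≫
          (mulInvIso W.Φ (show -l - 1 + 1 = -l by lia)).hom.app _ ≫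
          (invMulIso W.Φ (show -l - 1 + 1 = -l by lia)).inv.app _ ≫
          (W.Φ ^ (-l)).functor.map (K.X (2 * l)).φneg +
        W.Φ.inverse.map (πzeroO W _ _ (l - 1)) ≫
          (mulInvIso W.Φ (show -l + 1 = -(l - 1) by lia)).hom.app _ ≫
          (W.Φ ^ (-l)).functor.map (K.d (2 * (l - 1) + 1) (2 * l)).neg := by
  rw [totφneg, totNegLift_πE]

theorem totφneg_πO (l : ℤ) : totφneg K ≫ πnegO W _ _ l =
      -(W.Φ.inverse.map (πzeroO W _ _ l) ≫
          (mulInvIso W.Φ (show -l - 1 + 1 = -l by lia)).hom.app _ ≫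
          (W.Φ ^ (-l - 1)).functor.map (K.X (2 * l + 1)).φzero) +
        W.Φ.inverse.map (πzeroE W _ _ l) ≫
          (mulInvIso W.Φ (show -l - 1 + 1 = -l by lia)).hom.app _ ≫
          (W.Φ ^ (-l - 1)).functor.map (K.d (2 * l) (2 * l + 1)).zero := by
  rw [totφneg, totNegLift_πO]

theorem totφzero_πE (l : ℤ) : totφzero K ≫ πzeroE W _ _ l =
      πnegE W _ _ l ≫ (W.Φ ^ (-l)).functor.map (K.X (2 * l)).φzero +
        πnegO W _ _ (l - 1) ≫ (powEq W.Φ (show -(l - 1) - 1 = -l by lia)).hom.app _ ≫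
          (W.Φ ^ (-l)).functor.map (K.d (2 * (l - 1) + 1) (2 * l)).zero := by
  rw [totφzero, totZeroLift_πE]

theorem totφzero_πO (l : ℤ) : totφzero K ≫ πzeroO W _ _ l =
      -(πnegO W _ _ l ≫ (invMulIso W.Φ (show -l - 1 + 1 = -l by lia)).inv.app _ ≫
          (W.Φ ^ (-l)).functor.map (K.X (2 * l + 1)).φneg) +
        πnegE W _ _ l ≫ (W.Φ ^ (-l)).functor.map (K.d (2 * l) (2 * l + 1)).neg := by
  rw [totφzero, totZeroLift_πO]

theorem tot_rel1 : totφneg K ≫ totφzero K = wInv W.Φ W.w _ := by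
  apply totZero_ext <;> intro l
  · have hw : (K.X (2 * l)).φneg ≫ (K.X (2 * l)).φzero = wInv W.Φ W.w _ :=
      (K.X (2 * l)).φneg_φzero
    have hc := (K.d (2 * (l - 1) + 1) (2 * l)).comm_zero
    rw [Category.assoc, totφzero_πE, Preadditive.comp_add, reassoc_of% totφneg_πE K l, reassoc_of% totφneg_πO K (l - 1),
      Preadditive.add_comp, Preadditive.add_comp, wInv_naturality,
      wInv_pow W.Φ W.w W.w_comm (show -l - 1 + 1 = -l by lia), ← hw]
    have e1 := (powEq W.Φ (show -(l - 1) - 1 = -l by lia)).hom.naturality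
      (K.X (2 * (l - 1) + 1)).φzero
    have e2 := (powEq W.Φ (show -(l - 1) - 1 = -l by lia)).hom.naturality
      (K.d (2 * (l - 1)) (2 * (l - 1) + 1)).zero
    have e3 := mulInv_powEq W.Φ (show -(l - 1) - 1 + 1 = -(l - 1) by lia)
      (show -(l - 1) - 1 = -l by lia) (show -l + 1 = -(l - 1) by lia)
      (K.X (2 * (l - 1) + 1)).neg
    simp only [Category.assoc, Preadditive.neg_comp, reassoc_of% e1, reassoc_of% e2,
      reassoc_of% e3, ← Functor.map_comp, d_zero_comp, hc]
    simp
  · have hw := (Factorization.φzero_φneg_iff _ _).1 (K.X (2 * l + 1)).φzero_φneg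
    have hc := (K.d (2 * l) (2 * l + 1)).comm_neg
    rw [Category.assoc, totφzero_πO, Preadditive.comp_add, Preadditive.comp_neg, reassoc_of% totφneg_πE K l, reassoc_of% totφneg_πO K l,
      Preadditive.add_comp, Preadditive.add_comp, wInv_naturality,
      wInv_pow W.Φ W.w W.w_comm (show -l - 1 + 1 = -l by lia), ← hw]
    have e1 := (invMulIso W.Φ (show -l - 1 + 1 = -l by lia)).inv.naturality
      (K.X (2 * l + 1)).φzero
    have e2 := (invMulIso W.Φ (show -l - 1 + 1 = -l by lia)).inv.naturality
      (K.d (2 * l) (2 * l + 1)).zero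
    simp only [Functor.comp_map] at e1 e2
    simp only [Category.assoc, Preadditive.neg_comp, reassoc_of% e1, reassoc_of% e2,
      ← Functor.map_comp, d_neg_comp, hc]
    simp

theorem tot_rel2 : W.Φ.inverse.map (totφzero K) ≫ totφneg K = wInv W.Φ W.w _ := by
  apply totNeg_ext <;> intro l
  · have hw := (Factorization.φzero_φneg_iff _ _).1 (K.X (2 * l)).φzero_φneg
    have hc := (K.d (2 * (l - 1) + 1) (2 * l)).comm_neg
    rw [Category.assoc, totφneg_πE, Preadditive.comp_add, ← Functor.map_comp_assoc, ← Functor.map_comp_assoc, totφzero_πE, totφzero_πO,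
      Functor.map_add, Functor.map_add, Functor.map_neg,
      Preadditive.add_comp, Preadditive.add_comp, wInv_naturality,
      wInv_pow W.Φ W.w W.w_comm (show -l - 1 + 1 = -l by lia), ← hw]
    have e1 := (mulInvIso W.Φ (show -l - 1 + 1 = -l by lia)).hom.naturality
      (K.X (2 * l)).φzero
    have e2 := (invMulIso W.Φ (show -l - 1 + 1 = -l by lia)).inv.naturality
      (K.X (2 * l)).φzero
    have e3 := (mulInvIso W.Φ (show -l - 1 + 1 = -l by lia)).hom.naturality
      (K.d (2 * (l - 1) + 1) (2 * l)).zero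
    have e4 := (invMulIso W.Φ (show -l - 1 + 1 = -l by lia)).inv.naturality
      (K.d (2 * (l - 1) + 1) (2 * l)).zero
    have e5 := (mulInvIso W.Φ (show -l + 1 = -(l - 1) by lia)).hom.naturality
      (K.X (2 * (l - 1) + 1)).φneg
    have e6 := (mulInvIso W.Φ (show -l + 1 = -(l - 1) by lia)).hom.naturality
      (K.d (2 * (l - 1)) (2 * (l - 1) + 1)).neg
    have e7 := inv_coh' W.Φ (show -(l - 1) - 1 = -l by lia) (show -l - 1 + 1 = -l by lia)
      (show -(l - 1) - 1 + 1 = -(l - 1) by lia) (show -l + 1 = -(l - 1) by lia)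
      (K.X (2 * (l - 1) + 1)).zero
    simp only [Functor.comp_map] at e1 e2 e3 e4 e5 e6
    simp only [Category.assoc, Functor.map_comp, Preadditive.neg_comp]
    rw [reassoc_of% e1, reassoc_of% e2, reassoc_of% e3, reassoc_of% e4, reassoc_of% e5,
      reassoc_of% e6, reassoc_of% e7]
    simp only [← Functor.map_comp, d_neg_comp, hc]
    simp
  · have hw : (K.X (2 * l + 1)).φneg ≫ (K.X (2 * l + 1)).φzero = wInv W.Φ W.w _ :=
      (K.X (2 * l + 1)).φneg_φzero
    have hc := (K.d (2 * l) (2 * l + 1)).comm_zero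
    rw [Category.assoc, totφneg_πO, Preadditive.comp_add, Preadditive.comp_neg,
      ← Functor.map_comp_assoc, ← Functor.map_comp_assoc, totφzero_πE, totφzero_πO,
      Functor.map_add, Functor.map_add, Functor.map_neg,
      Preadditive.add_comp, Preadditive.add_comp, wInv_naturality,
      wInv_pow W.Φ W.w W.w_comm (show -l - 2 + 1 = -l - 1 by lia), ← hw]
    have e1 := (mulInvIso W.Φ (show -l - 1 + 1 = -l by lia)).hom.naturality
      (K.X (2 * l)).φzero
    have e2 := (mulInvIso W.Φ (show -l - 1 + 1 = -l by lia)).hom.naturality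
      (K.d (2 * l) (2 * l + 1)).neg
    have e3 := (mulInvIso W.Φ (show -l - 1 + 1 = -l by lia)).hom.naturality
      (K.d (2 * (l - 1) + 1) (2 * l)).zero
    have e4 := (mulInvIso W.Φ (show -l - 1 + 1 = -l by lia)).hom.naturality
      (K.X (2 * l + 1)).φneg
    have e7 := inv_coh' W.Φ (rfl : -l - 1 = -l - 1) (show -l - 2 + 1 = -l - 1 by lia)
      (show -l - 1 + 1 = -l by lia) (show -l - 1 + 1 = -l by lia)
      (K.X (2 * l + 1)).zero
    have e8 : W.Φ.inverse.map ((powEq W.Φ (rfl : -l - 1 = -l - 1)).hom.app (K.X (2 * l + 1)).zero) = 𝟙 _ :=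
      W.Φ.inverse.map_id _
    rw [e8, Category.id_comp] at e7
    simp only [Functor.comp_map] at e1 e2 e3 e4
    simp only [Category.assoc, Functor.map_comp, Preadditive.neg_comp]
    rw [reassoc_of% e1, reassoc_of% e2, reassoc_of% e3, reassoc_of% e4, reassoc_of% e7]
    simp only [← Functor.map_comp, d_zero_comp, hc]
    simp

/-- The `∏`-totalization of a complex of factorizations. For a bounded complex this is its
totalization, as finite products are direct sums. -/
def tot : Factorization W where
  neg := totNeg W (fun n => (K.X n).neg) (fun n => (K.X n).zero)
  zero := totZero W (fun n => (K.X n).neg) (fun n => (K.X n).zero)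
  φneg := totφneg K
  φzero := totφzero K
  φneg_φzero := tot_rel1 K
  φzero_φneg := (Factorization.φzero_φneg_iff _ _).2 (tot_rel2 K)

end
end Products

/-! ### The homotopy category, acyclic factorizations and quasi-isomorphisms -/

/-- The homotopy relation on morphisms of factorizations. -/
def Homotopic (W : Potential A) : HomRel (Factorization W) := fun E F f g =>
  ∃ (hneg : E.neg ⟶ W.Φ.inverse.obj F.zero) (hzero : E.zero ⟶ F.neg),
    f.neg - g.neg = E.φzero ≫ hzero + hneg ≫ F.φneg ∧
    f.zero - g.zero = hzero ≫ F.φzero +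
      show E.zero ⟶ F.zero from W.Φ.counitIso.inv.app E.zero ≫ W.Φ.functor.map E.φneg ≫
        W.Φ.functor.map hneg ≫ W.Φ.counitIso.hom.app F.zero

/-- The homotopy category of factorizations. -/
abbrev KFact (W : Potential A) := CategoryTheory.Quotient (Homotopic W)

/-- The functor from factorizations to the homotopy category. -/
abbrev toK (W : Potential A) : Factorization W ⥤ KFact W := CategoryTheory.Quotient.functor (Homotopic W)

/-- Thick subcategories of the homotopy category: full triangulated subcategories closed under
direct summands (hence under isomorphisms). -/
structure IsThick (N : ObjectProperty (KFact W)) : Prop where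
  zero : ∀ X, IsZero X → N X
  shift : ∀ E : Factorization W, N ((toK W).obj E.shift) ↔ N ((toK W).obj E)
  cone : ∀ {E F : Factorization W} (g : E ⟶ F), N ((toK W).obj E) → N ((toK W).obj F) →
    N ((toK W).obj (Factorization.cone g))
  retract : ∀ {X Y : KFact W}, Retract X Y → N Y → N X

/-- The Verdier quotient of the homotopy category by `N` inverts the morphisms whose cone lies
in `N`. -/
def coneIn (N : ObjectProperty (KFact W)) : MorphismProperty (KFact W) := fun X Y f =>
  ∃ g : X.as ⟶ Y.as, (toK W).map g = f ∧ N ((toK W).obj (Factorization.cone g))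

abbrev VerdierQuotient (N : ObjectProperty (KFact W)) := (coneIn N).Localization

/-- A morphism of factorizations becomes an isomorphism in the Verdier quotient by `N`. -/
def IsQuasiIsoMod (N : ObjectProperty (KFact W)) {E F : Factorization W} (g : E ⟶ F) : Prop :=
  IsIso ((toK W ⋙ ((coneIn N).Q : KFact W ⥤ VerdierQuotient N)).map g)

/-- Bounded exact complexes of factorizations. -/
def IsBoundedExact (K : CochainComplex (Factorization W) ℤ) : Prop :=
  K.Acyclic ∧ ∃ b : ℕ, ∀ n : ℤ, (b : ℤ) < |n| → IsZero (K.X n)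

section Products
variable [HasProducts.{v} A]

/-- Totally acyclic factorizations: the smallest thick subcategory that contains the totalizations
of bounded exact complexes. -/
def totallyAcyclic (W : Potential A) : ObjectProperty (KFact W) := fun X =>
  ∀ N : ObjectProperty (KFact W), IsThick N →
    (∀ K : CochainComplex (Factorization W) ℤ, IsBoundedExact K → N ((toK W).obj (tot K))) → N X

/-- Contra-acyclic factorizations: the smallest thick subcategory that contains the totalizations
of bounded exact complexes and is closed under small products. -/
def contraAcyclic (W : Potential A) : ObjectProperty (KFact W) := fun X =>
  ∀ N : ObjectProperty (KFact W), IsThick N →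
    (∀ J : Type v, N.IsClosedUnderLimitsOfShape (Discrete J)) →
    (∀ K : CochainComplex (Factorization W) ℤ, IsBoundedExact K → N ((toK W).obj (tot K))) → N X

/-- Quasi-isomorphisms: isomorphisms in the absolute derived category. -/
def IsQuasiIso {E F : Factorization W} (g : E ⟶ F) : Prop := IsQuasiIsoMod (totallyAcyclic W) g

/-- Contra-quasi-isomorphisms: isomorphisms in the contra-derived category. -/
def IsContraQuasiIso {E F : Factorization W} (g : E ⟶ F) : Prop := IsQuasiIsoMod (contraAcyclic W) g

/-! ### Foldings -/

section Components
variable {Xn Xz : ℤ → A}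
  (φn : W.Φ.inverse.obj (totZero W Xn Xz) ⟶ totNeg W Xn Xz)
  (φz : totNeg W Xn Xz ⟶ totZero W Xn Xz) (l j : ℤ)

/-! The components `φ⁻¹_{p,q}` and `φ⁰_{p,q}`, where `p` is `2l` (`E`) or `2l + 1` (`O`) and `q` is
`2j` (`E`) or `2j + 1` (`O`). -/

def negOO : (W.Φ ^ (-l - 1)).functor.obj (Xn (2 * l + 1)) ⟶
    (W.Φ ^ (-j - 1)).functor.obj (Xz (2 * j + 1)) :=
  (mulInvIso W.Φ (show -l - 1 + 1 = -l by lia)).inv.app _ ≫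
    W.Φ.inverse.map (ιzeroO W Xn Xz l) ≫ φn ≫ πnegO W Xn Xz j

def negOE : (W.Φ ^ (-l - 1)).functor.obj (Xn (2 * l + 1)) ⟶
    (W.Φ ^ (-j)).functor.obj (Xn (2 * j)) :=
  (mulInvIso W.Φ (show -l - 1 + 1 = -l by lia)).inv.app _ ≫
    W.Φ.inverse.map (ιzeroO W Xn Xz l) ≫ φn ≫ πnegE W Xn Xz j

def negEO : (W.Φ ^ (-l - 1)).functor.obj (Xz (2 * l)) ⟶
    (W.Φ ^ (-j - 1)).functor.obj (Xz (2 * j + 1)) :=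
  (mulInvIso W.Φ (show -l - 1 + 1 = -l by lia)).inv.app _ ≫
    W.Φ.inverse.map (ιzeroE W Xn Xz l) ≫ φn ≫ πnegO W Xn Xz j

def negEE : (W.Φ ^ (-l - 1)).functor.obj (Xz (2 * l)) ⟶
    (W.Φ ^ (-j)).functor.obj (Xn (2 * j)) :=
  (mulInvIso W.Φ (show -l - 1 + 1 = -l by lia)).inv.app _ ≫
    W.Φ.inverse.map (ιzeroE W Xn Xz l) ≫ φn ≫ πnegE W Xn Xz j

def zeroOO : (W.Φ ^ (-l - 1)).functor.obj (Xz (2 * l + 1)) ⟶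
    (W.Φ ^ (-j)).functor.obj (Xn (2 * j + 1)) :=
  ιnegO W Xn Xz l ≫ φz ≫ πzeroO W Xn Xz j

def zeroOE : (W.Φ ^ (-l - 1)).functor.obj (Xz (2 * l + 1)) ⟶
    (W.Φ ^ (-j)).functor.obj (Xz (2 * j)) :=
  ιnegO W Xn Xz l ≫ φz ≫ πzeroE W Xn Xz j

def zeroEO : (W.Φ ^ (-l)).functor.obj (Xn (2 * l)) ⟶
    (W.Φ ^ (-j)).functor.obj (Xn (2 * j + 1)) :=
  ιnegE W Xn Xz l ≫ φz ≫ πzeroO W Xn Xz j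

def zeroEE : (W.Φ ^ (-l)).functor.obj (Xn (2 * l)) ⟶
    (W.Φ ^ (-j)).functor.obj (Xz (2 * j)) :=
  ιnegE W Xn Xz l ≫ φz ≫ πzeroE W Xn Xz j

/-- `φ⁻¹_{p,q} = φ⁰_{p,q} = 0` for all `p` and `q` with `R p q`. -/
structure ComponentsVanish (R : ℤ → ℤ → Prop) : Prop where
  negOO : ∀ l j : ℤ, R (2 * l + 1) (2 * j + 1) → negOO φn l j = 0
  negOE : ∀ l j : ℤ, R (2 * l + 1) (2 * j) → negOE φn l j = 0
  negEO : ∀ l j : ℤ, R (2 * l) (2 * j + 1) → negEO φn l j = 0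
  negEE : ∀ l j : ℤ, R (2 * l) (2 * j) → negEE φn l j = 0
  zeroOO : ∀ l j : ℤ, R (2 * l + 1) (2 * j + 1) → zeroOO φz l j = 0
  zeroOE : ∀ l j : ℤ, R (2 * l + 1) (2 * j) → zeroOE φz l j = 0
  zeroEO : ∀ l j : ℤ, R (2 * l) (2 * j + 1) → zeroEO φz l j = 0
  zeroEE : ∀ l j : ℤ, R (2 * l) (2 * j) → zeroEE φz l j = 0

/-- The `q`-th coordinates of `φ⁻¹` and of `φ⁰` depend only on the coordinates of index
`p ≥ q - 1`: they vanish on generalized elements all of whose coordinates with `p ≥ q - 1` are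
zero. For families that vanish in large degrees these are finitely many coordinates, so that the
morphisms are then given by the matrices of their components. -/
structure IsMatrix : Prop where
  negE : ∀ (j : ℤ) (Z : A) (t : Z ⟶ W.Φ.inverse.obj (totZero W Xn Xz)),
    (∀ l : ℤ, 2 * j - 1 ≤ 2 * l → t ≫ W.Φ.inverse.map (πzeroE W Xn Xz l) = 0) →
    (∀ l : ℤ, 2 * j - 1 ≤ 2 * l + 1 → t ≫ W.Φ.inverse.map (πzeroO W Xn Xz l) = 0) →
    t ≫ φn ≫ πnegE W Xn Xz j = 0
  negO : ∀ (j : ℤ) (Z : A) (t : Z ⟶ W.Φ.inverse.obj (totZero W Xn Xz)),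
    (∀ l : ℤ, 2 * j ≤ 2 * l → t ≫ W.Φ.inverse.map (πzeroE W Xn Xz l) = 0) →
    (∀ l : ℤ, 2 * j ≤ 2 * l + 1 → t ≫ W.Φ.inverse.map (πzeroO W Xn Xz l) = 0) →
    t ≫ φn ≫ πnegO W Xn Xz j = 0
  zeroE : ∀ (j : ℤ) (Z : A) (t : Z ⟶ totNeg W Xn Xz),
    (∀ l : ℤ, 2 * j - 1 ≤ 2 * l → t ≫ πnegE W Xn Xz l = 0) →
    (∀ l : ℤ, 2 * j - 1 ≤ 2 * l + 1 → t ≫ πnegO W Xn Xz l = 0) →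
    t ≫ φz ≫ πzeroE W Xn Xz j = 0
  zeroO : ∀ (j : ℤ) (Z : A) (t : Z ⟶ totNeg W Xn Xz),
    (∀ l : ℤ, 2 * j ≤ 2 * l → t ≫ πnegE W Xn Xz l = 0) →
    (∀ l : ℤ, 2 * j ≤ 2 * l + 1 → t ≫ πnegO W Xn Xz l = 0) →
    t ≫ φz ≫ πzeroO W Xn Xz j = 0

end Components

/-- A `∏`-folding of a pair of complexes `(Cn, Cz) = (C⁻¹, C⁰)`. -/
structure ProdFolding (W : Potential A) (Cn Cz : CochainComplex A ℤ) where
  φneg : W.Φ.inverse.obj (totZero W Cn.X Cz.X) ⟶ totNeg W Cn.X Cz.X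
  φzero : totNeg W Cn.X Cz.X ⟶ totZero W Cn.X Cz.X
  φneg_φzero : φneg ≫ φzero =
    W.Φ.inverse.map (W.w.app (totZero W Cn.X Cz.X)) ≫
      W.Φ.unitIso.inv.app (totZero W Cn.X Cz.X)
  φzero_φneg : φzero ≫ W.Φ.counitIso.inv.app (totZero W Cn.X Cz.X) ≫ W.Φ.functor.map φneg =
    W.w.app (totNeg W Cn.X Cz.X)
  vanish : ComponentsVanish φneg φzero (fun p q => p + 1 < q)
  neg_odd_succ : ∀ l : ℤ, negOE φneg l (l + 1) =
    (W.Φ ^ (-l - 1)).functor.map (Cn.d (2 * l + 1) (2 * (l + 1))) ≫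
      (powEq W.Φ (show -l - 1 = -(l + 1) by lia)).hom.app _
  neg_even_succ : ∀ l : ℤ, negEO φneg l l =
    -(W.Φ ^ (-l - 1)).functor.map (Cz.d (2 * l) (2 * l + 1))
  zero_odd_succ : ∀ l : ℤ, zeroOE φzero l (l + 1) =
    -((W.Φ ^ (-l - 1)).functor.map (Cz.d (2 * l + 1) (2 * (l + 1))) ≫
      (powEq W.Φ (show -l - 1 = -(l + 1) by lia)).hom.app _)
  zero_even_succ : ∀ l : ℤ, zeroEO φzero l l =
    (W.Φ ^ (-l)).functor.map (Cn.d (2 * l) (2 * l + 1))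

/-- The factorization underlying a `∏`-folding. -/
def ProdFolding.fact {Cn Cz : CochainComplex A ℤ} (P : ProdFolding W Cn Cz) : Factorization W where
  neg := totNeg W Cn.X Cz.X
  zero := totZero W Cn.X Cz.X
  φneg := P.φneg
  φzero := P.φzero
  φneg_φzero := P.φneg_φzero
  φzero_φneg := P.φzero_φneg

end Products

/-! ### Resolutions of the components, lifts and null-homotopies -/

/-- The augmentation `P_0 ⟶ X` of a projective resolution of `X`, which we regard as a complex
`⋯ ⟶ P_{-1} ⟶ P_0 ⟶ 0` indexed by `ℤ`. -/
def aug {X : A} (R : ProjectiveResolution X) : R.cochainComplex.X 0 ⟶ X :=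
  R.π'.f 0 ≫ (HomologicalComplex.singleObjXSelf (ComplexShape.up ℤ) 0 X).hom

/-- The chain map `β⁰_j = w_{Φ⁻¹(C⁰_j)} - φ⁰_j φ⁻¹_j : Φ⁻¹(C⁰_j) ⟶ C⁰_j`. -/
def betaZero {Cn Cz : CochainComplex A ℤ}
    (fneg : (W.Φ.inverse.mapHomologicalComplex _).obj Cz ⟶ Cn) (fzero : Cn ⟶ Cz) :
    (W.Φ.inverse.mapHomologicalComplex _).obj Cz ⟶ Cz where
  f j := wInv W.Φ W.w (Cz.X j) -
    show W.Φ.inverse.obj (Cz.X j) ⟶ Cz.X j from fneg.f j ≫ fzero.f j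
  comm' i j _ := by
    have key : ∀ (a : W.Φ.inverse.obj (Cz.X i) ⟶ Cn.X i) (b : W.Φ.inverse.obj (Cz.X j) ⟶ Cn.X j),
        a ≫ Cn.d i j = W.Φ.inverse.map (Cz.d i j) ≫ b →
        W.Φ.inverse.map (Cz.d i j) ≫ (wInv W.Φ W.w (Cz.X j) - b ≫ fzero.f j) =
          (wInv W.Φ W.w (Cz.X i) - a ≫ fzero.f i) ≫ Cz.d i j := by
      intro a b h
      rw [Preadditive.sub_comp, Preadditive.comp_sub, wInv_naturality, Category.assoc,
        fzero.comm, reassoc_of% h]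
    exact (key _ _ (fneg.comm i j)).symm

/-- The chain map `β⁻¹_j = w_{C⁻¹_j} - Φ(φ⁻¹_j) φ⁰_j : C⁻¹_j ⟶ Φ(C⁻¹_j)`. -/
def betaNeg {Cn Cz : CochainComplex A ℤ}
    (fneg : (W.Φ.inverse.mapHomologicalComplex _).obj Cz ⟶ Cn) (fzero : Cn ⟶ Cz) :
    Cn ⟶ (W.Φ.functor.mapHomologicalComplex _).obj Cn where
  f j := (show Cn.X j ⟶ W.Φ.functor.obj (Cn.X j) from W.w.app (Cn.X j)) -
    fzero.f j ≫ W.Φ.counitIso.inv.app (Cz.X j) ≫ W.Φ.functor.map (fneg.f j)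
  comm' i j _ := by
    have key : ∀ (a : W.Φ.inverse.obj (Cz.X i) ⟶ Cn.X i) (b : W.Φ.inverse.obj (Cz.X j) ⟶ Cn.X j),
        a ≫ Cn.d i j = W.Φ.inverse.map (Cz.d i j) ≫ b →
        ((show Cn.X i ⟶ W.Φ.functor.obj (Cn.X i) from W.w.app (Cn.X i)) -
            fzero.f i ≫ W.Φ.counitIso.inv.app (Cz.X i) ≫ W.Φ.functor.map a) ≫
            W.Φ.functor.map (Cn.d i j) =
          Cn.d i j ≫ ((show Cn.X j ⟶ W.Φ.functor.obj (Cn.X j) from W.w.app (Cn.X j)) -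
            fzero.f j ≫ W.Φ.counitIso.inv.app (Cz.X j) ≫ W.Φ.functor.map b) := by
      intro a b h
      have h2 := W.w.naturality (Cn.d i j)
      have h3 := W.Φ.counitIso.inv.naturality (Cz.d i j)
      simp only [Functor.id_map, Functor.comp_map, Functor.id_obj, Functor.comp_obj] at h2 h3
      simp only [Functor.id_obj, Functor.comp_obj, Preadditive.sub_comp, Preadditive.comp_sub,
        Category.assoc]
      rw [h2, ← Functor.map_comp, h, ← fzero.comm_assoc, reassoc_of% h3, Functor.map_comp]
    exact key _ _ (fneg.comm i j)

/-- The choices made for a factorization `E`: projective resolutions `P⁻¹` and `P⁰` of its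
components, lifts `φ⁻¹_• : Φ⁻¹(P⁰) ⟶ P⁻¹` and `φ⁰_• : P⁻¹ ⟶ P⁰` of `φ⁻¹_E` and `φ⁰_E`, and
null-homotopies of `β⁻¹` and `β⁰`. In the latter, `hneg.hom (j + 1) j` is
`h⁻¹_j : P⁻¹_{j+1} ⟶ Φ(P⁻¹_j)` and `hzero.hom (j + 1) j` is `h⁰_j : Φ⁻¹(P⁰_{j+1}) ⟶ P⁰_j`. -/
structure ResolutionData (E : Factorization W) where
  Pneg : ProjectiveResolution E.neg
  Pzero : ProjectiveResolution E.zero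
  fneg : (W.Φ.inverse.mapHomologicalComplex _).obj Pzero.cochainComplex ⟶ Pneg.cochainComplex
  fneg_aug : fneg.f 0 ≫ aug Pneg = W.Φ.inverse.map (aug Pzero) ≫ E.φneg
  fzero : Pneg.cochainComplex ⟶ Pzero.cochainComplex
  fzero_aug : fzero.f 0 ≫ aug Pzero = aug Pneg ≫ E.φzero
  hneg : Homotopy (betaNeg fneg fzero) 0
  hzero : Homotopy (betaZero fneg fzero) 0

/-- The compatibility and square-zero conditions on the homotopies. -/
structure ResolutionData.IsCompatible {E : Factorization W} (D : ResolutionData E) : Prop where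
  hneg_fneg : ∀ p : ℤ, D.fneg.f (p + 1) ≫ D.hneg.hom (p + 1) p =
    D.hzero.hom (p + 1) p ≫ W.Φ.counitIso.inv.app _ ≫ W.Φ.functor.map (D.fneg.f p)
  hzero_fzero : ∀ p : ℤ, D.fzero.f (p + 1) ≫ W.Φ.counitIso.inv.app _ ≫
      W.Φ.functor.map (D.hzero.hom (p + 1) p) =
    D.hneg.hom (p + 1) p ≫ W.Φ.functor.map (D.fzero.f p)
  hneg_hneg : ∀ p : ℤ, D.hneg.hom (p + 1) p ≫ W.Φ.functor.map (D.hneg.hom p (p - 1)) = 0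
  hzero_hzero : ∀ p : ℤ, D.hzero.hom (p + 1) p ≫ W.Φ.counitIso.inv.app _ ≫
    W.Φ.functor.map (D.hzero.hom p (p - 1)) = 0

/-- A projective resolution is finite. -/
def IsFiniteResolution {X : A} (R : ProjectiveResolution X) : Prop :=
  ∃ N : ℕ, ∀ n : ℕ, N ≤ n → IsZero (R.complex.X n)

section Products
variable [HasProducts.{v} A]

/-- The properties required of the folding `P` of the chosen resolutions and of `d₀ : P ⟶ E`. -/
structure IsStrictification {E : Factorization W} (D : ResolutionData E)
    (P : ProdFolding W D.Pneg.cochainComplex D.Pzero.cochainComplex) (d₀ : P.fact ⟶ E) :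
    Prop where
  negOO_diag : ∀ l : ℤ, negOO P.φneg l l = (W.Φ ^ (-l - 1)).functor.map (D.fzero.f (2 * l + 1))
  negEE_diag : ∀ l : ℤ, negEE P.φneg l l =
    (invMulIso W.Φ (show -l - 1 + 1 = -l by lia)).inv.app _ ≫
      (W.Φ ^ (-l)).functor.map (D.fneg.f (2 * l))
  zeroOO_diag : ∀ l : ℤ, zeroOO P.φzero l l =
    (invMulIso W.Φ (show -l - 1 + 1 = -l by lia)).inv.app _ ≫
      (W.Φ ^ (-l)).functor.map (D.fneg.f (2 * l + 1))
  zeroEE_diag : ∀ l : ℤ, zeroEE P.φzero l l = (W.Φ ^ (-l)).functor.map (D.fzero.f (2 * l))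
  negOE_pred : ∀ l : ℤ, negOE P.φneg l l =
    (W.Φ ^ (-l - 1)).functor.map (D.hneg.hom (2 * l + 1) (2 * l)) ≫
      (mulIso W.Φ (show -l - 1 + 1 = -l by lia)).hom.app _
  negEO_pred : ∀ l : ℤ, negEO P.φneg l (l - 1) =
    -((invMulIso W.Φ (show -l - 1 + 1 = -l by lia)).inv.app _ ≫
      (W.Φ ^ (-l)).functor.map (D.hzero.hom (2 * l) (2 * (l - 1) + 1)) ≫
        (powEq W.Φ (show -l = -(l - 1) - 1 by lia)).hom.app _)
  zeroOE_pred : ∀ l : ℤ, zeroOE P.φzero l l =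
    -((invMulIso W.Φ (show -l - 1 + 1 = -l by lia)).inv.app _ ≫
      (W.Φ ^ (-l)).functor.map (D.hzero.hom (2 * l + 1) (2 * l)))
  zeroEO_pred : ∀ l : ℤ, zeroEO P.φzero l (l - 1) =
    (W.Φ ^ (-l)).functor.map (D.hneg.hom (2 * l) (2 * (l - 1) + 1)) ≫
      (mulIso W.Φ (show -l + 1 = -(l - 1) by lia)).hom.app _
  isMatrix : IsMatrix P.φneg P.φzero
  d₀_neg : d₀.neg = πnegE W D.Pneg.cochainComplex.X D.Pzero.cochainComplex.X 0 ≫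
    (powEq W.Φ (show (-0 : ℤ) = 0 by rfl)).hom.app (D.Pneg.cochainComplex.X 0) ≫ aug D.Pneg
  d₀_zero : d₀.zero = πzeroE W D.Pneg.cochainComplex.X D.Pzero.cochainComplex.X 0 ≫
    (powEq W.Φ (show (-0 : ℤ) = 0 by rfl)).hom.app (D.Pzero.cochainComplex.X 0) ≫ aug D.Pzero
  contraQuasiIso : IsContraQuasiIso d₀
  quasiIso : IsFiniteResolution D.Pneg → IsFiniteResolution D.Pzero → IsQuasiIso d₀

end Products
end Abelian

end Factorizations
end

open Factorizations

/-! On pairs of objects put Ω(X⁻¹, X⁰) = (Φ⁻¹(X⁰), X⁻¹) (`unshift`), a square root of Φ⁻¹. A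
factorization is then one object X with one morphism D : ΩX ⟶ X whose square D ∘ Ω(D) is w, that is,
a curved differential. A folding is a matrix of entries ΩQᵢ ⟶ Qⱼ, where Qᵢ is a power of Φ applied
to the terms of degree i of the two resolutions, and all identities to be proved become the single
equation D² = w.

Algebraic half. The prescribed entries are the resolution differentials (degree +1), the lifts
(degree 0) and the null-homotopies (degree -1), with signs that anticommute with Ω. The components
of D² - w that do not lower the degree vanish at once: they say that d² = 0, that the lifts are
chain maps, and that the homotopies are homotopies (`ShiftSystem.matSq_leading`). The components
that lower the degree are killed one after the other by further entries. When all earlier components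
vanish, associativity D·D² = D²·D and naturality of w show that the obstruction is a cycle for the
resolution differential. Since the source is projective and the resolutions are exact, the
obstruction is a boundary, and the new entry absorbs it (`matSq_perturb`,
`ResolutionData.exists_lift_leading`). Under the compatibility conditions there is no obstruction
and no further entry is needed. The infinite matrix defines a morphism of products because entries
raise the degree by at most one and the resolutions vanish in positive degrees, so every row is
finite (`totMatrix_sq`).

Homological half. The totalization of a short exact sequence E ⟶ F ⟶ G is the cone of C(E ⟶ F) ⟶ G
(`exists_retract_tot`), so a thick subcategory that contains totalizations of bounded exact
complexes has the two-out-of-three property along short exact sequences. As d₀ is an epimorphism, it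
remains to treat its kernel. That kernel is filtered by the largest subfactorizations whose
coordinates of degree above -n vanish. Exactness of the resolutions identifies each quotient of the
filtration with a cofree factorization on the cycles in degree -n
(`TwistedResolution.exists_isShortExact`), and cofree factorizations are contractible. For finite
resolutions the filtration is finite and the kernel is totally acyclic. In general the filtration is
complete, because the folding is a product, and a Milnor sequence 0 ⟶ L ⟶ ∏ C(jₙ) ⟶ ∏ C(jₙ) ⟶ 0,
with L the kernel of d₀ and jₙ the inclusion of the n-th step, shows that L is contra-acyclic
(`exists_isShortExact_prodFact`, `mem_of_isCompleteTower`). -/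

noncomputable section
namespace Factorizations

/-! ### Completing a matrix to a curved differential by obstruction theory -/

section Perturbation
variable {B : Type*} [Category B] [Preadditive B] (Ω : B ⥤ B) {I : Type} (e : I ≃ ℤ) {Q : I → B}

/-- The indices whose degree lies in `[a, b]`. -/
def indexIcc (a b : ℤ) : Finset I := (Finset.Icc a b).map e.symm.toEmbedding

/-- The index of the next degree. -/
def nextIndex (i : I) : I := e.symm (e i + 1)

theorem mem_indexIcc {a b : ℤ} {i : I} : i ∈ indexIcc e a b ↔ a ≤ e i ∧ e i ≤ b := by
  simp only [indexIcc, Finset.mem_map_equiv, Equiv.symm_symm, Finset.mem_Icc]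

theorem apply_nextIndex (i : I) : e (nextIndex e i) = e i + 1 := by simp [nextIndex]

theorem eq_nextIndex {i j : I} (h : e j = e i + 1) : j = nextIndex e i :=
  e.injective (h.trans (apply_nextIndex e i).symm)

theorem sum_indexIcc_of_eq_zero {M : Type*} [AddCommMonoid M] {a b a' b' : ℤ} (ha : a ≤ a')
    (hb : b' ≤ b) (f : I → M) (h : ∀ i, e i < a' ∨ b' < e i → f i = 0) :
    ∑ i ∈ indexIcc e a b, f i = ∑ i ∈ indexIcc e a' b', f i := by
  symm
  apply Finset.sum_subset
  · intro i hi
    rw [mem_indexIcc] at hi ⊢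
    lia
  · intro i _ hi
    rw [mem_indexIcc] at hi
    exact h i (by lia)

/-- A lift of `R` along `g` if there is one. -/
def liftAlong {X Y Z : B} (g : Ω.obj Y ⟶ Z) (R : Ω.obj (Ω.obj X) ⟶ Z) : Ω.obj X ⟶ Y :=
  open Classical in if h : ∃ f : Ω.obj X ⟶ Y, Ω.map f ≫ g = R then h.choose else 0

theorem liftAlong_spec {X Y Z : B} (g : Ω.obj Y ⟶ Z) (R : Ω.obj (Ω.obj X) ⟶ Z)
    (h : ∃ f : Ω.obj X ⟶ Y, Ω.map f ≫ g = R) : Ω.map (liftAlong Ω g R) ≫ g = R := by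
  rw [liftAlong, dif_pos h]
  exact h.choose_spec

/-- The components of the square of the matrix `D`. -/
def matSq (D : ∀ i j, Ω.obj (Q i) ⟶ Q j) (a b : ℤ) (i k : I) : Ω.obj (Ω.obj (Q i)) ⟶ Q k :=
  ∑ r ∈ indexIcc e a b, Ω.map (D i r) ≫ D r k

/-- The perturbation of the matrix `D₀` by higher homotopies. -/
def perturb (D₀ : ∀ i j, Ω.obj (Q i) ⟶ Q j) : ∀ i j, Ω.obj (Q i) ⟶ Q j := fun i j =>
  if _h : e i - e j ≤ 1 then D₀ i j else
    -- Objects of positive degree are zero in the application; the value 0 here stops the recursion,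
    -- which moves the source upwards.
    if _h' : 0 < e i then 0 else
      -- In the component of D² from `i` to `nextIndex e j` the unknown entry occurs followed by the
      -- differential out of `j`; the other summands, moved to the right-hand side, prescribe the
      -- value.
      liftAlong Ω (D₀ j (nextIndex e j))
        (-(Ω.map (D₀ i (nextIndex e i)) ≫ perturb D₀ (nextIndex e i) (nextIndex e j) +
          ∑ r ∈ (indexIcc e (e j + 1) (e i)).attach,
            Ω.map (perturb D₀ i r.1) ≫ perturb D₀ r.1 (nextIndex e j)))
-- Every entry on the right-hand side drops the degree by less, except the one from `nextIndex e i`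
-- to `nextIndex e j`, which drops it equally but starts one degree higher.
termination_by i j => ((e i - e j).toNat, (1 - e i).toNat)
decreasing_by
  · simp only [apply_nextIndex, Prod.lex_def]
    lia
  · have := (mem_indexIcc e).1 r.2
    simp only [Prod.lex_def]
    lia
  · have := (mem_indexIcc e).1 r.2
    simp only [apply_nextIndex, Prod.lex_def]
    lia

variable (D₀ : ∀ i j, Ω.obj (Q i) ⟶ Q j)

theorem perturb_of_le {i j : I} (h : e i - e j ≤ 1) : perturb Ω e D₀ i j = D₀ i j := by
  rw [perturb, dif_pos h]

theorem perturb_of_lt {i j : I} (h : 1 < e i - e j) (h' : e i ≤ 0) :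
    perturb Ω e D₀ i j = liftAlong Ω (D₀ j (nextIndex e j))
        (-(Ω.map (D₀ i (nextIndex e i)) ≫ perturb Ω e D₀ (nextIndex e i) (nextIndex e j) +
          ∑ r ∈ indexIcc e (e j + 1) (e i),
            Ω.map (perturb Ω e D₀ i r) ≫ perturb Ω e D₀ r (nextIndex e j))) := by
  rw [perturb, dif_neg (by lia), dif_neg (by lia), ← Finset.sum_attach (indexIcc e _ _)]

/-- The components of a multiple of the identity matrix. -/
def diagMat (w : ∀ X, Ω.obj (Ω.obj X) ⟶ X) (i k : I) : Ω.obj (Ω.obj (Q i)) ⟶ Q k :=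
  open Classical in if h : i = k then w (Q i) ≫ eqToHom (congrArg Q h) else 0

theorem diagMat_self (w : ∀ X, Ω.obj (Ω.obj X) ⟶ X) (i : I) :
    diagMat Ω (Q := Q) w i i = w (Q i) := by
  rw [diagMat, dif_pos rfl]
  exact Category.comp_id _

theorem diagMat_of_ne (w : ∀ X, Ω.obj (Ω.obj X) ⟶ X) {i k : I} (h : i ≠ k) :
    diagMat Ω (Q := Q) w i k = 0 := by
  rw [diagMat, dif_neg h]

variable [Ω.Additive]

/-- Since entries raise the degree by at most one, a path from `i` to `k` can only pass through
degrees between `e k - 1` and `e i + 1`. Squares with different endpoints can thus be summed over a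
common range. -/
theorem matSq_eq (D : ∀ i j, Ω.obj (Q i) ⟶ Q j) (hup : ∀ i j, e i + 1 < e j → D i j = 0)
    {a b : ℤ} {i k : I} (ha : a ≤ e k - 1) (hb : e i + 1 ≤ b) :
    matSq Ω e D a b i k = matSq Ω e D (e k - 1) (e i + 1) i k := by
  apply sum_indexIcc_of_eq_zero e ha hb
  rintro r (h | h)
  · rw [hup r k (by lia), comp_zero]
  · rw [hup i r (by lia), Functor.map_zero, zero_comp]

/-- Each component of the square that lowers the degree has the form "new entry followed by the
differential, minus obstruction". The Bianchi identity D·D² = D²·D, with D² = w already known for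
the earlier components, makes the obstruction a cycle, and `hlift` turns it into a boundary. -/
theorem matSq_perturb (w : ∀ X, Ω.obj (Ω.obj X) ⟶ X) (hw : ∀ X, w (Ω.obj X) = Ω.map (w X))
    (hnat : ∀ {X Y : B} (f : X ⟶ Y), Ω.map (Ω.map f) ≫ w Y = w X ≫ f)
    (hup : ∀ i j, e i + 1 < e j → D₀ i j = 0)
    (hzero : ∀ i, 0 < e i → IsZero (Q i))
    (hsq : ∀ i k, e i ≤ e k → matSq Ω e D₀ (e k - 1) (e i + 1) i k = diagMat Ω w i k)
    (hlift : ∀ i j, e j < -1 → e j < e i → ∀ R : Ω.obj (Ω.obj (Q i)) ⟶ Q (nextIndex e j),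
      Ω.map R ≫ D₀ (nextIndex e j) (nextIndex e (nextIndex e j)) = 0 →
      ∃ f : Ω.obj (Q i) ⟶ Q j, Ω.map f ≫ D₀ j (nextIndex e j) = R)
    (i k : I) :
    matSq Ω e (perturb Ω e D₀) (e k - 1) (e i + 1) i k = diagMat Ω w i k := by
  classical
  set D := perturb Ω e D₀ with hD
  have hupD : ∀ i j, e i + 1 < e j → D i j = 0 := fun i j h => by
    rw [hD, perturb_of_le Ω e D₀ (by lia), hup i j h]
  -- Double induction in the order of the recursion: `N` bounds the drop in degree, and for a fixed
  -- drop `M` bounds the distance of the source below degree 1.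
  suffices H : ∀ N M : ℕ, ∀ i k, e i - e k ≤ N → 1 - e i ≤ M →
      matSq Ω e D (e k - 1) (e i + 1) i k = diagMat Ω w i k from
    H (e i - e k).toNat (1 - e i).toNat i k (by lia) (by lia)
  intro N
  induction N with
  | zero =>
    intro M i k h _
    rw [← hsq i k (by lia)]
    apply Finset.sum_congr rfl
    intro r hr
    rw [mem_indexIcc] at hr
    rw [hD, perturb_of_le Ω e D₀ (by lia), perturb_of_le Ω e D₀ (by lia)]
  | succ N ihN =>
    intro M
    induction M with
    | zero =>
      intro i k _ h
      exact (Ω.map_isZero (Ω.map_isZero (hzero i (by lia)))).eq_of_src _ _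
    | succ M ihM =>
      intro i k h hM
      by_cases hN : e i - e k ≤ N
      · exact ihN (M + 1) i k hN hM
      by_cases hi : 0 < e i
      · exact (Ω.map_isZero (Ω.map_isZero (hzero i hi))).eq_of_src _ _
      have ih : ∀ i' k', (e i' - e k' ≤ N ∨ (e i' - e k' ≤ N + 1 ∧ e i < e i')) → ∀ {a b},
          a ≤ e k' - 1 → e i' + 1 ≤ b → matSq Ω e D a b i' k' = diagMat Ω w i' k' := by
        rintro i' k' (h' | ⟨h', h''⟩) a b ha hb <;> rw [matSq_eq Ω e D hupD ha hb]
        · exact ihN (1 - e i').toNat i' k' h' (by lia)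
        · exact ihM i' k' (by lia) (by lia)
      obtain ⟨j, hj⟩ : ∃ j, e j = e k - 1 := ⟨e.symm (e k - 1), by simp⟩
      obtain ⟨l, hl⟩ : ∃ l, e l = e i + 1 := ⟨e.symm (e i + 1), by simp⟩
      obtain ⟨m, hm⟩ : ∃ m, e m = e k + 1 := ⟨e.symm (e k + 1), by simp⟩
      obtain rfl : k = nextIndex e j := eq_nextIndex e (by lia)
      obtain rfl : l = nextIndex e i := eq_nextIndex e (by lia)
      obtain rfl : m = nextIndex e (nextIndex e j) := eq_nextIndex e (by lia)
      set k := nextIndex e j with hk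
      set m := nextIndex e k
      set l := nextIndex e i with hl'
      set R := -(Ω.map (D₀ i l) ≫ D l k + ∑ r ∈ indexIcc e (e j + 1) (e i), Ω.map (D i r) ≫ D r k)
        with hR
      have hDij : D i j = liftAlong Ω (D₀ j k) R := perturb_of_lt Ω e D₀ (by lia) (by lia)
      have hjk : D j k = D₀ j k := perturb_of_le Ω e D₀ (by lia)
      have hkm : D k m = D₀ k m := perturb_of_le Ω e D₀ (by lia)
      have hil : D i l = D₀ i l := perturb_of_le Ω e D₀ (by lia)
      -- The outermost intermediate indices are `j`, which carries the new entry, and `l`, which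
      -- carries the differential out of `i`; everything but the former is `-R`.
      have split : matSq Ω e D (e k - 1) (e i + 1) i k = Ω.map (D i j) ≫ D₀ j k - R := by
        have h1 : indexIcc e (e k - 1) (e i + 1) =
            insert j (insert l (indexIcc e (e j + 1) (e i))) := by
          ext r
          simp only [mem_indexIcc, Finset.mem_insert, ← e.injective.eq_iff]
          lia
        rw [matSq, h1, Finset.sum_insert, Finset.sum_insert, hjk, hR, hil, sub_neg_eq_add]
        · simp only [mem_indexIcc]; lia
        · simp only [mem_indexIcc, Finset.mem_insert, ← e.injective.eq_iff]; lia
      have hdd : Ω.map (D₀ j k) ≫ D₀ k m = 0 := by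
        have h2 := hsq j m (by lia)
        rw [diagMat_of_ne Ω w (by rw [ne_eq, ← e.injective.eq_iff]; lia), matSq,
          Finset.sum_eq_single k] at h2
        · exact h2
        · intro r hr hne
          rw [ne_eq, ← e.injective.eq_iff] at hne
          rw [mem_indexIcc] at hr
          lia
        · intro h3
          rw [mem_indexIcc] at h3
          lia
      -- The triple product from `i` to `m` is evaluated in both bracketings; what survives besides
      -- this term is w composed with `D i m` on either side.
      have bianchi : Ω.map (Ω.map (D i j) ≫ D₀ j k - R) ≫ D₀ k m = 0 := by
        rw [← split]
        have ha : e k - 2 ≤ e k - 1 := by lia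
        have hb : e i + 1 ≤ e i + 2 := by lia
        rw [← matSq_eq Ω e D hupD ha hb]
        -- For `n = l` the drop from `n` to `m` is the present one, but the source is one degree
        -- higher: here the inner induction is needed.
        have s1 : ∑ n ∈ indexIcc e (e k - 2) (e i + 2), Ω.map (Ω.map (D i n)) ≫
            matSq Ω e D (e k - 2) (e i + 2) n m = Ω.map (Ω.map (D i m)) ≫ w (Q m) := by
          rw [Finset.sum_eq_single m, ih m m (by lia) (by lia) (by lia), diagMat_self]
          · intro n hn hne
            rw [mem_indexIcc] at hn
            by_cases h3 : e n ≤ e i + 1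
            · rw [ih n m (by lia) (by lia) (by lia), diagMat_of_ne Ω w hne, comp_zero]
            · rw [hupD i n (by lia), Functor.map_zero, Functor.map_zero, zero_comp]
          · intro h3
            rw [mem_indexIcc] at h3
            lia
        -- Only `n = k`, the component under investigation, and `n = i`, the diagonal component w,
        -- contribute; strictly between them the outer induction applies.
        have s2 : ∑ n ∈ indexIcc e (e k - 2) (e i + 2),
            Ω.map (matSq Ω e D (e k - 2) (e i + 2) i n) ≫ D n m =
            Ω.map (matSq Ω e D (e k - 2) (e i + 2) i k) ≫ D₀ k m + Ω.map (w (Q i)) ≫ D i m := by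
          rw [Finset.sum_eq_add_of_mem k i, hkm, ih i i (by lia) (by lia) (by lia), diagMat_self]
          · rw [mem_indexIcc]; lia
          · rw [mem_indexIcc]; lia
          · rw [ne_eq, ← e.injective.eq_iff]; lia
          · rintro n hn ⟨hne, hne'⟩
            rw [mem_indexIcc] at hn
            rw [ne_eq, ← e.injective.eq_iff] at hne
            by_cases h3 : e n < e k
            · rw [hupD n m (by lia), comp_zero]
            · rw [ih i n (by lia) (by lia) (by lia), diagMat_of_ne Ω w (Ne.symm hne'),
                Functor.map_zero, zero_comp]
        have s3 : ∑ n ∈ indexIcc e (e k - 2) (e i + 2), Ω.map (Ω.map (D i n)) ≫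
            matSq Ω e D (e k - 2) (e i + 2) n m = ∑ n ∈ indexIcc e (e k - 2) (e i + 2),
            Ω.map (matSq Ω e D (e k - 2) (e i + 2) i n) ≫ D n m := by
          simp only [matSq, Preadditive.comp_sum, Functor.map_sum, Preadditive.sum_comp,
            Functor.map_comp, Category.assoc]
          exact Finset.sum_comm
        have nat : Ω.map (Ω.map (D i m)) ≫ w (Q m) = Ω.map (w (Q i)) ≫ D i m := by
          rw [← hw]
          exact hnat (D i m)
        rw [s1, s2, nat] at s3
        exact (add_eq_right.1 s3.symm)
      -- The summand with the new entry drops out by d² = 0, whatever that entry is.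
      have hRlift : Ω.map R ≫ D₀ k m = 0 := by
        rw [Functor.map_sub, Preadditive.sub_comp, Functor.map_comp, Category.assoc, hdd, comp_zero,
          zero_sub, neg_eq_zero] at bianchi
        exact bianchi
      rw [split, hDij, liftAlong_spec Ω _ _ (hlift i j (by lia) (by lia) R hRlift), sub_self,
        diagMat_of_ne Ω w]
      rw [ne_eq, ← e.injective.eq_iff]
      lia

end Perturbation

/-! ### Factorizations as twisted differentials on pairs of objects -/

section Pairs
variable {A : Type u} [Category.{v} A]

instance pairPreadditive [Preadditive A] : Preadditive (A × A) where
  homGroup X Y := inferInstanceAs (AddCommGroup ((X.1 ⟶ Y.1) × (X.2 ⟶ Y.2)))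
  add_comp _ _ _ f g h := Prod.ext (Preadditive.add_comp _ _ _ f.1 g.1 h.1)
    (Preadditive.add_comp _ _ _ f.2 g.2 h.2)
  comp_add _ _ _ f g h := Prod.ext (Preadditive.comp_add _ _ _ f.1 g.1 h.1)
    (Preadditive.comp_add _ _ _ f.2 g.2 h.2)

theorem pair_isZero {X : A × A} (h₁ : IsZero X.1) (h₂ : IsZero X.2) : IsZero X :=
  ⟨fun Y => ⟨⟨⟨(h₁.to_ Y.1, h₂.to_ Y.2)⟩, fun _ => Prod.ext (h₁.eq_of_src _ _)
    (h₂.eq_of_src _ _)⟩⟩, fun Y => ⟨⟨⟨(h₁.from_ Y.1, h₂.from_ Y.2)⟩,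
    fun _ => Prod.ext (h₁.eq_of_tgt _ _) (h₂.eq_of_tgt _ _)⟩⟩⟩

theorem pair_mono {X Y : A × A} (f : X ⟶ Y) [Mono f.1] [Mono f.2] : Mono f :=
  ⟨fun _ _ e => Prod.ext ((cancel_mono f.1).1 (congrArg Prod.fst e))
    ((cancel_mono f.2).1 (congrArg Prod.snd e))⟩

/-- The functor `(X⁻¹, X⁰) ↦ (Φ⁻¹(X⁰), X⁻¹)`, a square root of `Φ⁻¹`. -/
def unshift (W : Potential A) : A × A ⥤ A × A where
  obj X := (W.Φ.inverse.obj X.2, X.1)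
  map f := (W.Φ.inverse.map f.2, f.1)
  map_id X := Prod.ext (W.Φ.inverse.map_id X.2) rfl
  map_comp f g := Prod.ext (W.Φ.inverse.map_comp f.2 g.2) rfl

variable {W : Potential A}

@[simp] theorem unshift_map_fst {X Y : A × A} (f : X ⟶ Y) :
    ((unshift W).map f).1 = W.Φ.inverse.map f.2 := rfl
@[simp] theorem unshift_map_snd {X Y : A × A} (f : X ⟶ Y) : ((unshift W).map f).2 = f.1 := rfl

instance : (unshift W).Faithful where
  map_injective h := Prod.ext (congrArg Prod.snd h)
    (W.Φ.inverse.map_injective (congrArg Prod.fst h))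

/-- The inverse form of w at X is also w at Φ⁻¹(X) followed by the counit, by the case of exponent
-1 of `powNeg_w`. This is the compatibility of w with Φ on the other side, and it gives w_{ΩX} =
Ω(w_X) on pairs. -/
theorem wInv_inverse (X : A) :
    wInv W.Φ W.w (W.Φ.inverse.obj X) = W.Φ.inverse.map (wInv W.Φ W.w X) := by
  have h : wInv W.Φ W.w X = W.w.app (W.Φ.inverse.obj X) ≫ W.Φ.counitIso.hom.app X :=
    powNeg_w W.Φ W.w W.w_comm 0 X
  rw [h, Functor.map_comp, wInv]
  exact congrArg _ (W.Φ.unitInv_app_inverse X)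

theorem counitInv_naturality {X Y Z : A} (f : X ⟶ Y) (h : W.Φ.functor.obj (W.Φ.inverse.obj Y) ⟶ Z) :
    W.Φ.counitIso.inv.app X ≫ W.Φ.functor.map (W.Φ.inverse.map f) ≫ h =
      f ≫ W.Φ.counitIso.inv.app Y ≫ h := by
  have := W.Φ.counitIso.inv.naturality f
  simp only [Functor.id_obj, Functor.comp_obj, Functor.id_map, Functor.comp_map] at this
  rw [← reassoc_of% this]

theorem unitInv_naturality {X Y Z : A} (f : X ⟶ Y) (h : Y ⟶ Z) :
    W.Φ.inverse.map (W.Φ.functor.map f) ≫ W.Φ.unitIso.inv.app Y ≫ h =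
      W.Φ.unitIso.inv.app X ≫ f ≫ h := by
  have := W.Φ.unitIso.inv.naturality f
  simp only [Functor.id_obj, Functor.comp_obj, Functor.id_map, Functor.comp_map] at this
  rw [reassoc_of% this]

/-- The potential on pairs of objects. -/
def wPair (W : Potential A) (X : A × A) : (unshift W).obj ((unshift W).obj X) ⟶ X :=
  (wInv W.Φ W.w X.1, wInv W.Φ W.w X.2)

theorem wPair_naturality {X Y : A × A} (f : X ⟶ Y) :
    (unshift W).map ((unshift W).map f) ≫ wPair W Y = wPair W X ≫ f :=
  Prod.ext (wInv_naturality _ _ _).symm (wInv_naturality _ _ _).symm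

theorem wPair_unshift (X : A × A) : wPair W ((unshift W).obj X) = (unshift W).map (wPair W X) :=
  Prod.ext (wInv_inverse X.2) rfl

/-- The pair of objects underlying a factorization. -/
abbrev Factorization.pair (E : Factorization W) : A × A := (E.neg, E.zero)

/-- The structure morphisms of a factorization. -/
def Factorization.diff (E : Factorization W) : (unshift W).obj E.pair ⟶ E.pair := (E.φneg, E.φzero)

@[simp] theorem Factorization.diff_fst (E : Factorization W) : E.diff.1 = E.φneg := rfl
@[simp] theorem Factorization.diff_snd (E : Factorization W) : E.diff.2 = E.φzero := rfl

/-- The factorization given by a pair of objects with a twisted differential. -/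
def Factorization.ofDiff (X : A × A) (D : (unshift W).obj X ⟶ X)
    (h : (unshift W).map D ≫ D = wPair W X) : Factorization W where
  neg := X.1
  zero := X.2
  φneg := D.1
  φzero := D.2
  φneg_φzero := congrArg Prod.snd h
  φzero_φneg := (Factorization.φzero_φneg_iff _ _).2 (congrArg Prod.fst h)

/-- The pair of morphisms underlying a morphism of factorizations. -/
def Factorization.Hom.pair {E F : Factorization W} (f : E ⟶ F) : E.pair ⟶ F.pair := (f.neg, f.zero)

@[simp] theorem Factorization.Hom.pair_fst {E F : Factorization W} (f : E ⟶ F) :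
    (Hom.pair f).1 = f.neg := rfl
@[simp] theorem Factorization.Hom.pair_snd {E F : Factorization W} (f : E ⟶ F) :
    (Hom.pair f).2 = f.zero := rfl

theorem Factorization.Hom.pair_comm {E F : Factorization W} (f : E ⟶ F) :
    E.diff ≫ Hom.pair f = (unshift W).map (Hom.pair f) ≫ F.diff :=
  Prod.ext f.comm_neg f.comm_zero

/-- This is the square `comm_neg` transported along Φ, in the form in which it meets the shifted
summand of a cone. -/
theorem counitInv_map_comm {B G : Factorization W} (b : B ⟶ G) {Y : A}
    (h : W.Φ.functor.obj G.neg ⟶ Y) :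
    W.Φ.counitIso.inv.app B.zero ≫ W.Φ.functor.map B.φneg ≫ W.Φ.functor.map b.neg ≫ h =
      b.zero ≫ W.Φ.counitIso.inv.app G.zero ≫ W.Φ.functor.map G.φneg ≫ h := by
  rw [← Functor.map_comp_assoc, b.comm_neg, Functor.map_comp_assoc, counitInv_naturality]

/-- The morphism of factorizations given by a pair of morphisms. -/
def Factorization.homOfPair {E F : Factorization W} (f : E.pair ⟶ F.pair)
    (h : E.diff ≫ f = (unshift W).map f ≫ F.diff) : E ⟶ F :=
  { neg := f.1, zero := f.2, comm_neg := congrArg Prod.fst h, comm_zero := congrArg Prod.snd h }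

theorem Factorization.pair_comp {E F G : Factorization W} (f : E ⟶ F) (g : F ⟶ G) :
    Hom.pair (f ≫ g) = Hom.pair f ≫ Hom.pair g := rfl

theorem Factorization.pair_id (E : Factorization W) : Hom.pair (𝟙 E) = 𝟙 E.pair := rfl

@[simp] theorem Factorization.comp_neg_eq {E F G : Factorization W} (f : E ⟶ F) (g : F ⟶ G) :
    (f ≫ g).neg = f.neg ≫ g.neg := rfl
@[simp] theorem Factorization.comp_zero_eq {E F G : Factorization W} (f : E ⟶ F) (g : F ⟶ G) :
    (f ≫ g).zero = f.zero ≫ g.zero := rfl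
@[simp] theorem Factorization.id_neg (E : Factorization W) : Hom.neg (𝟙 E) = 𝟙 E.neg := rfl
@[simp] theorem Factorization.id_zero (E : Factorization W) : Hom.zero (𝟙 E) = 𝟙 E.zero := rfl

theorem Factorization.hom_ext {E F : Factorization W} {f g : E ⟶ F} (h₁ : f.neg = g.neg)
    (h₂ : f.zero = g.zero) : f = g := Hom.ext h₁ h₂

theorem Factorization.pair_injective {E F : Factorization W} {f g : E ⟶ F}
    (h : Hom.pair f = Hom.pair g) : f = g :=
  Hom.ext (congrArg Prod.fst h) (congrArg Prod.snd h)

end Pairs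

section Abelian
variable {A : Type u} [Category.{v} A] [Abelian A] {W : Potential A}

instance : (unshift W).Additive where
  map_add {_ _ f g} := Prod.ext (W.Φ.inverse.map_add (f := f.2) (g := g.2)) rfl

/-- Applying Φ⁻¹ to the degree-zero equation removes its unit and counit isomorphisms; the two
equations then are the components of one equation on pairs, of the usual form f - g = ds + sd after
applying Ω. -/
theorem homotopic_iff {E F : Factorization W} (f g : E ⟶ F) :
    Homotopic W f g ↔ ∃ s : E.pair ⟶ (unshift W).obj F.pair,
      (unshift W).map (Factorization.Hom.pair f - Factorization.Hom.pair g) =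
        E.diff ≫ s + (unshift W).map s ≫ (unshift W).map F.diff := by
  have key : ∀ (hneg : E.neg ⟶ W.Φ.inverse.obj F.zero) (hzero : E.zero ⟶ F.neg),
      (f.zero - g.zero = hzero ≫ F.φzero +
        show E.zero ⟶ F.zero from W.Φ.counitIso.inv.app E.zero ≫ W.Φ.functor.map E.φneg ≫
          W.Φ.functor.map hneg ≫ W.Φ.counitIso.hom.app F.zero) ↔
      W.Φ.inverse.map (f.zero - g.zero) = E.φneg ≫ hneg +
        W.Φ.inverse.map hzero ≫ W.Φ.inverse.map F.φzero := by
    intro hneg hzero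
    have h1 : W.Φ.inverse.map (W.Φ.counitIso.inv.app E.zero ≫ W.Φ.functor.map E.φneg ≫
          W.Φ.functor.map hneg ≫ W.Φ.counitIso.hom.app F.zero) = E.φneg ≫ hneg := by
      have h2 := Factorization.inverse_map_mate (E.φneg ≫ hneg)
      simp only [Functor.map_comp, Category.assoc] at h2 ⊢
      rw [← h2]
      congr 3
      exact (W.Φ.unitInv_app_inverse F.zero).symm
    rw [← h1, ← Functor.map_comp, add_comm, ← Functor.map_add]
    exact W.Φ.inverse.map_injective.eq_iff.symm
  constructor
  · rintro ⟨hneg, hzero, h1, h2⟩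
    exact ⟨(hneg, hzero), Prod.ext ((key _ _).1 h2) h1⟩
  · rintro ⟨s, h⟩
    exact ⟨s.1, s.2, congrArg Prod.snd h, (key _ _).2 (congrArg Prod.fst h)⟩

/-- Consequently equality in the homotopy category means homotopy, with no generated equivalence
relation in between; the product property below depends on this. -/
instance : Congruence (Homotopic W) where
  equivalence {E F} :=
    { refl := fun f => (homotopic_iff f f).2 ⟨0, by simp⟩
      symm := fun {f g} h => by
        obtain ⟨s, h⟩ := (homotopic_iff f g).1 h
        refine (homotopic_iff g f).2 ⟨-s, ?_⟩
        rw [← neg_sub, Functor.map_neg, h, Functor.map_neg, Preadditive.comp_neg,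
          Preadditive.neg_comp, neg_add]
      trans := fun {f g k} h h' => by
        obtain ⟨s, h⟩ := (homotopic_iff f g).1 h
        obtain ⟨t, h'⟩ := (homotopic_iff g k).1 h'
        refine (homotopic_iff f k).2 ⟨s + t, ?_⟩
        rw [← sub_add_sub_cancel _ (Factorization.Hom.pair g), Functor.map_add, h, h',
          Functor.map_add, Preadditive.comp_add, Preadditive.add_comp]
        abel }
  comp_left f g g' h := by
    obtain ⟨s, h⟩ := (homotopic_iff g g').1 h
    refine (homotopic_iff _ _).2 ⟨Factorization.Hom.pair f ≫ s, ?_⟩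
    rw [Factorization.pair_comp, Factorization.pair_comp, ← Preadditive.comp_sub, Functor.map_comp,
      h, Preadditive.comp_add, ← Category.assoc, ← Factorization.Hom.pair_comm, Category.assoc,
      Functor.map_comp, Category.assoc]
  comp_right {_ _ _ f f'} g h := by
    obtain ⟨s, h⟩ := (homotopic_iff f f').1 h
    refine (homotopic_iff _ _).2 ⟨s ≫ (unshift W).map (Factorization.Hom.pair g), ?_⟩
    rw [Factorization.pair_comp, Factorization.pair_comp, ← Preadditive.sub_comp, Functor.map_comp,
      h, Preadditive.add_comp, Category.assoc, Category.assoc, ← Functor.map_comp,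
      Factorization.Hom.pair_comm]
    simp only [Functor.map_comp, Category.assoc]

/-- Contractible factorizations become zero in the homotopy category. -/
theorem isZero_toK {E : Factorization W} (s : E.pair ⟶ (unshift W).obj E.pair)
    (h : E.diff ≫ s + (unshift W).map s ≫ (unshift W).map E.diff = 𝟙 _) :
    IsZero ((toK W).obj E) := by
  -- The contraction is a homotopy from the identity to zero, so every morphism into or out of the
  -- image is zero.
  have h0 : (toK W).map (𝟙 E) = (toK W).map 0 := by
    apply CategoryTheory.Quotient.sound
    refine (homotopic_iff _ _).2 ⟨s, h.symm ▸ ?_⟩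
    have : Factorization.Hom.pair (0 : E ⟶ E) = 0 := rfl
    rw [this, sub_zero, Factorization.pair_id, CategoryTheory.Functor.map_id]
  refine ⟨fun Y => ⟨⟨⟨(toK W).map (0 : E ⟶ Y.as)⟩, fun f => ?_⟩⟩,
    fun Y => ⟨⟨⟨(toK W).map (0 : Y.as ⟶ E)⟩, fun f => ?_⟩⟩⟩
  · obtain ⟨f, rfl⟩ := (toK W).map_surjective (X := E) (Y := Y.as) f
    have : (toK W).map (𝟙 E ≫ f) = (toK W).map (0 ≫ f) := by
      rw [Functor.map_comp, h0, Functor.map_comp]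
    rw [Category.id_comp, zero_comp] at this
    exact this
  · obtain ⟨f, rfl⟩ := (toK W).map_surjective (X := Y.as) (Y := E) f
    have : (toK W).map (f ≫ 𝟙 E) = (toK W).map (f ≫ 0) := by
      rw [Functor.map_comp, h0, Functor.map_comp]
    rw [Category.comp_id, comp_zero] at this
    exact this

end Abelian

/-! ### Cones -/

section Cones
variable {A : Type u} [Category.{v} A] [Abelian A] {W : Potential A}

namespace Factorization
variable {E F : Factorization W} (g : E ⟶ F)

/-- The projection of a cone onto the shifted source, on `E⁻¹`. -/
def coneFstNeg : (cone g).neg ⟶ E.zero := biprod.fst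
/-- The projection of a cone onto the target, on `E⁻¹`. -/
def coneSndNeg : (cone g).neg ⟶ F.neg := biprod.snd
/-- The projection of a cone onto the shifted source, on `E⁰`. -/
def coneFstZero : (cone g).zero ⟶ W.Φ.functor.obj E.neg := biprod.fst
/-- The projection of a cone onto the target, on `E⁰`. -/
def coneSndZero : (cone g).zero ⟶ F.zero := biprod.snd

variable {g}

/-- The morphism into `C(g)⁻¹` with given components. -/
def coneLiftNeg {Z : A} (a : Z ⟶ E.zero) (b : Z ⟶ F.neg) : Z ⟶ (cone g).neg := biprod.lift a b
/-- The morphism into `C(g)⁰` with given components. -/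
def coneLiftZero {Z : A} (a : Z ⟶ W.Φ.functor.obj E.neg) (b : Z ⟶ F.zero) : Z ⟶ (cone g).zero :=
  biprod.lift a b

section
variable {Z : A}

@[simp] theorem coneLiftNeg_fst (a : Z ⟶ E.zero) (b : Z ⟶ F.neg) :
    coneLiftNeg a b ≫ coneFstNeg g = a := biprod.lift_fst _ _
@[simp] theorem coneLiftNeg_snd (a : Z ⟶ E.zero) (b : Z ⟶ F.neg) :
    coneLiftNeg a b ≫ coneSndNeg g = b := biprod.lift_snd _ _
@[simp] theorem coneLiftZero_fst (a : Z ⟶ W.Φ.functor.obj E.neg)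
    (b : Z ⟶ F.zero) : coneLiftZero a b ≫ coneFstZero g = a := biprod.lift_fst _ _
@[simp] theorem coneLiftZero_snd (a : Z ⟶ W.Φ.functor.obj E.neg)
    (b : Z ⟶ F.zero) : coneLiftZero a b ≫ coneSndZero g = b := biprod.lift_snd _ _

@[simp] theorem coneLiftNeg_fst_assoc (a : Z ⟶ E.zero) (b : Z ⟶ F.neg) {Y : A} (h : E.zero ⟶ Y) :
    coneLiftNeg a b ≫ coneFstNeg g ≫ h = a ≫ h := by rw [← Category.assoc, coneLiftNeg_fst]
@[simp] theorem coneLiftNeg_snd_assoc (a : Z ⟶ E.zero) (b : Z ⟶ F.neg) {Y : A} (h : F.neg ⟶ Y) :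
    coneLiftNeg a b ≫ coneSndNeg g ≫ h = b ≫ h := by rw [← Category.assoc, coneLiftNeg_snd]
@[simp] theorem coneLiftZero_fst_assoc (a : Z ⟶ W.Φ.functor.obj E.neg) (b : Z ⟶ F.zero) {Y : A}
    (h : W.Φ.functor.obj E.neg ⟶ Y) : coneLiftZero a b ≫ coneFstZero g ≫ h = a ≫ h := by
  rw [← Category.assoc, coneLiftZero_fst]
@[simp] theorem coneLiftZero_snd_assoc (a : Z ⟶ W.Φ.functor.obj E.neg) (b : Z ⟶ F.zero) {Y : A}
    (h : F.zero ⟶ Y) : coneLiftZero a b ≫ coneSndZero g ≫ h = b ≫ h := by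
  rw [← Category.assoc, coneLiftZero_snd]

theorem coneNeg_ext {s t : Z ⟶ (cone g).neg} (h₁ : s ≫ coneFstNeg g = t ≫ coneFstNeg g)
    (h₂ : s ≫ coneSndNeg g = t ≫ coneSndNeg g) : s = t := biprod.hom_ext _ _ h₁ h₂
theorem coneZero_ext {s t : Z ⟶ (cone g).zero} (h₁ : s ≫ coneFstZero g = t ≫ coneFstZero g)
    (h₂ : s ≫ coneSndZero g = t ≫ coneSndZero g) : s = t := biprod.hom_ext _ _ h₁ h₂

end

section
variable (G : A ⥤ A)

@[simp] theorem map_coneLiftNeg_fst {Z : A} (a : Z ⟶ E.zero) (b : Z ⟶ F.neg) :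
    G.map (coneLiftNeg (g := g) a b) ≫ G.map (coneFstNeg g) = G.map a := by
  rw [← G.map_comp, coneLiftNeg_fst]
@[simp] theorem map_coneLiftNeg_fst_assoc {Z Y : A} (a : Z ⟶ E.zero) (b : Z ⟶ F.neg)
    (h : G.obj (E.zero) ⟶ Y) :
    G.map (coneLiftNeg (g := g) a b) ≫ G.map (coneFstNeg g) ≫ h = G.map a ≫ h := by
  rw [← G.map_comp_assoc, coneLiftNeg_fst]
@[simp] theorem map_coneLiftNeg_snd {Z : A} (a : Z ⟶ E.zero) (b : Z ⟶ F.neg) :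
    G.map (coneLiftNeg (g := g) a b) ≫ G.map (coneSndNeg g) = G.map b := by
  rw [← G.map_comp, coneLiftNeg_snd]
@[simp] theorem map_coneLiftNeg_snd_assoc {Z Y : A} (a : Z ⟶ E.zero) (b : Z ⟶ F.neg)
    (h : G.obj (F.neg) ⟶ Y) :
    G.map (coneLiftNeg (g := g) a b) ≫ G.map (coneSndNeg g) ≫ h = G.map b ≫ h := by
  rw [← G.map_comp_assoc, coneLiftNeg_snd]
@[simp] theorem map_coneLiftZero_fst {Z : A} (a : Z ⟶ W.Φ.functor.obj E.neg) (b : Z ⟶ F.zero) :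
    G.map (coneLiftZero (g := g) a b) ≫ G.map (coneFstZero g) = G.map a := by
  rw [← G.map_comp, coneLiftZero_fst]
@[simp] theorem map_coneLiftZero_fst_assoc {Z Y : A} (a : Z ⟶ W.Φ.functor.obj E.neg) (b : Z ⟶ F.zero)
    (h : G.obj (W.Φ.functor.obj E.neg) ⟶ Y) :
    G.map (coneLiftZero (g := g) a b) ≫ G.map (coneFstZero g) ≫ h = G.map a ≫ h := by
  rw [← G.map_comp_assoc, coneLiftZero_fst]
@[simp] theorem map_coneLiftZero_snd {Z : A} (a : Z ⟶ W.Φ.functor.obj E.neg) (b : Z ⟶ F.zero) :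
    G.map (coneLiftZero (g := g) a b) ≫ G.map (coneSndZero g) = G.map b := by
  rw [← G.map_comp, coneLiftZero_snd]
@[simp] theorem map_coneLiftZero_snd_assoc {Z Y : A} (a : Z ⟶ W.Φ.functor.obj E.neg) (b : Z ⟶ F.zero)
    (h : G.obj (F.zero) ⟶ Y) :
    G.map (coneLiftZero (g := g) a b) ≫ G.map (coneSndZero g) ≫ h = G.map b ≫ h := by
  rw [← G.map_comp_assoc, coneLiftZero_snd]

end

@[simp] theorem cone_φneg_fst : (cone g).φneg ≫ coneFstNeg g =
    -(W.Φ.inverse.map (coneFstZero g) ≫ W.Φ.unitIso.inv.app E.neg ≫ E.φzero) :=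
  (biprod.lift_fst _ _).trans (Preadditive.comp_neg _ _)
@[simp] theorem cone_φneg_snd : (cone g).φneg ≫ coneSndNeg g =
    W.Φ.inverse.map (coneFstZero g) ≫ W.Φ.unitIso.inv.app E.neg ≫ g.neg +
      W.Φ.inverse.map (coneSndZero g) ≫ F.φneg := biprod.lift_snd _ _
@[simp] theorem cone_φzero_fst : (cone g).φzero ≫ coneFstZero g =
    -(coneFstNeg g ≫ W.Φ.counitIso.inv.app E.zero ≫ W.Φ.functor.map E.φneg) :=
  (biprod.lift_fst _ _).trans (Preadditive.comp_neg _ _)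
@[simp] theorem cone_φzero_snd : (cone g).φzero ≫ coneSndZero g =
    coneFstNeg g ≫ g.zero + coneSndNeg g ≫ F.φzero := biprod.lift_snd _ _

@[simp] theorem cone_φneg_fst_assoc {Y : A} (h : E.zero ⟶ Y) :
    (cone g).φneg ≫ coneFstNeg g ≫ h =
    -(W.Φ.inverse.map (coneFstZero g) ≫ W.Φ.unitIso.inv.app E.neg ≫ E.φzero ≫ h) := by
  rw [← Category.assoc, cone_φneg_fst]
  simp
@[simp] theorem cone_φneg_snd_assoc {Y : A} (h : F.neg ⟶ Y) :
    (cone g).φneg ≫ coneSndNeg g ≫ h =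
    W.Φ.inverse.map (coneFstZero g) ≫ W.Φ.unitIso.inv.app E.neg ≫ g.neg ≫ h +
      W.Φ.inverse.map (coneSndZero g) ≫ F.φneg ≫ h := by
  rw [← Category.assoc, cone_φneg_snd]
  simp
@[simp] theorem cone_φzero_fst_assoc {Y : A} (h : W.Φ.functor.obj E.neg ⟶ Y) :
    (cone g).φzero ≫ coneFstZero g ≫ h =
    -(coneFstNeg g ≫ W.Φ.counitIso.inv.app E.zero ≫ W.Φ.functor.map E.φneg ≫ h) := by
  rw [← Category.assoc, cone_φzero_fst]
  simp
@[simp] theorem cone_φzero_snd_assoc {Y : A} (h : F.zero ⟶ Y) :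
    (cone g).φzero ≫ coneSndZero g ≫ h =
    coneFstNeg g ≫ g.zero ≫ h + coneSndNeg g ≫ F.φzero ≫ h := by
  rw [← Category.assoc, cone_φzero_snd]
  simp
theorem map_cone_φneg_snd (G : A ⥤ A) {Y : A} (h : G.obj (F.neg) ⟶ Y) :
    G.map (cone g).φneg ≫ G.map (coneSndNeg g) ≫ h =
    G.map (W.Φ.inverse.map (coneFstZero g) ≫ W.Φ.unitIso.inv.app E.neg ≫ g.neg +
      W.Φ.inverse.map (coneSndZero g) ≫ F.φneg) ≫ h := by
  rw [← G.map_comp_assoc, cone_φneg_snd]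

@[simp] theorem zero_neg (E F : Factorization W) : Hom.neg (0 : E ⟶ F) = 0 := rfl
@[simp] theorem zero_zero (E F : Factorization W) : Hom.zero (0 : E ⟶ F) = 0 := rfl

variable (g)

/-- The inclusion `F ⟶ C(g)`. -/
def coneInr : F ⟶ cone g where
  neg := coneLiftNeg 0 (𝟙 _)
  zero := coneLiftZero 0 (𝟙 _)
  comm_neg := by
    apply coneNeg_ext <;> simp [← Functor.map_comp_assoc]
  comm_zero := by
    apply coneZero_ext <;> simp

@[simp] theorem coneInr_neg : (coneInr g).neg = coneLiftNeg 0 (𝟙 _) := rfl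
@[simp] theorem coneInr_zero : (coneInr g).zero = coneLiftZero 0 (𝟙 _) := rfl

/-- Identifications that make `S` the shift of `E`. -/
structure ShiftData (E S : Factorization W) where
  neg : S.neg ≅ E.zero
  zero : S.zero ≅ W.Φ.functor.obj E.neg
  φneg : S.φneg = -(W.Φ.inverse.map zero.hom ≫ W.Φ.unitIso.inv.app E.neg ≫ E.φzero ≫ neg.inv)
  φzero : S.φzero =
    -(neg.hom ≫ W.Φ.counitIso.inv.app E.zero ≫ W.Φ.functor.map E.φneg ≫ zero.inv)

/-- The shift is a shift. -/
def shiftData (E : Factorization W) : ShiftData E E.shift where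
  neg := Iso.refl E.zero
  zero := Iso.refl (W.Φ.functor.obj E.neg)
  φneg := by
    change -(W.Φ.unitIso.inv.app E.neg ≫ E.φzero) =
      -(W.Φ.inverse.map (𝟙 _) ≫ W.Φ.unitIso.inv.app E.neg ≫ E.φzero ≫ 𝟙 _)
    simp
  φzero := by
    change -(W.Φ.counitIso.inv.app E.zero ≫ W.Φ.functor.map E.φneg) =
      -(𝟙 _ ≫ W.Φ.counitIso.inv.app E.zero ≫ W.Φ.functor.map E.φneg ≫ 𝟙 _)
    simp

variable {S : Factorization W} (d : ShiftData E S)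

/-- The projection `C(g) ⟶ E[1]`. -/
def coneFst : cone g ⟶ S where
  neg := coneFstNeg g ≫ d.neg.inv
  zero := coneFstZero g ≫ d.zero.inv
  comm_neg := by simp [d.φneg, ← Functor.map_comp_assoc]
  comm_zero := by simp [d.φzero]

@[simp] theorem coneFst_neg : (coneFst g d).neg = coneFstNeg g ≫ d.neg.inv := rfl
@[simp] theorem coneFst_zero : (coneFst g d).zero = coneFstZero g ≫ d.zero.inv := rfl

end Factorization

open Factorization

theorem IsThick.of_retract {N : ObjectProperty (KFact W)} (hN : IsThick N) {E F : Factorization W}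
    (i : E ⟶ F) (r : F ⟶ E) (h : i ≫ r = 𝟙 E) (hF : N ((toK W).obj F)) : N ((toK W).obj E) :=
  hN.retract (Retract.map ⟨i, r, h⟩ (toK W)) hF

/-! ### Rotating triangles by strict retractions of iterated cones -/

section Rotation
variable {B G S T : Factorization W} (b : B ⟶ G) (d : ShiftData B S) (t : ShiftData G T)

/-- The inclusion of `G[1]` into the cone of `C(b) ⟶ B[1]`. -/
def rotateIncl : T ⟶ cone (coneFst b d) where
  neg := coneLiftNeg (coneLiftZero 0 t.neg.hom) 0
  zero := coneLiftZero (t.zero.hom ≫ W.Φ.functor.map (coneLiftNeg 0 (𝟙 G.neg))) 0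
  comm_neg := by
    apply coneNeg_ext
    · apply coneZero_ext
      · simp [t.φneg]
      · simp [t.φneg]
    · simp [t.φneg]
  comm_zero := by
    apply coneZero_ext
    · simp only [t.φzero, Category.assoc, Preadditive.neg_comp, Iso.inv_hom_id_assoc,
        coneLiftZero_fst, cone_φzero_fst, Preadditive.comp_neg, coneLiftNeg_fst_assoc]
      rw [← counitInv_naturality, ← counitInv_naturality, ← Functor.map_comp, ← Functor.map_comp]
      rw [← Functor.map_comp]
      congr 3
      apply coneNeg_ext <;> simp
    · simp [t.φzero]

/-- The projection of the cone of `C(b) ⟶ B[1]` onto `G[1]`. -/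
def rotateProj : cone (coneFst b d) ⟶ T where
  -- The plain projection onto G[1] does not commute with the structure morphisms; adding `b` on the
  -- summand B[1] cancels the entry `b` of the inner cone.
  neg := (coneFstNeg (coneFst b d) ≫ coneSndZero b +
    coneSndNeg (coneFst b d) ≫ d.neg.hom ≫ b.zero) ≫ t.neg.inv
  zero := (coneFstZero (coneFst b d) ≫ W.Φ.functor.map (coneSndNeg b) +
    coneSndZero (coneFst b d) ≫ d.zero.hom ≫ W.Φ.functor.map b.neg) ≫ t.zero.inv
  comm_neg := by
    simp [t.φneg, d.φneg]
    rw [reassoc_of% b.comm_zero]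
    exact add_comm _ _
  comm_zero := by
    simp [t.φzero, d.φzero, map_cone_φneg_snd]
    rw [counitInv_map_comm]
    exact add_comm _ _

theorem rotate_retract : rotateIncl b d t ≫ rotateProj b d t = 𝟙 T := by
  apply hom_ext <;> simp [rotateIncl, rotateProj]

/-- The inclusion of `B[1]` into the cone of `G ⟶ C(b)`. -/
def rotateIncl' : S ⟶ cone (coneInr b) where
  -- The component `-b` in G[1] compensates the term that the inner cone sends from B to G.
  neg := d.neg.hom ≫ coneLiftNeg (-b.zero) (coneLiftNeg (𝟙 _) 0)
  zero := d.zero.hom ≫ coneLiftZero (-W.Φ.functor.map b.neg) (coneLiftZero (𝟙 _) 0)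
  comm_neg := by
    apply coneNeg_ext
    · simp [d.φneg]
      rw [b.comm_zero]
    · apply coneNeg_ext
      · simp [d.φneg]
      · simp [d.φneg]
  comm_zero := by
    apply coneZero_ext
    · simp [d.φzero]
      simpa using counitInv_map_comm b (𝟙 _)
    · apply coneZero_ext
      · simp [d.φzero]
      · simp [d.φzero]

/-- The projection of the cone of `G ⟶ C(b)` onto `B[1]`. -/
def rotateProj' : cone (coneInr b) ⟶ S where
  neg := coneSndNeg (coneInr b) ≫ coneFstNeg b ≫ d.neg.inv
  zero := coneSndZero (coneInr b) ≫ coneFstZero b ≫ d.zero.inv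
  comm_neg := by
    simp [d.φneg]
  comm_zero := by simp [d.φzero]

theorem rotate_retract' : rotateIncl' b d ≫ rotateProj' b d = 𝟙 S := by
  apply hom_ext <;> simp [rotateIncl', rotateProj']

variable {N : ObjectProperty (KFact W)}

/-- Closure under cones, shifts and retracts suffices for two-out-of-three: G[1] is a retract,
already before passing to homotopy, of the cone of C(b) ⟶ B[1]. -/
theorem IsThick.target_of_cone (hN : IsThick N) (hB : N ((toK W).obj B))
    (hC : N ((toK W).obj (Factorization.cone b))) : N ((toK W).obj G) :=
  (hN.shift G).1 (hN.of_retract _ _ (rotate_retract b (shiftData B) (shiftData G))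
    (hN.cone _ hC ((hN.shift B).2 hB)))

/-- In the same way, B[1] is a strict retract of the cone of G ⟶ C(b). -/
theorem IsThick.source_of_cone (hN : IsThick N) (hG : N ((toK W).obj G))
    (hC : N ((toK W).obj (Factorization.cone b))) : N ((toK W).obj B) :=
  (hN.shift B).1 (hN.of_retract _ _ (rotate_retract' b (shiftData B)) (hN.cone _ hG hC))

end Rotation
end Cones

/-! ### Short exact sequences of factorizations -/

section Exactness

/-- An explicit kernel and cokernel of the two maps give homology data with zero homology. Working
with zero morphisms only allows exactness in the category of factorizations to be verified without
constructing its abelian structure. -/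
theorem exact_of_kernel_cokernel {C : Type*} [Category C] [HasZeroMorphisms C] {S : ShortComplex C}
    {K Q O : C} (hO : IsZero O) (i : K ⟶ S.X₂) (wi : i ≫ S.g = 0)
    (hi : IsLimit (KernelFork.ofι i wi)) (p : S.X₂ ⟶ Q) (wp : S.f ≫ p = 0)
    (hp : IsColimit (CokernelCofork.ofπ p wp)) (e : S.X₁ ⟶ K) [Epi e] (he : e ≫ i = S.f)
    (m : Q ⟶ S.X₃) [Mono m] (hm : p ≫ m = S.g) : S.Exact := by
  have he' : hi.lift (KernelFork.ofι S.f S.zero) = e := by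
    apply Fork.IsLimit.hom_ext hi
    exact (hi.fac _ WalkingParallelPair.zero).trans he.symm
  have hm' : hp.desc (CokernelCofork.ofπ S.g S.zero) = m := by
    apply Cofork.IsColimit.hom_ext hp
    exact (hp.fac _ WalkingParallelPair.one).trans hm.symm
  refine ⟨⟨{ K := K, H := O, i := i, π := 0, wi := wi, hi := hi, wπ := comp_zero, hπ := ?_ },
    { Q := Q, H := O, p := p, ι := 0, wp := wp, hp := hp, wι := zero_comp, hι := ?_ },
    Iso.refl _, ?_⟩, hO⟩
  · refine CokernelCofork.IsColimit.ofπ _ _ (fun _ _ => 0) (fun k hk => ?_)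
      (fun _ _ _ _ => hO.eq_of_src _ _)
    rw [he'] at hk
    rw [zero_comp]
    exact (zero_of_epi_comp e hk).symm
  · refine KernelFork.IsLimit.ofι _ _ (fun _ _ => 0) (fun k hk => ?_)
      (fun _ _ _ _ => hO.eq_of_tgt _ _)
    rw [hm'] at hk
    rw [comp_zero]
    exact (zero_of_comp_mono m hk).symm
  · have : i ≫ p = 0 := by
      rw [← cancel_mono m, ← cancel_epi e, Category.assoc, hm, zero_comp, comp_zero, wi, comp_zero]
    simp [this]

end Exactness

section
open scoped ZeroObject
variable {A : Type u} [Category.{v} A] [Abelian A] {W : Potential A}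

/-- The zero factorization. -/
def zeroFact (W : Potential A) : Factorization W where
  neg := 0
  zero := 0
  φneg := 0
  φzero := 0
  φneg_φzero := (isZero_zero A).eq_of_tgt _ _
  φzero_φneg := (isZero_zero A).eq_of_src _ _

theorem Factorization.isZero_of_components {E : Factorization W} (h₁ : IsZero E.neg)
    (h₂ : IsZero E.zero) : IsZero E :=
  ⟨fun _ => ⟨⟨⟨0⟩, fun _ => Factorization.hom_ext (h₁.eq_of_src _ _) (h₂.eq_of_src _ _)⟩⟩,
    fun _ => ⟨⟨⟨0⟩, fun _ => Factorization.hom_ext (h₁.eq_of_tgt _ _) (h₂.eq_of_tgt _ _)⟩⟩⟩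

theorem isZero_zeroFact (W : Potential A) : IsZero (zeroFact W) :=
  Factorization.isZero_of_components (isZero_zero A) (isZero_zero A)

/-- Short exact sequences of factorizations. -/
structure IsShortExact {E F G : Factorization W} (f : E ⟶ F) (g : F ⟶ G) : Prop where
  comp : f ≫ g = 0
  mono_neg : Mono f.neg
  mono_zero : Mono f.zero
  epi_neg : Epi g.neg
  epi_zero : Epi g.zero
  lift_neg : ∀ {Z : A} (t : Z ⟶ F.neg), t ≫ g.neg = 0 → ∃ s, s ≫ f.neg = t
  lift_zero : ∀ {Z : A} (t : Z ⟶ F.zero), t ≫ g.zero = 0 → ∃ s, s ≫ f.zero = t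

/-- The lifting property on generalized elements is exactness in the middle, and in an abelian
category this makes the epimorphism `g` a cokernel of `f`. -/
theorem exists_desc_of_exists_lift {X Y Z : A} {f : X ⟶ Y} {g : Y ⟶ Z} (w : f ≫ g = 0) [Epi g]
    (h : ∀ {T : A} (t : T ⟶ Y), t ≫ g = 0 → ∃ s, s ≫ f = t) {T : A} (t : Y ⟶ T)
    (ht : f ≫ t = 0) : ∃ s, g ≫ s = t := by
  have hex : (ShortComplex.mk f g w).Exact := by
    rw [ShortComplex.exact_iff_exact_up_to_refinements]
    intro T x hx
    obtain ⟨s, hs⟩ := h x hx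
    exact ⟨T, 𝟙 T, inferInstance, s, by rw [hs, Category.id_comp]⟩
  have : Epi (ShortComplex.mk f g w).g := inferInstanceAs (Epi g)
  exact ⟨hex.desc t ht, hex.g_desc t ht⟩

namespace IsShortExact
variable {E F G : Factorization W} {f : E ⟶ F} {g : F ⟶ G} (h : IsShortExact f g)
include h

theorem comp_neg : f.neg ≫ g.neg = 0 := congrArg Factorization.Hom.neg h.comp
theorem comp_zero : f.zero ≫ g.zero = 0 := congrArg Factorization.Hom.zero h.comp

theorem mono : Mono f :=
  have := h.mono_neg
  have := h.mono_zero
  ⟨fun _ _ e => Factorization.hom_ext ((cancel_mono f.neg).1 (congrArg Factorization.Hom.neg e))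
    ((cancel_mono f.zero).1 (congrArg Factorization.Hom.zero e))⟩

theorem epi : Epi g :=
  have := h.epi_neg
  have := h.epi_zero
  ⟨fun _ _ e => Factorization.hom_ext ((cancel_epi g.neg).1 (congrArg Factorization.Hom.neg e))
    ((cancel_epi g.zero).1 (congrArg Factorization.Hom.zero e))⟩

/-- The two components lift independently; that they form a morphism of factorizations can be tested
after the monomorphisms of `f`. -/
theorem exists_lift {Z : Factorization W} (t : Z ⟶ F) (ht : t ≫ g = 0) : ∃ s, s ≫ f = t := by
  have := h.mono_neg
  have := h.mono_zero
  obtain ⟨a, ha⟩ := h.lift_neg t.neg (congrArg Factorization.Hom.neg ht)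
  obtain ⟨b, hb⟩ := h.lift_zero t.zero (congrArg Factorization.Hom.zero ht)
  refine ⟨{ neg := a, zero := b, comm_neg := ?_, comm_zero := ?_ }, Factorization.hom_ext ha hb⟩
  · rw [← cancel_mono f.neg, Category.assoc, ha, t.comm_neg, Category.assoc, f.comm_neg,
      ← Functor.map_comp_assoc, hb]
  · rw [← cancel_mono f.zero, Category.assoc, hb, t.comm_zero, Category.assoc, f.comm_zero,
      reassoc_of% ha]

theorem exists_desc {Z : Factorization W} (t : F ⟶ Z) (ht : f ≫ t = 0) : ∃ s, g ≫ s = t := by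
  have := h.epi_neg
  have := h.epi_zero
  obtain ⟨a, ha⟩ := exists_desc_of_exists_lift h.comp_neg h.lift_neg t.neg
    (congrArg Factorization.Hom.neg ht)
  obtain ⟨b, hb⟩ := exists_desc_of_exists_lift h.comp_zero h.lift_zero t.zero
    (congrArg Factorization.Hom.zero ht)
  refine ⟨{ neg := a, zero := b, comm_neg := ?_, comm_zero := ?_ }, Factorization.hom_ext ha hb⟩
  -- The equivalence Φ⁻¹ preserves the epimorphism `g.zero`, so the square may be tested after it.
  · rw [← cancel_epi (W.Φ.inverse.map g.zero), ← Functor.map_comp_assoc, hb, ← t.comm_neg, ← ha,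
      ← Category.assoc, ← g.comm_neg, Category.assoc]
  · rw [← cancel_epi g.neg, ← Category.assoc, ← g.comm_zero, Category.assoc, hb, t.comm_zero,
      reassoc_of% ha]

/-- A short exact sequence exhibits its first morphism as a kernel. -/
def isKernel : IsLimit (KernelFork.ofι f h.comp) :=
  have := h.mono
  KernelFork.IsLimit.ofι _ _ (fun k hk => (h.exists_lift k hk).choose)
    (fun k hk => (h.exists_lift k hk).choose_spec)
    (fun k hk m hm => by rw [← cancel_mono f, hm, (h.exists_lift k hk).choose_spec])

/-- A short exact sequence exhibits its second morphism as a cokernel. -/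
def isCokernel : IsColimit (CokernelCofork.ofπ g h.comp) :=
  have := h.epi
  CokernelCofork.IsColimit.ofπ _ _ (fun k hk => (h.exists_desc k hk).choose)
    (fun k hk => (h.exists_desc k hk).choose_spec)
    (fun k hk m hm => by rw [← cancel_epi g, hm, (h.exists_desc k hk).choose_spec])

end IsShortExact

variable {E F G : Factorization W}

/-- The objects of the complex `E ⟶ F ⟶ G` with `G` in degree `0`. -/
def threeTermX (E F G : Factorization W) : ℤ → Factorization W
  | Int.ofNat 0 => G
  | Int.negSucc 0 => F
  | Int.negSucc 1 => E
  | _ => zeroFact W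

/-- The differentials of the complex `E ⟶ F ⟶ G`. -/
def threeTermD (f : E ⟶ F) (g : F ⟶ G) : ∀ i j : ℤ, threeTermX E F G i ⟶ threeTermX E F G j
  | Int.negSucc 1, Int.negSucc 0 => f
  | Int.negSucc 0, Int.ofNat 0 => g
  | _, _ => 0

theorem isZero_threeTermX {n : ℤ} (h₀ : n ≠ 0) (h₁ : n ≠ -1) (h₂ : n ≠ -2) :
    IsZero (threeTermX E F G n) := by
  match n with
  | Int.ofNat 0 => exact absurd rfl h₀
  | Int.negSucc 0 => exact absurd rfl h₁
  | Int.negSucc 1 => exact absurd rfl h₂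
  | Int.ofNat (n + 1) => exact isZero_zeroFact W
  | Int.negSucc (n + 2) => exact isZero_zeroFact W

theorem threeTermD_eq_zero (f : E ⟶ F) (g : F ⟶ G) {i j : ℤ} (h₁ : i ≠ -2 ∨ j ≠ -1)
    (h₂ : i ≠ -1 ∨ j ≠ 0) : threeTermD f g i j = 0 := by
  by_cases hi : i = -2
  · by_cases hj : j = -1
    · lia
    by_cases hj : j = -2
    · subst hi; subst hj; rfl
    by_cases hj : j = 0
    · subst hi; subst hj; rfl
    · exact (isZero_threeTermX (by lia) (by lia) (by lia)).eq_of_tgt _ _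
  by_cases hi : i = -1
  · by_cases hj : j = 0
    · lia
    by_cases hj : j = -2
    · subst hi; subst hj; rfl
    by_cases hj : j = -1
    · subst hi; subst hj; rfl
    · exact (isZero_threeTermX (by lia) (by lia) (by lia)).eq_of_tgt _ _
  by_cases hi : i = 0
  · subst hi
    by_cases hj : j = 0
    · subst hj; rfl
    by_cases hj : j = -2
    · subst hj; rfl
    by_cases hj : j = -1
    · subst hj; rfl
    · exact (isZero_threeTermX (by lia) (by lia) (by lia)).eq_of_tgt _ _
  · exact (isZero_threeTermX (by lia) (by lia) (by lia)).eq_of_src _ _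

/-- The complex `E ⟶ F ⟶ G` with `G` in degree `0`. -/
def threeTerm (f : E ⟶ F) (g : F ⟶ G) (w : f ≫ g = 0) : CochainComplex (Factorization W) ℤ where
  X := threeTermX E F G
  d := threeTermD f g
  shape i j h := by
    simp only [ComplexShape.up_Rel] at h
    exact threeTermD_eq_zero f g (by lia) (by lia)
  d_comp_d' i j k h h' := by
    simp only [ComplexShape.up_Rel] at h h'
    by_cases hi : i = -2
    · obtain rfl : j = -1 := by lia
      obtain rfl : k = 0 := by lia
      subst hi
      exact w
    by_cases hj : j = 0
    · rw [threeTermD_eq_zero f g (i := j) (j := k) (by lia) (by lia)]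
      exact Limits.comp_zero
    · rw [threeTermD_eq_zero f g (i := i) (j := j) (by lia) (by lia)]
      exact zero_comp

/-- In degrees 0 and -2 the required kernels and cokernels are identities or zero because `g` is an
epimorphism and `f` a monomorphism; in degree -1 they are `f` and `g` themselves. -/
theorem IsShortExact.isBoundedExact {f : E ⟶ F} {g : F ⟶ G} (h : IsShortExact f g) :
    IsBoundedExact (threeTerm f g h.comp) := by
  have := h.mono
  have := h.epi
  refine ⟨fun n => ?_, 2, fun n hn => isZero_threeTermX ?_ ?_ ?_⟩
  · by_cases h0 : n = 0
    · subst h0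
      rw [HomologicalComplex.exactAt_iff' _ (-1) 0 1 (by simp) (by simp)]
      have : Mono (0 : zeroFact W ⟶ zeroFact W) := (isZero_zeroFact W).mono _
      exact show (ShortComplex.mk g (0 : G ⟶ zeroFact W) Limits.comp_zero).Exact from
        exact_of_kernel_cokernel (isZero_zeroFact W) (𝟙 G) (Category.id_comp _)
        (KernelFork.IsLimit.ofId _ rfl) (0 : G ⟶ zeroFact W) Limits.comp_zero
        (CokernelCofork.IsColimit.ofπ _ _ (fun _ _ => 0)
          (fun k hk => (zero_of_epi_comp g hk).symm ▸ zero_comp)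
          (fun _ _ _ _ => (isZero_zeroFact W).eq_of_src _ _)) g (Category.comp_id _)
        (0 : zeroFact W ⟶ zeroFact W) zero_comp
    by_cases h1 : n = -1
    · subst h1
      rw [HomologicalComplex.exactAt_iff' _ (-2) (-1) 0 (by simp) (by simp)]
      exact show (ShortComplex.mk f g h.comp).Exact from
        exact_of_kernel_cokernel (isZero_zeroFact W) f h.comp h.isKernel g h.comp h.isCokernel
        (𝟙 E) (Category.id_comp _) (𝟙 G) (Category.comp_id _)
    by_cases h2 : n = -2
    · subst h2
      rw [HomologicalComplex.exactAt_iff' _ (-3) (-2) (-1) (by simp) (by simp)]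
      have : Epi (0 : zeroFact W ⟶ zeroFact W) := (isZero_zeroFact W).epi _
      exact show (ShortComplex.mk (0 : zeroFact W ⟶ E) f zero_comp).Exact from
        exact_of_kernel_cokernel (isZero_zeroFact W) (0 : zeroFact W ⟶ E) zero_comp
        (KernelFork.IsLimit.ofι _ _ (fun _ _ => 0)
          (fun k hk => (zero_of_comp_mono f hk).symm ▸ Limits.comp_zero)
          (fun _ _ _ _ => (isZero_zeroFact W).eq_of_tgt _ _)) (𝟙 E) (Category.comp_id _)
        (CokernelCofork.IsColimit.ofId _ rfl) (0 : zeroFact W ⟶ zeroFact W) Limits.comp_zero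
        f (Category.id_comp _)
    · exact ShortComplex.exact_of_isZero_X₂ _ (isZero_threeTermX h0 h1 h2)
  all_goals rintro rfl; simp at hn

end

/-! ### Totalizations of short exact sequences -/

section
variable {A : Type u} [Category.{v} A] {W : Potential A}

/-- For small exponents the canonical isomorphisms unfold to units and counits, and a triangle
identity remains. The powers of Φ that occur for a complex in degrees -2, -1, 0 involve only the
exponents -1, 0, 1. -/
theorem mulInvIso_neg_one_zero (h : (-1 : ℤ) + 1 = 0) (X : A) :
    (mulInvIso W.Φ h).hom.app X = 𝟙 (W.Φ.inverse.obj X) := by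
  have e : W.Φ.inverse.map (𝟙 X ≫ W.Φ.counitIso.inv.app X) ≫ 𝟙 _ ≫
      W.Φ.unitIso.inv.app (W.Φ.inverse.obj X) ≫ 𝟙 _ = 𝟙 (W.Φ.inverse.obj X) := by
    simp
  exact e

theorem invMulIso_neg_one_zero (h : (-1 : ℤ) + 1 = 0) (X : A) :
    (invMulIso W.Φ h).inv.app X = 𝟙 (W.Φ.inverse.obj X) := by
  have e : ((𝟙 (W.Φ.inverse.obj X) ≫ W.Φ.inverse.map (W.Φ.counitIso.inv.app X)) ≫ 𝟙 _) ≫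
      W.Φ.unitIso.inv.app (W.Φ.inverse.obj X) ≫ 𝟙 _ = 𝟙 (W.Φ.inverse.obj X) := by
    simp
  exact e

theorem mulInvIso_zero_one (h : (0 : ℤ) + 1 = 1) (X : A) :
    (mulInvIso W.Φ h).hom.app X = W.Φ.unitIso.inv.app X := by
  have e : W.Φ.inverse.map (𝟙 (W.Φ.functor.obj X) ≫ 𝟙 _) ≫ 𝟙 _ ≫ W.Φ.unitIso.inv.app X ≫ 𝟙 _ =
      W.Φ.unitIso.inv.app X := by
    simp
  exact e

theorem invMulIso_zero_one (h : (0 : ℤ) + 1 = 1) (X : A) :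
    (invMulIso W.Φ h).inv.app X = W.Φ.counitIso.inv.app X := by
  have e : ((𝟙 X ≫ W.Φ.counitIso.inv.app X) ≫ 𝟙 _) ≫ 𝟙 _ ≫ 𝟙 _ = W.Φ.counitIso.inv.app X := by
    simp
  exact e

end

section
open Factorization
variable {A : Type u} [Category.{v} A] [Abelian A] {W : Potential A} [HasProducts.{v} A]
variable {E F G : Factorization W} (f : E ⟶ F) (g : F ⟶ G) (w : f ≫ g = 0)

/-- The factors of index 0, -1 and -2 are the only possibly nonzero ones. The targets of these
projections are written without powers because Φ⁰ and Φ¹ reduce to the identity and to Φ. -/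
def totNegG : (tot (threeTerm f g w)).neg ⟶ G.neg := by
  exact πnegE W (fun n => ((threeTerm f g w).X n).neg) (fun n => ((threeTerm f g w).X n).zero) 0
def totNegF : (tot (threeTerm f g w)).neg ⟶ F.zero := by
  exact πnegO W (fun n => ((threeTerm f g w).X n).neg) (fun n => ((threeTerm f g w).X n).zero) (-1 : ℤ)
def totNegE : (tot (threeTerm f g w)).neg ⟶ W.Φ.functor.obj E.neg := by
  exact πnegE W (fun n => ((threeTerm f g w).X n).neg) (fun n => ((threeTerm f g w).X n).zero) (-1 : ℤ)
def totZeroG : (tot (threeTerm f g w)).zero ⟶ G.zero := by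
  exact πzeroE W (fun n => ((threeTerm f g w).X n).neg) (fun n => ((threeTerm f g w).X n).zero) 0
def totZeroF : (tot (threeTerm f g w)).zero ⟶ W.Φ.functor.obj F.neg := by
  exact πzeroO W (fun n => ((threeTerm f g w).X n).neg) (fun n => ((threeTerm f g w).X n).zero) (-1 : ℤ)
def totZeroE : (tot (threeTerm f g w)).zero ⟶ W.Φ.functor.obj E.zero := by
  exact πzeroE W (fun n => ((threeTerm f g w).X n).neg) (fun n => ((threeTerm f g w).X n).zero) (-1 : ℤ)

theorem tot_φneg_G : (tot (threeTerm f g w)).φneg ≫ totNegG f g w =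
    W.Φ.inverse.map (totZeroG f g w) ≫ G.φneg +
      W.Φ.inverse.map (totZeroF f g w) ≫ W.Φ.unitIso.inv.app F.neg ≫ g.neg := by
  have e := totφneg_πE (threeTerm f g w) 0
  change (tot (threeTerm f g w)).φneg ≫ totNegG f g w =
    W.Φ.inverse.map (totZeroG f g w) ≫ (mulInvIso W.Φ (show (-1 : ℤ) + 1 = 0 by lia)).hom.app _ ≫
    (invMulIso W.Φ (show (-1 : ℤ) + 1 = 0 by lia)).inv.app _ ≫ G.φneg +
    W.Φ.inverse.map (totZeroF f g w) ≫ (mulInvIso W.Φ (show (0 : ℤ) + 1 = 1 by lia)).hom.app _ ≫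
      g.neg at e
  rw [mulInvIso_neg_one_zero, invMulIso_neg_one_zero, mulInvIso_zero_one] at e
  refine e.trans ?_
  congr 2
  exact (Category.id_comp _).trans (Category.id_comp _)

theorem tot_φneg_F : (tot (threeTerm f g w)).φneg ≫ totNegF f g w =
    -(W.Φ.inverse.map (totZeroF f g w) ≫ W.Φ.unitIso.inv.app F.neg ≫ F.φzero) +
      W.Φ.inverse.map (totZeroE f g w) ≫ W.Φ.unitIso.inv.app E.zero ≫ f.zero := by
  have e := totφneg_πO (threeTerm f g w) (-1)
  change (tot (threeTerm f g w)).φneg ≫ totNegF f g w = -(W.Φ.inverse.map (totZeroF f g w) ≫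
    (mulInvIso W.Φ (show (0 : ℤ) + 1 = 1 by lia)).hom.app _ ≫ F.φzero) +
    W.Φ.inverse.map (totZeroE f g w) ≫ (mulInvIso W.Φ (show (0 : ℤ) + 1 = 1 by lia)).hom.app _ ≫
      f.zero at e
  rwa [mulInvIso_zero_one, mulInvIso_zero_one] at e

theorem tot_φneg_E : (tot (threeTerm f g w)).φneg ≫ totNegE f g w =
    W.Φ.inverse.map (totZeroE f g w) ≫ W.Φ.unitIso.inv.app E.zero ≫
      W.Φ.counitIso.inv.app E.zero ≫ W.Φ.functor.map E.φneg := by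
  have e := totφneg_πE (threeTerm f g w) (-1)
  -- Nothing maps into the lowest term E, so only its own structure morphism contributes.
  have h : (threeTerm f g w).d (2 * (-1 - 1) + 1) (2 * -1) = 0 :=
    threeTermD_eq_zero f g (by lia) (by lia)
  have h' : (W.Φ ^ (-(-1) : ℤ)).functor.map
    ((threeTerm f g w).d (2 * (-1 - 1) + 1) (2 * -1)).neg = 0 := by
    rw [h]
    exact Functor.map_zero _ _ _
  rw [h', Limits.comp_zero, Limits.comp_zero, add_zero] at e
  change (tot (threeTerm f g w)).φneg ≫ totNegE f g w = W.Φ.inverse.map (totZeroE f g w) ≫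
    (mulInvIso W.Φ (show (0 : ℤ) + 1 = 1 by lia)).hom.app _ ≫
    (invMulIso W.Φ (show (0 : ℤ) + 1 = 1 by lia)).inv.app _ ≫ W.Φ.functor.map E.φneg at e
  rwa [mulInvIso_zero_one, invMulIso_zero_one] at e

theorem tot_φzero_G : (tot (threeTerm f g w)).φzero ≫ totZeroG f g w =
    totNegG f g w ≫ G.φzero + totNegF f g w ≫ g.zero := by
  have e := totφzero_πE (threeTerm f g w) 0
  change (tot (threeTerm f g w)).φzero ≫ totZeroG f g w =
    totNegG f g w ≫ G.φzero + totNegF f g w ≫ 𝟙 _ ≫ g.zero at e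
  rwa [Category.id_comp] at e

theorem tot_φzero_F : (tot (threeTerm f g w)).φzero ≫ totZeroF f g w =
    -(totNegF f g w ≫ W.Φ.counitIso.inv.app F.zero ≫ W.Φ.functor.map F.φneg) +
      totNegE f g w ≫ W.Φ.functor.map f.neg := by
  have e := totφzero_πO (threeTerm f g w) (-1)
  change (tot (threeTerm f g w)).φzero ≫ totZeroF f g w =
    -(totNegF f g w ≫ (invMulIso W.Φ (show (0 : ℤ) + 1 = 1 by lia)).inv.app _ ≫
    W.Φ.functor.map F.φneg) + totNegE f g w ≫ W.Φ.functor.map f.neg at e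
  rwa [invMulIso_zero_one] at e

theorem tot_φzero_E : (tot (threeTerm f g w)).φzero ≫ totZeroE f g w =
    totNegE f g w ≫ W.Φ.functor.map E.φzero := by
  have e := totφzero_πE (threeTerm f g w) (-1)
  have h : (threeTerm f g w).d (2 * (-1 - 1) + 1) (2 * -1) = 0 :=
    threeTermD_eq_zero f g (by lia) (by lia)
  have h' : (W.Φ ^ (-(-1) : ℤ)).functor.map
    ((threeTerm f g w).d (2 * (-1 - 1) + 1) (2 * -1)).zero = 0 := by
    rw [h]
    exact Functor.map_zero _ _ _
  rw [h', Limits.comp_zero, Limits.comp_zero, add_zero] at e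
  exact e

omit [HasProducts.{v} A] in
theorem isZero_threeTermX_neg {n : ℤ} (h₀ : n ≠ 0) (h₁ : n ≠ -1) (h₂ : n ≠ -2) :
    IsZero (threeTermX E F G n).neg ∧ IsZero (threeTermX E F G n).zero := by
  match n with
  | Int.ofNat 0 => exact absurd rfl h₀
  | Int.negSucc 0 => exact absurd rfl h₁
  | Int.negSucc 1 => exact absurd rfl h₂
  | Int.ofNat (n + 1) => exact ⟨isZero_zero A, isZero_zero A⟩
  | Int.negSucc (n + 2) => exact ⟨isZero_zero A, isZero_zero A⟩

theorem totNeg_hom_ext {Z : A} {s t : Z ⟶ (tot (threeTerm f g w)).neg}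
    (hG : s ≫ totNegG f g w = t ≫ totNegG f g w) (hF : s ≫ totNegF f g w = t ≫ totNegF f g w)
    (hE : s ≫ totNegE f g w = t ≫ totNegE f g w) : s = t := by
  apply totNeg_ext (Xn := fun n => ((threeTerm f g w).X n).neg)
    (Xz := fun n => ((threeTerm f g w).X n).zero)
  · intro l
    by_cases h0 : l = 0
    · subst h0; exact hG
    by_cases h1 : l = -1
    · subst h1; exact hE
    · exact (Functor.map_isZero _ (isZero_threeTermX_neg (n := 2 * l) (by lia) (by lia)
        (by lia)).1).eq_of_tgt _ _
  · intro l
    by_cases h1 : l = -1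
    · subst h1; exact hF
    · exact (Functor.map_isZero _ (isZero_threeTermX_neg (n := 2 * l + 1) (by lia) (by lia)
        (by lia)).2).eq_of_tgt _ _

theorem totZero_hom_ext {Z : A} {s t : Z ⟶ (tot (threeTerm f g w)).zero}
    (hG : s ≫ totZeroG f g w = t ≫ totZeroG f g w) (hF : s ≫ totZeroF f g w = t ≫ totZeroF f g w)
    (hE : s ≫ totZeroE f g w = t ≫ totZeroE f g w) : s = t := by
  apply totZero_ext (Xn := fun n => ((threeTerm f g w).X n).neg)
    (Xz := fun n => ((threeTerm f g w).X n).zero)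
  · intro l
    by_cases h0 : l = 0
    · subst h0; exact hG
    by_cases h1 : l = -1
    · subst h1; exact hE
    · exact (Functor.map_isZero _ (isZero_threeTermX_neg (n := 2 * l) (by lia) (by lia)
        (by lia)).2).eq_of_tgt _ _
  · intro l
    by_cases h1 : l = -1
    · subst h1; exact hF
    · exact (Functor.map_isZero _ (isZero_threeTermX_neg (n := 2 * l + 1) (by lia) (by lia)
        (by lia)).1).eq_of_tgt _ _

/-- Two prescribed values suffice, since all other coordinates of the totalization of a three-term
complex lie in zero objects. -/
theorem exists_family (X : ℤ → Type*) [∀ l, Zero (X l)] (a : X 0) (c : X (-1)) :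
    ∃ f : ∀ l, X l, f 0 = a ∧ f (-1) = c :=
  ⟨Function.update (Function.update 0 0 a) (-1) c, by simp, by simp⟩

theorem exists_totNegLift {Xn Xz : ℤ → A} {Z : A} (a : Z ⟶ (W.Φ ^ (-0 : ℤ)).functor.obj (Xn (2 * 0)))
    (b : Z ⟶ (W.Φ ^ (-(-1) - 1 : ℤ)).functor.obj (Xz (2 * -1 + 1)))
    (c : Z ⟶ (W.Φ ^ (-(-1) : ℤ)).functor.obj (Xn (2 * -1))) : ∃ t : Z ⟶ totNeg W Xn Xz,
      t ≫ πnegE W Xn Xz 0 = a ∧ t ≫ πnegO W Xn Xz (-1) = b ∧ t ≫ πnegE W Xn Xz (-1) = c := by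
  obtain ⟨fE, rfl, rfl⟩ := exists_family (fun l : ℤ => Z ⟶ (W.Φ ^ (-l)).functor.obj
    (Xn (2 * l))) a c
  obtain ⟨fO, -, rfl⟩ := exists_family (fun l : ℤ => Z ⟶ (W.Φ ^ (-l - 1)).functor.obj
    (Xz (2 * l + 1))) 0 b
  exact ⟨totNegLift fE fO, totNegLift_πE fE fO 0, totNegLift_πO fE fO (-1), totNegLift_πE fE fO (-1)⟩

theorem exists_totZeroLift {Xn Xz : ℤ → A} {Z : A} (a : Z ⟶ (W.Φ ^ (-0 : ℤ)).functor.obj (Xz (2 * 0)))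
    (b : Z ⟶ (W.Φ ^ (-(-1) : ℤ)).functor.obj (Xn (2 * -1 + 1)))
    (c : Z ⟶ (W.Φ ^ (-(-1) : ℤ)).functor.obj (Xz (2 * -1))) : ∃ t : Z ⟶ totZero W Xn Xz,
      t ≫ πzeroE W Xn Xz 0 = a ∧ t ≫ πzeroO W Xn Xz (-1) = b ∧ t ≫ πzeroE W Xn Xz (-1) = c := by
  obtain ⟨fE, rfl, rfl⟩ := exists_family (fun l : ℤ => Z ⟶ (W.Φ ^ (-l)).functor.obj
    (Xz (2 * l))) a c
  obtain ⟨fO, -, rfl⟩ := exists_family (fun l : ℤ => Z ⟶ (W.Φ ^ (-l)).functor.obj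
    (Xn (2 * l + 1))) 0 b
  exact ⟨totZeroLift fE fO, totZeroLift_πE fE fO 0, totZeroLift_πO fE fO (-1), totZeroLift_πE fE fO (-1)⟩

theorem exists_totNeg_lift {Z : A} (a : Z ⟶ G.neg) (b : Z ⟶ F.zero)
    (c : Z ⟶ W.Φ.functor.obj E.neg) : ∃ t : Z ⟶ (tot (threeTerm f g w)).neg,
      t ≫ totNegG f g w = a ∧ t ≫ totNegF f g w = b ∧ t ≫ totNegE f g w = c := by
  have h := exists_totNegLift (Xn := fun n => ((threeTerm f g w).X n).neg)
    (Xz := fun n => ((threeTerm f g w).X n).zero) (Z := Z) (W := W)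
  exact h a b c

theorem exists_totZero_lift {Z : A} (a : Z ⟶ G.zero) (b : Z ⟶ W.Φ.functor.obj F.neg)
    (c : Z ⟶ W.Φ.functor.obj E.zero) : ∃ t : Z ⟶ (tot (threeTerm f g w)).zero,
      t ≫ totZeroG f g w = a ∧ t ≫ totZeroF f g w = b ∧ t ≫ totZeroE f g w = c := by
  have h := exists_totZeroLift (Xn := fun n => ((threeTerm f g w).X n).neg)
    (Xz := fun n => ((threeTerm f g w).X n).zero) (Z := Z) (W := W)
  exact h a b c

omit [HasProducts.{v} A] in
theorem coneNeg_total : coneFstNeg f ≫ coneLiftNeg (𝟙 _) 0 + coneSndNeg f ≫ coneLiftNeg 0 (𝟙 _) =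
    𝟙 (cone f).neg := by
  apply coneNeg_ext <;> simp

/-- The morphism from the cone of `E ⟶ F` to `G` for a complex `E ⟶ F ⟶ G`. -/
def coneDesc : cone f ⟶ G where
  neg := coneSndNeg f ≫ g.neg
  zero := coneSndZero f ≫ g.zero
  comm_neg := by
    have h : f.neg ≫ g.neg = 0 := congrArg Hom.neg w
    simp [h, g.comm_neg]
  comm_zero := by
    have h : f.zero ≫ g.zero = 0 := congrArg Hom.zero w
    simp [h, g.comm_zero]

/-- The comparison of the totalization of `E ⟶ F ⟶ G` with an iterated cone. -/
def totToCone : tot (threeTerm f g w) ⟶ cone (coneDesc f g w) where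
  -- The outer cone shifts C(f) and thereby turns `f` into `-f`, whereas the totalization contains
  -- `f` with sign +; hence the sign on the factor of E.
  neg := coneLiftNeg (coneLiftZero (-totNegE f g w) (totNegF f g w)) (totNegG f g w)
  zero := coneLiftZero (-(totZeroE f g w ≫ W.Φ.functor.map (coneLiftNeg (𝟙 _) 0)) +
    totZeroF f g w ≫ W.Φ.functor.map (coneLiftNeg 0 (𝟙 _))) (totZeroG f g w)
  comm_neg := by
    apply coneNeg_ext
    · apply coneZero_ext
      · simp [tot_φneg_E]
      · simp [tot_φneg_F]
    · simp [tot_φneg_G, coneDesc, add_comm]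
  comm_zero := by
    apply coneZero_ext
    · simp [reassoc_of% tot_φzero_E f g w, reassoc_of% tot_φzero_F f g w]
      -- The identity of C(f)⁻¹ is split into its two summands under Φ, where the biproduct
      -- projections are not directly visible.
      have h : (cone f).φneg = (cone f).φneg ≫ (coneFstNeg f ≫ coneLiftNeg (𝟙 _) 0 +
          coneSndNeg f ≫ coneLiftNeg 0 (𝟙 _)) := by
        rw [coneNeg_total, Category.comp_id]
      rw [h]
      simp
      abel
    · simp [tot_φzero_G, coneDesc, add_comm]

/-- Up to one sign both factorizations have the same summands and the same matrix, so the comparison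
`totToCone` is invertible in each component. Thick subcategories are closed under retracts, so half
of the isomorphism is enough. -/
theorem exists_retract_tot : ∃ (i : cone (coneDesc f g w) ⟶ tot (threeTerm f g w))
    (r : tot (threeTerm f g w) ⟶ cone (coneDesc f g w)), i ≫ r = 𝟙 _ := by
  obtain ⟨a, haG, haF, haE⟩ := exists_totNeg_lift f g w (coneSndNeg (coneDesc f g w))
    (coneFstNeg (coneDesc f g w) ≫ coneSndZero f) (-(coneFstNeg (coneDesc f g w) ≫ coneFstZero f))
  obtain ⟨b, hbG, hbF, hbE⟩ := exists_totZero_lift f g w (coneSndZero (coneDesc f g w))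
    (coneFstZero (coneDesc f g w) ≫ W.Φ.functor.map (coneSndNeg f))
    (-(coneFstZero (coneDesc f g w) ≫ W.Φ.functor.map (coneFstNeg f)))
  have ha : a ≫ (totToCone f g w).neg = 𝟙 _ := by
    apply coneNeg_ext
    · apply coneZero_ext <;> simp [totToCone, haF, haE]
    · simp [totToCone, haG]
  have hb : b ≫ (totToCone f g w).zero = 𝟙 _ := by
    apply coneZero_ext
    · simp [totToCone, reassoc_of% hbF, reassoc_of% hbE]
      rw [← Functor.map_comp, ← Functor.map_comp, ← Preadditive.comp_add, ← Functor.map_add,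
        coneNeg_total, CategoryTheory.Functor.map_id, Category.comp_id]
    · simp [totToCone, hbG]
  -- Compatibility of `a` and `b` with the structure morphisms is inherited from `totToCone`,
  -- provided one can cancel its components on the right.
  have ma : Mono (totToCone f g w).neg := by
    refine ⟨fun s t h => totNeg_hom_ext _ _ _ ?_ ?_ ?_⟩
    · simpa [totToCone] using congrArg (· ≫ coneSndNeg _) h
    · simpa [totToCone] using congrArg (· ≫ coneFstNeg _ ≫ coneSndZero _) h
    · simpa [totToCone] using congrArg (· ≫ coneFstNeg _ ≫ coneFstZero _) h
  have mb : Mono (totToCone f g w).zero := by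
    refine ⟨fun s t h => totZero_hom_ext _ _ _ ?_ ?_ ?_⟩
    · simpa [totToCone] using congrArg (· ≫ coneSndZero _) h
    · simpa [totToCone] using congrArg (· ≫ coneFstZero _ ≫ W.Φ.functor.map (coneSndNeg _)) h
    · simpa [totToCone] using congrArg (· ≫ coneFstZero _ ≫ W.Φ.functor.map (coneFstNeg _)) h
  refine ⟨{ neg := a, zero := b, comm_neg := ?_, comm_zero := ?_ }, totToCone f g w,
    Factorization.hom_ext ha hb⟩
  · rw [← cancel_mono (totToCone f g w).neg, Category.assoc, ha, Category.assoc,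
      (totToCone f g w).comm_neg, ← Functor.map_comp_assoc, hb]
    simp
  · rw [← cancel_mono (totToCone f g w).zero, Category.assoc, hb, Category.assoc,
      (totToCone f g w).comm_zero, reassoc_of% ha]
    simp

/-- A property of objects of the homotopy category that contains the totalizations of bounded
exact complexes. -/
def ContainsTot (N : ObjectProperty (KFact W)) : Prop :=
  ∀ K : CochainComplex (Factorization W) ℤ, IsBoundedExact K → N ((toK W).obj (tot K))

variable {f g} {N : ObjectProperty (KFact W)}

theorem IsShortExact.cone_mem (h : IsShortExact f g) (hN : IsThick N) (hT : ContainsTot N) :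
    N ((toK W).obj (cone (coneDesc f g h.comp))) := by
  obtain ⟨i, r, e⟩ := exists_retract_tot f g h.comp
  exact hN.of_retract i r e (hT _ h.isBoundedExact)

/-- The cone of C(f) ⟶ G belongs to `N`, being a totalization up to retracts; rotation gives first
C(f) and then the missing term. -/
theorem IsShortExact.mem_middle (h : IsShortExact f g) (hN : IsThick N) (hT : ContainsTot N)
    (hE : N ((toK W).obj E)) (hG : N ((toK W).obj G)) : N ((toK W).obj F) :=
  hN.target_of_cone f hE (hN.source_of_cone _ hG (h.cone_mem hN hT))

theorem IsShortExact.mem_left (h : IsShortExact f g) (hN : IsThick N) (hT : ContainsTot N)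
    (hF : N ((toK W).obj F)) (hG : N ((toK W).obj G)) : N ((toK W).obj E) :=
  hN.source_of_cone f hF (hN.source_of_cone _ hG (h.cone_mem hN hT))

end

/-! ### Contractible factorizations and short exact sequences of cones -/

section
open Factorization
variable {A : Type u} [Category.{v} A] [Abelian A] {W : Potential A}

/-- The cofree factorization on a pair of objects. -/
def cofree (W : Potential A) (Z : A × A) : Factorization W where
  neg := Z.1 ⊞ Z.2
  zero := Z.2 ⊞ W.Φ.functor.obj Z.1
  φneg := biprod.lift (W.Φ.inverse.map biprod.snd ≫ W.Φ.unitIso.inv.app Z.1)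
    (W.Φ.inverse.map biprod.fst ≫ wInv W.Φ W.w Z.2)
  φzero := biprod.lift biprod.snd (biprod.fst ≫ W.w.app Z.1)
  φneg_φzero := by
    change _ = wInv W.Φ W.w _
    apply biprod.hom_ext
    · simp [wInv_naturality]
    · rw [wInv_naturality]
      have := W.Φ.unitIso.inv.naturality (W.w.app Z.1)
      simp only [Functor.id_obj, Functor.comp_obj, Functor.id_map, Functor.comp_map] at this
      simp only [Category.assoc, biprod.lift_snd, biprod.lift_fst_assoc, wInv, W.w_comm, ← this]
  φzero_φneg := by
    rw [Factorization.φzero_φneg_iff]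
    apply biprod.hom_ext
    · rw [wInv_naturality, Category.assoc, biprod.lift_fst, ← Functor.map_comp_assoc,
        biprod.lift_snd, wInv, Functor.map_comp_assoc]
    · rw [wInv_naturality, Category.assoc, biprod.lift_snd, ← Functor.map_comp_assoc,
        biprod.lift_fst]

/-- A contraction of a factorization, in components. -/
theorem isZero_toK_of_contraction {E : Factorization W} (hneg : E.neg ⟶ W.Φ.inverse.obj E.zero)
    (hzero : E.zero ⟶ E.neg) (h₁ : E.φzero ≫ hzero + hneg ≫ E.φneg = 𝟙 _)
    (h₂ : E.φneg ≫ hneg + W.Φ.inverse.map (hzero ≫ E.φzero) = 𝟙 _) : IsZero ((toK W).obj E) :=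
  isZero_toK (E := E) (hneg, hzero) (Prod.ext (by rwa [Functor.map_comp] at h₂) h₁)

section
variable (Z : A × A)

/-- Projections of a cofree factorization. -/
def cofreeNegFst : (cofree W Z).neg ⟶ Z.1 := biprod.fst
/-- Projections of a cofree factorization. -/
def cofreeNegSnd : (cofree W Z).neg ⟶ Z.2 := biprod.snd
/-- Projections of a cofree factorization. -/
def cofreeZeroFst : (cofree W Z).zero ⟶ Z.2 := biprod.fst
/-- Projections of a cofree factorization. -/
def cofreeZeroSnd : (cofree W Z).zero ⟶ W.Φ.functor.obj Z.1 := biprod.snd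

theorem cofree_φneg_fst : (cofree W Z).φneg ≫ cofreeNegFst Z =
    W.Φ.inverse.map (cofreeZeroSnd Z) ≫ W.Φ.unitIso.inv.app Z.1 := biprod.lift_fst _ _
theorem cofree_φneg_snd : (cofree W Z).φneg ≫ cofreeNegSnd Z =
    W.Φ.inverse.map (cofreeZeroFst Z) ≫ wInv W.Φ W.w Z.2 := biprod.lift_snd _ _
theorem cofree_φzero_fst : (cofree W Z).φzero ≫ cofreeZeroFst Z = cofreeNegSnd Z :=
  biprod.lift_fst _ _
theorem cofree_φzero_snd : (cofree W Z).φzero ≫ cofreeZeroSnd Z =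
    cofreeNegFst Z ≫ W.w.app Z.1 := biprod.lift_snd _ _

variable {Z} {T : A}

/-- The morphism to the component `-1` of a cofree factorization with given components. -/
def cofreeLiftNeg (a : T ⟶ Z.1) (b : T ⟶ Z.2) : T ⟶ (cofree W Z).neg := biprod.lift a b
/-- The morphism to the component `0` of a cofree factorization with given components. -/
def cofreeLiftZero (a : T ⟶ Z.2) (b : T ⟶ W.Φ.functor.obj Z.1) : T ⟶ (cofree W Z).zero :=
  biprod.lift a b

@[simp] theorem cofreeLiftNeg_fst (a : T ⟶ Z.1) (b : T ⟶ Z.2) :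
    cofreeLiftNeg (W := W) a b ≫ cofreeNegFst Z = a := biprod.lift_fst _ _
@[simp] theorem cofreeLiftNeg_snd (a : T ⟶ Z.1) (b : T ⟶ Z.2) :
    cofreeLiftNeg (W := W) a b ≫ cofreeNegSnd Z = b := biprod.lift_snd _ _
@[simp] theorem cofreeLiftZero_fst (a : T ⟶ Z.2) (b : T ⟶ W.Φ.functor.obj Z.1) :
    cofreeLiftZero a b ≫ cofreeZeroFst Z = a := biprod.lift_fst _ _
@[simp] theorem cofreeLiftZero_snd (a : T ⟶ Z.2) (b : T ⟶ W.Φ.functor.obj Z.1) :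
    cofreeLiftZero a b ≫ cofreeZeroSnd Z = b := biprod.lift_snd _ _

theorem cofreeNeg_ext {s t : T ⟶ (cofree W Z).neg} (h₁ : s ≫ cofreeNegFst Z = t ≫ cofreeNegFst Z)
    (h₂ : s ≫ cofreeNegSnd Z = t ≫ cofreeNegSnd Z) : s = t := biprod.hom_ext _ _ h₁ h₂
theorem cofreeZero_ext {s t : T ⟶ (cofree W Z).zero}
    (h₁ : s ≫ cofreeZeroFst Z = t ≫ cofreeZeroFst Z)
    (h₂ : s ≫ cofreeZeroSnd Z = t ≫ cofreeZeroSnd Z) : s = t := biprod.hom_ext _ _ h₁ h₂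

end

/-- One of the two structure morphisms carries the summand Z⁰ identically to Z⁰, the other carries
Φ(Z⁻¹) to Z⁻¹ through the unit isomorphism; the contraction moves these summands back. -/
theorem isZero_toK_cofree (Z : A × A) : IsZero ((toK W).obj (cofree W Z)) := by
  refine isZero_toK_of_contraction (E := cofree W Z)
    (cofreeNegFst Z ≫ W.Φ.unitIso.hom.app Z.1 ≫ W.Φ.inverse.map (cofreeLiftZero 0 (𝟙 _)))
    (cofreeZeroFst Z ≫ cofreeLiftNeg 0 (𝟙 _)) ?_ ?_
  · apply cofreeNeg_ext
    · simp [cofree_φneg_fst, ← Functor.map_comp_assoc]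
    · simp [cofree_φneg_snd, reassoc_of% cofree_φzero_fst, ← Functor.map_comp_assoc]
  · rw [reassoc_of% cofree_φneg_fst, Iso.inv_hom_id_app_assoc, ← Functor.map_comp,
      ← Functor.map_add, ← W.Φ.inverse.map_id]
    congr 1
    apply cofreeZero_ext
    · simp [cofree_φzero_fst]
    · have h : cofreeLiftNeg (W := W) (0 : Z.2 ⟶ Z.1) (𝟙 Z.2) ≫ cofreeNegFst Z = 0 := by simp
      simp [cofree_φzero_snd, reassoc_of% h]

/-- The morphism to a cofree factorization given by a pair of morphisms. -/
def cofreeLift {M : Factorization W} {Z : A × A} (κ : M.pair ⟶ Z) : M ⟶ cofree W Z where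
  neg := cofreeLiftNeg κ.1 (M.φzero ≫ κ.2)
  zero := cofreeLiftZero κ.2 (W.Φ.counitIso.inv.app M.zero ≫ W.Φ.functor.map (M.φneg ≫ κ.1))
  comm_neg := by
    have h : M.φneg ≫ M.φzero = wInv W.Φ W.w _ := M.φneg_φzero
    have h' := Factorization.inverse_map_mate (M.φneg ≫ κ.1)
    apply cofreeNeg_ext
    · rw [Category.assoc, cofreeLiftNeg_fst, Category.assoc, cofree_φneg_fst,
        ← Functor.map_comp_assoc, cofreeLiftZero_snd, h']
    · rw [Category.assoc, cofreeLiftNeg_snd, Category.assoc, cofree_φneg_snd,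
        ← Functor.map_comp_assoc, cofreeLiftZero_fst, reassoc_of% h, wInv_naturality]
  comm_zero := by
    have h := M.φzero_φneg
    apply cofreeZero_ext
    · simp [cofree_φzero_fst]
    · simp only [Category.assoc, cofree_φzero_snd, cofreeLiftZero_snd, Functor.map_comp]
      rw [reassoc_of% h, ← Category.assoc, cofreeLiftNeg_fst]
      exact (W.w.naturality κ.1).symm

@[simp] theorem cofreeLift_neg_fst {M : Factorization W} {Z : A × A} (κ : M.pair ⟶ Z) :
    (cofreeLift κ).neg ≫ cofreeNegFst Z = κ.1 := biprod.lift_fst _ _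
@[simp] theorem cofreeLift_neg_snd {M : Factorization W} {Z : A × A} (κ : M.pair ⟶ Z) :
    (cofreeLift κ).neg ≫ cofreeNegSnd Z = M.φzero ≫ κ.2 := biprod.lift_snd _ _
@[simp] theorem cofreeLift_zero_fst {M : Factorization W} {Z : A × A} (κ : M.pair ⟶ Z) :
    (cofreeLift κ).zero ≫ cofreeZeroFst Z = κ.2 := biprod.lift_fst _ _
@[simp] theorem cofreeLift_zero_snd {M : Factorization W} {Z : A × A} (κ : M.pair ⟶ Z) :
    (cofreeLift κ).zero ≫ cofreeZeroSnd Z =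
      W.Φ.counitIso.inv.app M.zero ≫ W.Φ.functor.map (M.φneg ≫ κ.1) := biprod.lift_snd _ _

/-- The usual contraction: the unshifted copy of `E` is moved back onto the shifted one. -/
theorem isZero_toK_cone_id (E : Factorization W) : IsZero ((toK W).obj (cone (𝟙 E))) := by
  refine isZero_toK_of_contraction (E := cone (𝟙 E))
    (coneSndNeg _ ≫ W.Φ.unitIso.hom.app E.neg ≫ W.Φ.inverse.map (coneLiftZero (𝟙 _) 0))
    (coneSndZero _ ≫ coneLiftNeg (𝟙 _) 0) ?_ ?_
  · apply coneNeg_ext <;> simp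
  · have h : E.φneg ≫ W.Φ.unitIso.hom.app E.neg =
        W.Φ.inverse.map (W.Φ.counitIso.inv.app E.zero ≫ W.Φ.functor.map E.φneg) := by
      rw [← cancel_mono (W.Φ.unitIso.inv.app E.neg), Category.assoc, Iso.hom_inv_id_app,
        Factorization.inverse_map_mate]
      exact Category.comp_id _
    rw [cone_φneg_snd_assoc, reassoc_of% h, id_neg]
    erw [Category.id_comp, Iso.inv_hom_id_app_assoc]
    simp only [← Functor.map_comp, ← Functor.map_add]
    rw [← W.Φ.inverse.map_id]
    congr 1
    apply coneZero_ext <;> simp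

/-! ### Morphisms of cones and their exactness -/

section
variable {E₁ E₂ F₁ F₂ : Factorization W} {a : E₁ ⟶ E₂} {b : F₁ ⟶ F₂}

/-- The morphism of cones given by a commutative square. -/
def coneMap (f₁ : E₁ ⟶ F₁) (f₂ : E₂ ⟶ F₂) (h : a ≫ f₂ = f₁ ≫ b) : cone a ⟶ cone b where
  neg := coneLiftNeg (coneFstNeg a ≫ f₁.zero) (coneSndNeg a ≫ f₂.neg)
  zero := coneLiftZero (coneFstZero a ≫ W.Φ.functor.map f₁.neg) (coneSndZero a ≫ f₂.zero)
  comm_neg := by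
    have h' : a.neg ≫ f₂.neg = f₁.neg ≫ b.neg := congrArg Hom.neg h
    apply coneNeg_ext
    · simp [f₁.comm_zero]
    · simp [h', f₂.comm_neg]
  comm_zero := by
    have h' : a.zero ≫ f₂.zero = f₁.zero ≫ b.zero := congrArg Hom.zero h
    apply coneZero_ext
    · simpa using congrArg (coneFstNeg a ≫ ·) (counitInv_map_comm f₁ (𝟙 _))
    · simp [h', f₂.comm_zero]

variable {G₁ G₂ : Factorization W} {c : G₁ ⟶ G₂} {f₁ : E₁ ⟶ F₁} {f₂ : E₂ ⟶ F₂}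
  {g₁ : F₁ ⟶ G₁} {g₂ : F₂ ⟶ G₂}

theorem coneNeg_ext' {T : A} {s t : (cone a).neg ⟶ T}
    (h₁ : coneLiftNeg (𝟙 _) 0 ≫ s = coneLiftNeg (𝟙 _) 0 ≫ t)
    (h₂ : coneLiftNeg 0 (𝟙 _) ≫ s = coneLiftNeg 0 (𝟙 _) ≫ t) : s = t := by
  rw [← Category.id_comp s, ← Category.id_comp t, ← coneNeg_total, Preadditive.add_comp,
    Preadditive.add_comp, Category.assoc, Category.assoc, h₁, h₂, Category.assoc, Category.assoc]

theorem coneZero_ext' {T : A} {s t : (cone a).zero ⟶ T}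
    (h₁ : coneLiftZero (𝟙 _) 0 ≫ s = coneLiftZero (𝟙 _) 0 ≫ t)
    (h₂ : coneLiftZero 0 (𝟙 _) ≫ s = coneLiftZero 0 (𝟙 _) ≫ t) : s = t := by
  have h : coneFstZero a ≫ coneLiftZero (𝟙 _) 0 + coneSndZero a ≫ coneLiftZero 0 (𝟙 _) =
      𝟙 (cone a).zero := by
    apply coneZero_ext <;> simp
  rw [← Category.id_comp s, ← Category.id_comp t, ← h, Preadditive.add_comp,
    Preadditive.add_comp, Category.assoc, Category.assoc, h₁, h₂, Category.assoc, Category.assoc]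

/-- The lift is found after transposing along the equivalence Φ. It is needed because the
degree-zero part of a cone contains Φ(E⁻¹). -/
theorem IsShortExact.exists_lift_map (h : IsShortExact f₁ g₁) {Z : A}
    (t : Z ⟶ W.Φ.functor.obj F₁.neg) (ht : t ≫ W.Φ.functor.map g₁.neg = 0) :
    ∃ s, s ≫ W.Φ.functor.map f₁.neg = t := by
  obtain ⟨s, hs⟩ := h.lift_neg (W.Φ.inverse.map t ≫ W.Φ.unitIso.inv.app _) (by
    have := W.Φ.unitIso.inv.naturality g₁.neg
    simp only [Functor.id_obj, Functor.comp_obj, Functor.id_map, Functor.comp_map] at this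
    rw [Category.assoc, ← this, ← Functor.map_comp_assoc, ht, Functor.map_zero, zero_comp])
  refine ⟨W.Φ.counitIso.inv.app Z ≫ W.Φ.functor.map s, ?_⟩
  rw [Category.assoc, ← Functor.map_comp, hs, Functor.map_comp, counitInv_naturality]
  simp

/-- Exactness concerns only the underlying objects, on which a sequence of cones is the direct sum
of a shifted copy of the first sequence and the second one. -/
theorem IsShortExact.cone (h₁ : IsShortExact f₁ g₁) (h₂ : IsShortExact f₂ g₂)
    (e : a ≫ f₂ = f₁ ≫ b) (e' : b ≫ g₂ = g₁ ≫ c) :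
    IsShortExact (coneMap f₁ f₂ e) (coneMap g₁ g₂ e') := by
  have := h₁.mono_neg
  have := h₁.mono_zero
  have := h₂.mono_neg
  have := h₂.mono_zero
  have := h₁.epi_neg
  have := h₁.epi_zero
  have := h₂.epi_neg
  have := h₂.epi_zero
  constructor
  · apply Factorization.hom_ext
    · change coneLiftNeg _ _ ≫ coneLiftNeg _ _ = 0
      apply coneNeg_ext <;> simp [h₁.comp_zero, h₂.comp_neg]
    · change coneLiftZero _ _ ≫ coneLiftZero _ _ = 0
      apply coneZero_ext <;> simp [← Functor.map_comp, h₁.comp_neg, h₂.comp_zero]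
  · refine ⟨fun s t e => coneNeg_ext ?_ ?_⟩
    · rw [← cancel_mono f₁.zero]
      simpa [coneMap] using congrArg (· ≫ coneFstNeg b) e
    · rw [← cancel_mono f₂.neg]
      simpa [coneMap] using congrArg (· ≫ coneSndNeg b) e
  · refine ⟨fun s t e => coneZero_ext ?_ ?_⟩
    · rw [← cancel_mono (W.Φ.functor.map f₁.neg)]
      simpa [coneMap] using congrArg (· ≫ coneFstZero b) e
    · rw [← cancel_mono f₂.zero]
      simpa [coneMap] using congrArg (· ≫ coneSndZero b) e
  · refine ⟨fun s t e => coneNeg_ext' ?_ ?_⟩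
    · rw [← cancel_epi g₁.zero, ← Category.assoc, ← Category.assoc]
      have h : g₁.zero ≫ coneLiftNeg (𝟙 _) 0 = coneLiftNeg (𝟙 _) 0 ≫ (coneMap g₁ g₂ e').neg := by
        apply coneNeg_ext <;> simp [coneMap]
      rw [h, Category.assoc, e, Category.assoc]
    · rw [← cancel_epi g₂.neg, ← Category.assoc, ← Category.assoc]
      have h : g₂.neg ≫ coneLiftNeg 0 (𝟙 _) = coneLiftNeg 0 (𝟙 _) ≫ (coneMap g₁ g₂ e').neg := by
        apply coneNeg_ext <;> simp [coneMap]
      rw [h, Category.assoc, e, Category.assoc]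
  · refine ⟨fun s t e => coneZero_ext' ?_ ?_⟩
    · rw [← cancel_epi (W.Φ.functor.map g₁.neg), ← Category.assoc, ← Category.assoc]
      have h : W.Φ.functor.map g₁.neg ≫ coneLiftZero (𝟙 _) 0 =
          coneLiftZero (𝟙 _) 0 ≫ (coneMap g₁ g₂ e').zero := by
        apply coneZero_ext <;> simp [coneMap]
      rw [h, Category.assoc, e, Category.assoc]
    · rw [← cancel_epi g₂.zero, ← Category.assoc, ← Category.assoc]
      have h : g₂.zero ≫ coneLiftZero 0 (𝟙 _) =
          coneLiftZero 0 (𝟙 _) ≫ (coneMap g₁ g₂ e').zero := by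
        apply coneZero_ext <;> simp [coneMap]
      rw [h, Category.assoc, e, Category.assoc]
  · intro Z t ht
    obtain ⟨s₁, hs₁⟩ := h₁.lift_zero (t ≫ coneFstNeg b) (by
      simpa [coneMap] using congrArg (· ≫ coneFstNeg c) ht)
    obtain ⟨s₂, hs₂⟩ := h₂.lift_neg (t ≫ coneSndNeg b) (by
      simpa [coneMap] using congrArg (· ≫ coneSndNeg c) ht)
    exact ⟨coneLiftNeg s₁ s₂, by apply coneNeg_ext <;> simp [coneMap, hs₁, hs₂]⟩
  · intro Z t ht
    obtain ⟨s₁, hs₁⟩ := h₁.exists_lift_map (t ≫ coneFstZero b) (by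
      simpa [coneMap] using congrArg (· ≫ coneFstZero c) ht)
    obtain ⟨s₂, hs₂⟩ := h₂.lift_zero (t ≫ coneSndZero b) (by
      simpa [coneMap] using congrArg (· ≫ coneSndZero c) ht)
    exact ⟨coneLiftZero s₁ s₂, by apply coneZero_ext <;> simp [coneMap, hs₁, hs₂]⟩

end
end

/-! ### Membership criteria for cones -/

set_option linter.unusedSectionVars false

section
open Factorization
variable {A : Type u} [Category.{v} A] [Abelian A] {W : Potential A}

theorem zeroFact_neg_eq {Z : A} (s t : (zeroFact W).neg ⟶ Z) : s = t :=
  (isZero_zero A).eq_of_src _ _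
theorem zeroFact_zero_eq {Z : A} (s t : (zeroFact W).zero ⟶ Z) : s = t :=
  (isZero_zero A).eq_of_src _ _
theorem zeroFact_neg_eq' {Z : A} (s t : Z ⟶ (zeroFact W).neg) : s = t :=
  (isZero_zero A).eq_of_tgt _ _
theorem zeroFact_zero_eq' {Z : A} (s t : Z ⟶ (zeroFact W).zero) : s = t :=
  (isZero_zero A).eq_of_tgt _ _

theorem isShortExact_id_zero (L : Factorization W) :
    IsShortExact (𝟙 L) (0 : L ⟶ zeroFact W) where
  comp := comp_zero
  mono_neg := inferInstanceAs (Mono (𝟙 L.neg))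
  mono_zero := inferInstanceAs (Mono (𝟙 L.zero))
  epi_neg := ⟨fun _ _ _ => zeroFact_neg_eq _ _⟩
  epi_zero := ⟨fun _ _ _ => zeroFact_zero_eq _ _⟩
  lift_neg t _ := ⟨t, Category.comp_id t⟩
  lift_zero t _ := ⟨t, Category.comp_id t⟩

theorem isShortExact_zero_id (L : Factorization W) :
    IsShortExact (0 : zeroFact W ⟶ L) (𝟙 L) where
  comp := zero_comp
  mono_neg := ⟨fun _ _ _ => zeroFact_neg_eq' _ _⟩
  mono_zero := ⟨fun _ _ _ => zeroFact_zero_eq' _ _⟩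
  epi_neg := inferInstanceAs (Epi (𝟙 L.neg))
  epi_zero := inferInstanceAs (Epi (𝟙 L.zero))
  lift_neg t h := ⟨0, by rw [zero_comp, ← show t ≫ 𝟙 _ = t from Category.comp_id t]; exact h.symm⟩
  lift_zero t h := ⟨0, by rw [zero_comp, ← show t ≫ 𝟙 _ = t from Category.comp_id t]; exact h.symm⟩

variable [HasProducts.{v} A] {N : ObjectProperty (KFact W)}

theorem IsThick.mem_zeroFact (hN : IsThick N) : N ((toK W).obj (zeroFact W)) :=
  hN.zero _ (isZero_toK_of_contraction 0 0 (zeroFact_neg_eq _ _)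
    ((Functor.map_isZero _ (isZero_zero A)).eq_of_src _ _))

/-- A strict substitute for the octahedral axiom: the cones of `f ≫ j`, of `j` and of G ⟶ 0 form a
short exact sequence. -/
theorem IsShortExact.mem_cone_comp {E F G L : Factorization W} {f : E ⟶ F} {g : F ⟶ G}
    (h : IsShortExact f g) (hN : IsThick N) (hT : ContainsTot N) (j : F ⟶ L)
    (hG : N ((toK W).obj G)) (hj : N ((toK W).obj (Factorization.cone j))) :
    N ((toK W).obj (Factorization.cone (f ≫ j))) :=
  (h.cone (isShortExact_id_zero L) (a := f ≫ j) (b := j) (c := (0 : G ⟶ zeroFact W))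
    (Category.comp_id _) (by rw [Limits.comp_zero, Limits.comp_zero])).mem_left hN hT hj
      (hN.cone _ hG hN.mem_zeroFact)

/-- The cone of `g` is an extension of the contractible cone of the identity of `G` by the cone of E
⟶ 0. -/
theorem IsShortExact.mem_cone {E F G : Factorization W} {f : E ⟶ F} {g : F ⟶ G}
    (h : IsShortExact f g) (hN : IsThick N) (hT : ContainsTot N) (hE : N ((toK W).obj E)) :
    N ((toK W).obj (Factorization.cone g)) :=
  (h.cone (isShortExact_zero_id G) (a := (0 : E ⟶ zeroFact W)) (b := g) (c := 𝟙 G)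
    (by rw [Limits.comp_zero, h.comp]) rfl).mem_middle hN hT (hN.cone _ hE hN.mem_zeroFact)
      (hN.zero _ (isZero_toK_cone_id G))

theorem isIso_of_cone_mem {E F : Factorization W} (g : E ⟶ F)
    (h : N ((toK W).obj (cone g))) : IsQuasiIsoMod N g :=
  MorphismProperty.Q_inverts (coneIn N) ((toK W).map g) ⟨g, rfl, h⟩

end

/-! ### Products of factorizations -/

section
open Factorization
variable {A : Type u} [Category.{v} A] [Abelian A] {W : Potential A} [HasProducts.{v} A]
variable {J : Type v} (T : J → Factorization W)

/-- The product of a family of factorizations. -/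
def prodFact : Factorization W where
  neg := ∏ᶜ fun j => (T j).neg
  zero := ∏ᶜ fun j => (T j).zero
  φneg := Pi.lift fun j => W.Φ.inverse.map (Pi.π _ j) ≫ (T j).φneg
  φzero := Pi.lift fun j => Pi.π _ j ≫ (T j).φzero
  φneg_φzero := by
    change _ = wInv W.Φ W.w _
    apply Pi.hom_ext
    intro j
    have h : (T j).φneg ≫ (T j).φzero = wInv W.Φ W.w _ := (T j).φneg_φzero
    simp [h, wInv_naturality]
  φzero_φneg := by
    rw [Factorization.φzero_φneg_iff]
    apply Pi.hom_ext
    intro j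
    have h := (Factorization.φzero_φneg_iff _ _).1 (T j).φzero_φneg
    simp [h, wInv_naturality, ← Functor.map_comp_assoc]

/-- The projections of a product of factorizations. -/
def prodFactπ (j : J) : prodFact T ⟶ T j where
  neg := Pi.π (fun j => (T j).neg) j
  zero := Pi.π (fun j => (T j).zero) j
  comm_neg := Pi.lift_π _ _
  comm_zero := Pi.lift_π _ _

variable {T}

theorem prodFactNeg_ext {Z : A} {s t : Z ⟶ (prodFact T).neg}
    (h : ∀ j, s ≫ (prodFactπ T j).neg = t ≫ (prodFactπ T j).neg) : s = t := Pi.hom_ext _ _ h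
theorem prodFactZero_ext {Z : A} {s t : Z ⟶ (prodFact T).zero}
    (h : ∀ j, s ≫ (prodFactπ T j).zero = t ≫ (prodFactπ T j).zero) : s = t := Pi.hom_ext _ _ h

/-- The morphism into the component `-1` of a product with given components. -/
def prodFactLiftNeg {Z : A} (s : ∀ j, Z ⟶ (T j).neg) : Z ⟶ (prodFact T).neg := Pi.lift s
/-- The morphism into the component `0` of a product with given components. -/
def prodFactLiftZero {Z : A} (s : ∀ j, Z ⟶ (T j).zero) : Z ⟶ (prodFact T).zero := Pi.lift s

@[simp] theorem prodFactLiftNeg_π {Z : A} (s : ∀ j, Z ⟶ (T j).neg) (j : J) :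
    prodFactLiftNeg s ≫ (prodFactπ T j).neg = s j := Pi.lift_π _ _
@[simp] theorem prodFactLiftZero_π {Z : A} (s : ∀ j, Z ⟶ (T j).zero) (j : J) :
    prodFactLiftZero s ≫ (prodFactπ T j).zero = s j := Pi.lift_π _ _

/-- The morphism into a product with given components. -/
def prodFactLift {Z : Factorization W} (s : ∀ j, Z ⟶ T j) : Z ⟶ prodFact T where
  neg := prodFactLiftNeg fun j => (s j).neg
  zero := prodFactLiftZero fun j => (s j).zero
  comm_neg := prodFactNeg_ext fun j => by
    rw [Category.assoc, prodFactLiftNeg_π, Category.assoc, (prodFactπ T j).comm_neg,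
      ← Functor.map_comp_assoc, prodFactLiftZero_π, (s j).comm_neg]
  comm_zero := prodFactZero_ext fun j => by
    rw [Category.assoc, prodFactLiftZero_π, Category.assoc, (prodFactπ T j).comm_zero,
      ← Category.assoc, prodFactLiftNeg_π, (s j).comm_zero]

theorem prodFactLift_π {Z : Factorization W} (s : ∀ j, Z ⟶ T j) (j : J) :
    prodFactLift s ≫ prodFactπ T j = s j :=
  Factorization.hom_ext (prodFactLiftNeg_π _ j) (prodFactLiftZero_π _ j)

/-- The equivalence Φ⁻¹ preserves products. Homotopies have components with values in Φ⁻¹ of a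
product, so uniqueness and existence of lifts are needed there too. -/
theorem inverse_prodFactZero_ext {Z : A} {s t : Z ⟶ W.Φ.inverse.obj (prodFact T).zero}
    (h : ∀ j, s ≫ W.Φ.inverse.map (prodFactπ T j).zero =
      t ≫ W.Φ.inverse.map (prodFactπ T j).zero) : s = t := by
  apply W.Φ.functor.map_injective
  rw [← cancel_mono (W.Φ.counitIso.hom.app _)]
  apply prodFactZero_ext
  intro j
  have := W.Φ.counitIso.hom.naturality (prodFactπ T j).zero
  simp only [Functor.id_obj, Functor.comp_obj, Functor.id_map, Functor.comp_map] at this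
  rw [Category.assoc, Category.assoc, ← this, ← Functor.map_comp_assoc, h, Functor.map_comp_assoc]

theorem exists_inverse_prodFactZero_lift {Z : A} (s : ∀ j, Z ⟶ W.Φ.inverse.obj (T j).zero) :
    ∃ a : Z ⟶ W.Φ.inverse.obj (prodFact T).zero,
      ∀ j, a ≫ W.Φ.inverse.map (prodFactπ T j).zero = s j := by
  refine ⟨W.Φ.unitIso.hom.app _ ≫ W.Φ.inverse.map (prodFactLiftZero fun j =>
    W.Φ.functor.map (s j) ≫ W.Φ.counitIso.hom.app _), fun j => ?_⟩
  rw [Category.assoc, ← Functor.map_comp, prodFactLiftZero_π]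
  have := W.Φ.unitIso.hom.naturality (s j)
  simp only [Functor.id_obj, Functor.comp_obj, Functor.id_map, Functor.comp_map] at this
  rw [Functor.map_comp, ← reassoc_of% this]
  exact (congrArg _ (W.Φ.unit_inverse_comp _)).trans (Category.comp_id _)

theorem homotopic_iff_components {E F : Factorization W} (f g : E ⟶ F) :
    Homotopic W f g ↔ ∃ (hneg : E.neg ⟶ W.Φ.inverse.obj F.zero) (hzero : E.zero ⟶ F.neg),
      f.neg - g.neg = E.φzero ≫ hzero + hneg ≫ F.φneg ∧
      W.Φ.inverse.map (f.zero - g.zero) = E.φneg ≫ hneg +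
        W.Φ.inverse.map hzero ≫ W.Φ.inverse.map F.φzero := by
  rw [homotopic_iff]
  exact ⟨fun ⟨s, h⟩ => ⟨s.1, s.2, congrArg Prod.snd h, congrArg Prod.fst h⟩,
    fun ⟨a, b, h₁, h₂⟩ => ⟨(a, b), Prod.ext h₂ h₁⟩⟩

/-- One homotopy is chosen for every factor; together they define a homotopy into the product,
because its structure morphisms act factorwise. This is the uniqueness half of the product property
in the homotopy category. -/
theorem homotopic_of_components {Z : Factorization W} (f g : Z ⟶ prodFact T)
    (h : ∀ j, Homotopic W (f ≫ prodFactπ T j) (g ≫ prodFactπ T j)) : Homotopic W f g := by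
  choose s t h₁ h₂ using fun j => (homotopic_iff_components _ _).1 (h j)
  obtain ⟨a, ha⟩ := exists_inverse_prodFactZero_lift s
  have hb : ∀ j, prodFactLiftNeg t ≫ (prodFactπ T j).neg = t j := by simp
  refine (homotopic_iff_components _ _).2 ⟨a, prodFactLiftNeg t, ?_, ?_⟩
  · apply prodFactNeg_ext
    intro j
    have e := h₁ j
    simp only [comp_neg_eq] at e
    rw [Preadditive.sub_comp, e, Preadditive.add_comp, Category.assoc, hb, Category.assoc,
      (prodFactπ T j).comm_neg, reassoc_of% ha]
  · apply inverse_prodFactZero_ext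
    intro j
    have e := h₂ j
    simp only [comp_zero_eq, ← Preadditive.sub_comp, Functor.map_comp] at e
    rw [e, Preadditive.add_comp, Category.assoc, ha, Category.assoc, ← Functor.map_comp,
      ← Functor.map_comp, (prodFactπ T j).comm_zero, ← Functor.map_comp, reassoc_of% hb]

/-- A product of factorizations is a product in the homotopy category. -/
def prodFactIsLimit : IsLimit (Fan.mk ((toK W).obj (prodFact T))
    fun j => (toK W).map (prodFactπ T j)) :=
  Fan.IsLimit.mk _ (fun s => (toK W).map (X := s.pt.as) (prodFactLift fun j =>
      ((toK W).map_surjective (X := s.pt.as) (Y := T j) (s.proj j)).choose))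
    (fun s j => by
      have h := ((toK W).map_surjective (X := s.pt.as) (Y := T j) (s.proj j)).choose_spec
      rw [← h]
      refine ((toK W).map_comp _ _).symm.trans ?_
      rw [prodFactLift_π])
    (fun s m hm => by
      obtain ⟨m, rfl⟩ := (toK W).map_surjective (X := s.pt.as) (Y := prodFact T) m
      apply CategoryTheory.Quotient.sound
      apply homotopic_of_components
      intro j
      rw [prodFactLift_π]
      -- Equal projections in the quotient are genuinely homotopic, as the relation is a congruence.
      refine (CategoryTheory.Quotient.functor_map_eq_iff (Homotopic W) _ _).1 ?_
      refine ((toK W).map_comp _ _).trans ((hm j).trans ?_)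
      exact ((toK W).map_surjective (X := s.pt.as) (Y := T j) (s.proj j)).choose_spec.symm)

theorem prodFact_mem {N : ObjectProperty (KFact W)}
    (hP : N.IsClosedUnderLimitsOfShape (Discrete J)) (h : ∀ j, N ((toK W).obj (T j))) :
    N ((toK W).obj (prodFact T)) :=
  N.prop_of_isLimit prodFactIsLimit (fun j => h j.as)

end

/-! ### Complete towers -/

set_option linter.unusedSectionVars false

section
variable {A : Type u} [Category.{v} A] [Preadditive A]

/-- A tower `⋯ ⟶ X 1 ⟶ X 0` that is separated and in which series converge. -/
structure IsCompleteTower (X : ℕ → A) (i : ∀ n, X (n + 1) ⟶ X n) : Prop where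
  eq_zero : ∀ {Z : A} (u : ∀ n, Z ⟶ X n), (∀ n, u (n + 1) ≫ i n = u n) → ∀ n, u n = 0
  exists_sum : ∀ {Z : A} (a : ∀ n, Z ⟶ X n), ∃ τ : ∀ n, Z ⟶ X n, ∀ n, τ n - τ (n + 1) ≫ i n = a n

end

section
open Factorization
variable {A : Type u} [Category.{v} A] [Abelian A] {W : Potential A}

/-- Both conditions quantify over all test objects, so they can be transposed along the equivalence
Φ. -/
theorem IsCompleteTower.map {X : ℕ → A} {i : ∀ n, X (n + 1) ⟶ X n} (h : IsCompleteTower X i) :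
    IsCompleteTower (fun n => W.Φ.functor.obj (X n)) fun n => W.Φ.functor.map (i n) := by
  have hi : ∀ n {Y : A} (g : X n ⟶ Y), W.Φ.inverse.map (W.Φ.functor.map (i n)) ≫
      W.Φ.unitIso.inv.app (X n) ≫ g = W.Φ.unitIso.inv.app (X (n + 1)) ≫ i n ≫ g :=
    fun n _ g => unitInv_naturality _ _
  constructor
  · intro Z u hu n
    have h0 := h.eq_zero (fun n => W.Φ.inverse.map (u n) ≫ W.Φ.unitIso.inv.app (X n)) (fun n => by
      rw [← hu n, Functor.map_comp, Category.assoc, Category.assoc]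
      simp) n
    apply W.Φ.inverse.map_injective
    rw [← cancel_mono (W.Φ.unitIso.inv.app (X n)), h0, Functor.map_zero, zero_comp]
  · intro Z a
    obtain ⟨τ, hτ⟩ := h.exists_sum fun n => W.Φ.inverse.map (a n) ≫ W.Φ.unitIso.inv.app (X n)
    refine ⟨fun n => W.Φ.counitIso.inv.app Z ≫ W.Φ.functor.map (τ n), fun n => ?_⟩
    rw [Category.assoc, ← Functor.map_comp, ← Preadditive.comp_sub, ← Functor.map_sub, hτ,
      Functor.map_comp, counitInv_naturality]
    simp

variable [HasProducts.{v} A] {F : ℕ → Factorization W} (i : ∀ n, F (n + 1) ⟶ F n)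
  {L : Factorization W} (j : ∀ n, F n ⟶ L) (hj : ∀ n, i n ≫ j n = j (n + 1))

/-- This supplies the morphism "identity minus shift" of the Milnor sequence; beyond zero morphisms
no additive structure on factorizations has been set up. -/
theorem Factorization.exists_sub {E G : Factorization W} (f g : E ⟶ G) :
    ∃ k : E ⟶ G, k.neg = f.neg - g.neg ∧ k.zero = f.zero - g.zero :=
  ⟨{ neg := f.neg - g.neg
     zero := f.zero - g.zero
     comm_neg := by
      rw [Preadditive.comp_sub, f.comm_neg, g.comm_neg, Functor.map_sub, Preadditive.sub_comp]
     comm_zero := by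
      rw [Preadditive.comp_sub, f.comm_zero, g.comm_zero, Preadditive.sub_comp] }, rfl, rfl⟩

/-- The transition morphisms between the cones of the morphisms from a tower. -/
def coneTransition (n : ℕ) : cone (j (n + 1)) ⟶ cone (j n) :=
  coneMap (i n) (𝟙 L) ((Category.comp_id _).trans (hj n).symm)

@[simp] theorem coneTransition_neg (n : ℕ) : (coneTransition i j hj n).neg =
    coneLiftNeg (coneFstNeg _ ≫ (i n).zero) (coneSndNeg _) :=
  congrArg (coneLiftNeg _) (Category.comp_id _)
@[simp] theorem coneTransition_zero (n : ℕ) : (coneTransition i j hj n).zero =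
    coneLiftZero (coneFstZero _ ≫ W.Φ.functor.map (i n).neg) (coneSndZero _) :=
  congrArg (coneLiftZero _) (Category.comp_id _)

/-- On a constant tower, such as the one formed by the summands of the common target in the cones,
finite partial sums solve the equation, without any convergence. -/
theorem exists_telescope {Z Y : A} (b : ℕ → (Z ⟶ Y)) :
    ∃ y : ℕ → (Z ⟶ Y), ∀ n, y n - y (n + 1) = b n :=
  ⟨fun n => -∑ m ∈ Finset.range n, b m, fun n => by
    simp only [Finset.sum_range_succ]
    abel⟩

theorem eq_zeroth_of_telescope {Z Y : A} {y : ℕ → (Z ⟶ Y)} (h : ∀ n, y (n + 1) = y n) (n : ℕ) :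
    y n = y 0 := by
  induction n with
  | zero => rfl
  | succ n ih => rw [h, ih]

/-- The cones of the morphisms from a tower, indexed in the universe of `A`. -/
abbrev coneTower (n : ULift.{v} ℕ) : Factorization W := cone (j n.down)

-- The Milnor sequence of the cones C(jₙ). On the summands from the tower, identity minus shift is
-- bijective on generalized elements by completeness; on the constant tower of summands L it is
-- surjective with kernel the constant sequences, that is, L.
include hj in
theorem exists_isShortExact_prodFact (hneg : IsCompleteTower (fun n => (F n).neg) fun n => (i n).neg)
    (hzero : IsCompleteTower (fun n => (F n).zero) fun n => (i n).zero) :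
    ∃ (f : L ⟶ prodFact (coneTower j))
      (g : prodFact (coneTower j) ⟶
        prodFact (coneTower j)), IsShortExact f g := by
  -- `g` is the identity of the product minus the shift by one step followed by the transition
  -- morphisms.
  obtain ⟨g, hg₁, hg₂⟩ := Factorization.exists_sub
    (𝟙 (prodFact (coneTower j)))
    (prodFactLift (T := coneTower j) fun n => prodFactπ (coneTower j) (ULift.up (n.down + 1)) ≫ coneTransition i j hj n.down)
  let f : L ⟶ prodFact (coneTower j) :=
    prodFactLift (T := coneTower j) fun n => coneInr (j n.down)
  have hgn : ∀ n : ULift.{v} ℕ, g.neg ≫ (prodFactπ (coneTower j) n).neg = (prodFactπ (coneTower j) n).neg -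
      (prodFactπ (coneTower j) (ULift.up (n.down + 1))).neg ≫
        coneLiftNeg (coneFstNeg (j (n.down + 1)) ≫ (i n.down).zero) (coneSndNeg (j (n.down + 1))) := by
    intro n
    rw [hg₁, Preadditive.sub_comp]
    congr 1
    · exact Category.id_comp _
    · rw [← coneTransition_neg i j hj]
      exact congrArg Hom.neg (prodFactLift_π _ n)
  have hgz : ∀ n : ULift.{v} ℕ, g.zero ≫ (prodFactπ (coneTower j) n).zero = (prodFactπ (coneTower j) n).zero -
      (prodFactπ (coneTower j) (ULift.up (n.down + 1))).zero ≫
        coneLiftZero (coneFstZero (j (n.down + 1)) ≫ W.Φ.functor.map (i n.down).neg)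
          (coneSndZero (j (n.down + 1))) := by
    intro n
    rw [hg₂, Preadditive.sub_comp]
    congr 1
    · exact Category.id_comp _
    · rw [← coneTransition_zero i j hj]
      exact congrArg Hom.zero (prodFactLift_π _ n)
  have hfn : ∀ n : ULift.{v} ℕ, f.neg ≫ (prodFactπ (coneTower j) n).neg = coneLiftNeg 0 (𝟙 _) := fun n =>
    congrArg Hom.neg (prodFactLift_π (T := coneTower j) (fun n => coneInr (j n.down)) n)
  have hfz : ∀ n : ULift.{v} ℕ, f.zero ≫ (prodFactπ (coneTower j) n).zero = coneLiftZero 0 (𝟙 _) := fun n =>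
    congrArg Hom.zero (prodFactLift_π (T := coneTower j) (fun n => coneInr (j n.down)) n)
  refine ⟨f, g, ?_, ?_, ?_, ?_, ?_, ?_, ?_⟩
  · apply Factorization.hom_ext
    · apply prodFactNeg_ext
      intro n
      rw [comp_neg_eq, Category.assoc, hgn, Preadditive.comp_sub, hfn, reassoc_of% hfn]
      apply coneNeg_ext <;> simp
    · apply prodFactZero_ext
      intro n
      rw [comp_zero_eq, Category.assoc, hgz, Preadditive.comp_sub, hfz, reassoc_of% hfz]
      apply coneZero_ext <;> simp
  · refine ⟨fun s t e => ?_⟩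
    simpa [reassoc_of% hfn ⟨0⟩] using congrArg (· ≫ (prodFactπ (coneTower j) ⟨0⟩).neg ≫ coneSndNeg _) e
  · refine ⟨fun s t e => ?_⟩
    simpa [reassoc_of% hfz ⟨0⟩] using congrArg (· ≫ (prodFactπ (coneTower j) ⟨0⟩).zero ≫ coneSndZero _) e
  -- Applied to the universal element, the solutions `τ` and `y` form a section of `g`. The
  -- degree-zero tower enters because C(jₙ)⁻¹ contains the degree-zero part of the n-th step.
  · obtain ⟨τ, hτ⟩ := hzero.exists_sum fun n => (prodFactπ (coneTower j) ⟨n⟩).neg ≫ coneFstNeg _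
    obtain ⟨y, hy⟩ := exists_telescope fun n => (prodFactπ (coneTower j) ⟨n⟩).neg ≫ coneSndNeg _
    have : prodFactLiftNeg (T := coneTower j) (fun n : ULift.{v} ℕ => coneLiftNeg (τ n.down) (y n.down)) ≫ g.neg =
        𝟙 _ := by
      apply prodFactNeg_ext
      intro n
      rw [Category.assoc, hgn, Preadditive.comp_sub, prodFactLiftNeg_π, ← Category.assoc,
        prodFactLiftNeg_π]
      apply coneNeg_ext
      · simp [hτ]
      · simp [hy]
    have : IsSplitEpi g.neg := ⟨⟨⟨_, this⟩⟩⟩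
    infer_instance
  · obtain ⟨τ, hτ⟩ := hneg.map.exists_sum fun n => (prodFactπ (coneTower j) ⟨n⟩).zero ≫ coneFstZero _
    obtain ⟨y, hy⟩ := exists_telescope fun n => (prodFactπ (coneTower j) ⟨n⟩).zero ≫ coneSndZero _
    have : prodFactLiftZero (T := coneTower j) (fun n : ULift.{v} ℕ => coneLiftZero (τ n.down) (y n.down)) ≫ g.zero =
        𝟙 _ := by
      apply prodFactZero_ext
      intro n
      rw [Category.assoc, hgz, Preadditive.comp_sub, prodFactLiftZero_π, ← Category.assoc,
        prodFactLiftZero_π]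
      apply coneZero_ext
      · simp [hτ]
      · simp [hy]
    have : IsSplitEpi g.zero := ⟨⟨⟨_, this⟩⟩⟩
    infer_instance
  · intro Z t ht
    have e : ∀ n : ULift.{v} ℕ, t ≫ (prodFactπ (coneTower j) n).neg =
        t ≫ (prodFactπ (coneTower j) (ULift.up (n.down + 1))).neg ≫
          coneLiftNeg (coneFstNeg (j (n.down + 1)) ≫ (i n.down).zero) (coneSndNeg (j (n.down + 1))) := fun n => by
      rw [← sub_eq_zero, ← Preadditive.comp_sub, ← hgn, reassoc_of% ht, zero_comp]
    -- An element of the kernel is compatible with the transitions: its coordinates in the tower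
    -- vanish by separatedness, those in L are constant.
    have h₁ := hzero.eq_zero (fun n => t ≫ (prodFactπ (coneTower j) ⟨n⟩).neg ≫ coneFstNeg _) fun n => by
        simpa using (congrArg (· ≫ coneFstNeg _) (e ⟨n⟩)).symm
    have h₂ := eq_zeroth_of_telescope (y := fun n => t ≫ (prodFactπ (coneTower j) ⟨n⟩).neg ≫ coneSndNeg _) fun n => by
        simpa using (congrArg (· ≫ coneSndNeg _) (e ⟨n⟩)).symm
    refine ⟨t ≫ (prodFactπ (coneTower j) ⟨0⟩).neg ≫ coneSndNeg (j 0), prodFactNeg_ext fun n => ?_⟩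
    rw [Category.assoc, hfn]
    apply coneNeg_ext
    · simpa using (h₁ n.down).symm
    · simpa using (h₂ n.down).symm
  · intro Z t ht
    have e : ∀ n : ULift.{v} ℕ, t ≫ (prodFactπ (coneTower j) n).zero =
        t ≫ (prodFactπ (coneTower j) (ULift.up (n.down + 1))).zero ≫
          coneLiftZero (coneFstZero (j (n.down + 1)) ≫ W.Φ.functor.map (i n.down).neg)
          (coneSndZero (j (n.down + 1))) := fun n => by
      rw [← sub_eq_zero, ← Preadditive.comp_sub, ← hgz, reassoc_of% ht, zero_comp]
    have h₁ := hneg.map.eq_zero (fun n => t ≫ (prodFactπ (coneTower j) ⟨n⟩).zero ≫ coneFstZero _) fun n => by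
        simpa using (congrArg (· ≫ coneFstZero _) (e ⟨n⟩)).symm
    have h₂ := eq_zeroth_of_telescope (y := fun n => t ≫ (prodFactπ (coneTower j) ⟨n⟩).zero ≫ coneSndZero _) fun n => by
        simpa using (congrArg (· ≫ coneSndZero _) (e ⟨n⟩)).symm
    refine ⟨t ≫ (prodFactπ (coneTower j) ⟨0⟩).zero ≫ coneSndZero (j 0), prodFactZero_ext fun n => ?_⟩
    rw [Category.assoc, hfz]
    apply coneZero_ext
    · simpa using (h₁ n.down).symm
    · simpa using (h₂ n.down).symm

include hj in
/-- The colimit end of a complete tower whose cones lie in a thick subcategory that is closed under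
products lies in it. -/
theorem mem_of_isCompleteTower {N : ObjectProperty (KFact W)} (hN : IsThick N)
    (hT : ContainsTot N) (hP : ∀ J : Type v, N.IsClosedUnderLimitsOfShape (Discrete J))
    (hneg : IsCompleteTower (fun n => (F n).neg) fun n => (i n).neg) (hzero : IsCompleteTower (fun n => (F n).zero) fun n => (i n).zero)
    (hmem : ∀ n, N ((toK W).obj (cone (j n)))) : N ((toK W).obj L) := by
  obtain ⟨f, g, h⟩ := exists_isShortExact_prodFact i j hj hneg hzero
  have := prodFact_mem (hP _) fun n : ULift.{v} ℕ => hmem n.down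
  -- Middle and right-hand term of the Milnor sequence are the same product of the given cones.
  exact h.mem_left hN hT this this

end

/-! ### Kernels of morphisms of factorizations -/

set_option linter.unusedSectionVars false

section
open Factorization
variable {A : Type u} [Category.{v} A] [Abelian A] {W : Potential A}
variable {M G : Factorization W} (g : M ⟶ G)

/-- The kernel of a morphism of factorizations. -/
def kerFact : Factorization W where
  neg := kernel g.neg
  zero := kernel g.zero
  φneg := kernel.lift _ (W.Φ.inverse.map (kernel.ι g.zero) ≫ M.φneg) (by
    rw [Category.assoc, g.comm_neg, ← Functor.map_comp_assoc, kernel.condition, Functor.map_zero,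
      zero_comp])
  φzero := kernel.lift _ (kernel.ι g.neg ≫ M.φzero) (by
    rw [Category.assoc, g.comm_zero, kernel.condition_assoc, zero_comp])
  φneg_φzero := by
    change _ = wInv W.Φ W.w _
    have h : M.φneg ≫ M.φzero = wInv W.Φ W.w _ := M.φneg_φzero
    rw [← cancel_mono (kernel.ι g.zero), wInv_naturality]
    simp [h]
  φzero_φneg := by
    have h := (Factorization.φzero_φneg_iff _ _).1 M.φzero_φneg
    rw [Factorization.φzero_φneg_iff, ← cancel_mono (kernel.ι g.neg), wInv_naturality,
      Category.assoc, kernel.lift_ι, ← Functor.map_comp_assoc, kernel.lift_ι, Functor.map_comp,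
      Category.assoc, h]

/-- The inclusion of the kernel of a morphism of factorizations. -/
def kerFactι : kerFact g ⟶ M where
  neg := kernel.ι g.neg
  zero := kernel.ι g.zero
  comm_neg := kernel.lift_ι _ _ _
  comm_zero := kernel.lift_ι _ _ _

instance : Mono (kerFactι g).neg := inferInstanceAs (Mono (kernel.ι g.neg))
instance : Mono (kerFactι g).zero := inferInstanceAs (Mono (kernel.ι g.zero))

theorem kerFactι_comp : kerFactι g ≫ g = 0 :=
  Factorization.hom_ext (kernel.condition _) (kernel.condition _)

theorem exists_kerFact_lift {T : A × A} (t : T ⟶ M.pair) (h : t ≫ Hom.pair g = 0) :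
    ∃ s : T ⟶ (kerFact g).pair, s ≫ Hom.pair (kerFactι g) = t :=
  ⟨(kernel.lift g.neg t.1 (congrArg Prod.fst h), kernel.lift g.zero t.2 (congrArg Prod.snd h)),
    Prod.ext (kernel.lift_ι _ _ _) (kernel.lift_ι _ _ _)⟩

/-- The cofree lift records κ together with κ after the structure morphisms, the latter transposed.
Its kernel is therefore the largest subfactorization on which κ vanishes. -/
theorem pair_comp_cofreeLift_eq_zero_iff {T Z : A × A} (t : T ⟶ M.pair) (κ : M.pair ⟶ Z) :
    t ≫ Hom.pair (cofreeLift κ) = 0 ↔ t ≫ κ = 0 ∧ (unshift W).map t ≫ M.diff ≫ κ = 0 := by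
  have e : ∀ {X : A} (a : X ⟶ M.zero), a ≫ W.Φ.counitIso.inv.app M.zero ≫
      W.Φ.functor.map (M.φneg ≫ κ.1) = 0 ↔ W.Φ.inverse.map a ≫ M.φneg ≫ κ.1 = 0 := by
    intro X a
    rw [← counitInv_naturality, ← Functor.map_comp,
      Preadditive.IsIso.comp_left_eq_zero (W.Φ.counitIso.inv.app X), Functor.map_eq_zero_iff]
  constructor
  · intro h
    have h₁ : t.1 ≫ (cofreeLift κ).neg = 0 := congrArg Prod.fst h
    have h₂ : t.2 ≫ (cofreeLift κ).zero = 0 := congrArg Prod.snd h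
    refine ⟨Prod.ext ?_ ?_, Prod.ext ?_ ?_⟩
    · simpa using congrArg (· ≫ cofreeNegFst Z) h₁
    · simpa using congrArg (· ≫ cofreeZeroFst Z) h₂
    · exact (e t.2).1 (by simpa using congrArg (· ≫ cofreeZeroSnd Z) h₂)
    · change t.1 ≫ M.φzero ≫ κ.2 = 0
      simpa using congrArg (· ≫ cofreeNegSnd Z) h₁
  · rintro ⟨h₁, h₂⟩
    have h₁₁ : t.1 ≫ κ.1 = 0 := congrArg Prod.fst h₁
    have h₁₂ : t.2 ≫ κ.2 = 0 := congrArg Prod.snd h₁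
    have h₂₁ : W.Φ.inverse.map t.2 ≫ M.φneg ≫ κ.1 = 0 := congrArg Prod.fst h₂
    have h₂₂ : t.1 ≫ M.φzero ≫ κ.2 = 0 := congrArg Prod.snd h₂
    have k₁ : t.1 ≫ (cofreeLift κ).neg = 0 := by
      apply cofreeNeg_ext <;> simp [h₁₁, h₂₂]
    have k₂ : t.2 ≫ (cofreeLift κ).zero = 0 := by
      apply cofreeZero_ext
      · simp [h₁₂]
      · rw [Category.assoc, cofreeLift_zero_snd, zero_comp]
        exact (e t.2).2 h₂₁
    exact Prod.ext k₁ k₂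

/-- On the images of `y` and `r` the lift is triangular: elements from `y` reach the second summand
of the cofree factorization epimorphically and have no first coordinate, elements from `r` have the
identity as first coordinate. -/
theorem epi_cofreeLift {Z Y : A × A} (κ : M.pair ⟶ Z) (r : Z ⟶ M.pair) (hr : r ≫ κ = 𝟙 Z)
    (y : Y ⟶ M.pair) (hy : y ≫ κ = 0) (h₁ : Epi ((unshift W).map y ≫ M.diff ≫ κ).1)
    (h₂ : Epi ((unshift W).map y ≫ M.diff ≫ κ).2) :
    Epi (cofreeLift κ).neg ∧ Epi (cofreeLift κ).zero := by
  have h₁ : Epi (W.Φ.inverse.map y.2 ≫ M.φneg ≫ κ.1) := h₁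
  have h₂ : Epi (y.1 ≫ M.φzero ≫ κ.2) := h₂
  have hr₁ : r.1 ≫ κ.1 = 𝟙 Z.1 := congrArg Prod.fst hr
  have hr₂ : r.2 ≫ κ.2 = 𝟙 Z.2 := congrArg Prod.snd hr
  have hy₁ : y.1 ≫ κ.1 = 0 := congrArg Prod.fst hy
  have hy₂ : y.2 ≫ κ.2 = 0 := congrArg Prod.snd hy
  constructor
  · refine Preadditive.epi_of_cancel_zero _ fun {T} s hs => ?_
    have hr' : r.1 ≫ (cofreeLift κ).neg = cofreeLiftNeg (𝟙 _) 0 +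
        (r.1 ≫ M.φzero ≫ κ.2) ≫ cofreeLiftNeg 0 (𝟙 _) := by
      apply cofreeNeg_ext <;> simp [hr₁]
    have hy' : y.1 ≫ (cofreeLift κ).neg = (y.1 ≫ M.φzero ≫ κ.2) ≫ cofreeLiftNeg 0 (𝟙 _) := by
      apply cofreeNeg_ext <;> simp [hy₁]
    have e₂ : cofreeLiftNeg 0 (𝟙 _) ≫ s = 0 := by
      rw [← cancel_epi (y.1 ≫ M.φzero ≫ κ.2), ← Category.assoc, ← hy', Category.assoc, hs,
        comp_zero, comp_zero]
    have e₁ : cofreeLiftNeg (𝟙 _) 0 ≫ s = 0 := by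
      have := congrArg (· ≫ s) hr'
      simpa [hs, e₂] using this.symm
    have : cofreeNegFst Z ≫ cofreeLiftNeg (𝟙 _) 0 + cofreeNegSnd Z ≫ cofreeLiftNeg 0 (𝟙 _) =
        𝟙 (cofree W Z).neg := by
      apply cofreeNeg_ext <;> simp
    rw [← Category.id_comp s, ← this]
    simp [e₁, e₂]
  · refine Preadditive.epi_of_cancel_zero _ fun {T} s hs => ?_
    have hr' : r.2 ≫ (cofreeLift κ).zero = cofreeLiftZero (𝟙 _) 0 +
        (r.2 ≫ W.Φ.counitIso.inv.app M.zero ≫ W.Φ.functor.map (M.φneg ≫ κ.1)) ≫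
          cofreeLiftZero 0 (𝟙 _) := by
      apply cofreeZero_ext <;> simp [hr₂]
    have hy' : y.2 ≫ (cofreeLift κ).zero =
        (W.Φ.counitIso.inv.app _ ≫ W.Φ.functor.map (W.Φ.inverse.map y.2 ≫ M.φneg ≫ κ.1)) ≫
          cofreeLiftZero 0 (𝟙 _) := by
      rw [Functor.map_comp W.Φ.functor (W.Φ.inverse.map y.2), counitInv_naturality]
      apply cofreeZero_ext <;> simp [hy₂]
    have e₂ : cofreeLiftZero 0 (𝟙 _) ≫ s = 0 := by
      rw [← cancel_epi (W.Φ.counitIso.inv.app _ ≫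
        W.Φ.functor.map (W.Φ.inverse.map y.2 ≫ M.φneg ≫ κ.1)), ← Category.assoc, ← hy',
        Category.assoc, hs, comp_zero, comp_zero]
    have e₁ : cofreeLiftZero (𝟙 _) 0 ≫ s = 0 := by
      have := congrArg (· ≫ s) hr'
      simpa [hs, e₂] using this.symm
    have : cofreeZeroFst Z ≫ cofreeLiftZero (𝟙 _) 0 + cofreeZeroSnd Z ≫ cofreeLiftZero 0 (𝟙 _) =
        𝟙 (cofree W Z).zero := by
      apply cofreeZero_ext <;> simp
    rw [← Category.id_comp s, ← this]
    simp [e₁, e₂]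

/-- The tower of pairs is tested on elements whose other component is zero. -/
theorem IsCompleteTower.fst {X : ℕ → A × A} {i : ∀ n, X (n + 1) ⟶ X n} (h : IsCompleteTower X i) :
    IsCompleteTower (fun n => (X n).1) fun n => (i n).1 where
  eq_zero {Z} u hu n := congrArg Prod.fst (h.eq_zero (Z := (Z, (X 0).2)) (fun n => (u n, 0))
    (fun n => Prod.ext (hu n) zero_comp) n)
  exists_sum {Z} a := by
    obtain ⟨τ, hτ⟩ := h.exists_sum (Z := (Z, (X 0).2)) fun n => (a n, 0)
    exact ⟨fun n => (τ n).1, fun n => congrArg Prod.fst (hτ n)⟩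

theorem IsCompleteTower.snd {X : ℕ → A × A} {i : ∀ n, X (n + 1) ⟶ X n} (h : IsCompleteTower X i) :
    IsCompleteTower (fun n => (X n).2) fun n => (i n).2 where
  eq_zero {Z} u hu n := congrArg Prod.snd (h.eq_zero (Z := ((X 0).1, Z)) (fun n => (0, u n))
    (fun n => Prod.ext zero_comp (hu n)) n)
  exists_sum {Z} a := by
    obtain ⟨τ, hτ⟩ := h.exists_sum (Z := ((X 0).1, Z)) fun n => (0, a n)
    exact ⟨fun n => (τ n).2, fun n => congrArg Prod.snd (hτ n)⟩

end

/-! ### Twisted resolutions -/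

section
open Factorization
variable {A : Type u} [Category.{v} A] [Abelian A] {W : Potential A}

/-- A factorization `P` that is a product of pairs `X 0, X 1, …`, with a morphism `d₀ : P ⟶ E`
through `X 0`, whose differential raises the filtration by at most one, and whose leading terms
`⋯ ⟶ X 1 ⟶ X 0 ⟶ E` form an exact sequence. -/
structure TwistedResolution {P E : Factorization W} (d₀ : P ⟶ E) where
  X : ℕ → A × A
  π : ∀ n, P.pair ⟶ X n
  ι : ∀ n, X n ⟶ P.pair
  D : ∀ m n, (unshift W).obj (X m) ⟶ X n
  aug : X 0 ⟶ E.pair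
  hom_ext : ∀ {T : A × A} (s t : T ⟶ P.pair), (∀ n, s ≫ π n = t ≫ π n) → s = t
  exists_lift : ∀ {T : A × A} (s : ∀ n, T ⟶ X n), ∃ t, ∀ n, t ≫ π n = s n
  ι_π_self : ∀ n, ι n ≫ π n = 𝟙 _
  ι_π_ne : ∀ m n, m ≠ n → ι m ≫ π n = 0
  diff_π : ∀ n, P.diff ≫ π n = ∑ m ∈ Finset.range (n + 2), (unshift W).map (π m) ≫ D m n
  pair_d₀ : Hom.pair d₀ = π 0 ≫ aug
  epi_aug_fst : Epi aug.1
  epi_aug_snd : Epi aug.2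
  exact_zero : ∀ {T : A × A} (t : T ⟶ X 0), t ≫ aug = 0 → ∃ (T' : A × A) (p : T' ⟶ T)
    (s : T' ⟶ (unshift W).obj (X 1)), Epi p.1 ∧ Epi p.2 ∧ s ≫ D 1 0 = p ≫ t
  exact_succ : ∀ (n : ℕ) {T : A × A} (t : T ⟶ X (n + 1)),
    (unshift W).map t ≫ D (n + 1) n = 0 → ∃ (T' : A × A) (p : T' ⟶ T)
    (s : T' ⟶ (unshift W).obj (X (n + 2))), Epi p.1 ∧ Epi p.2 ∧ s ≫ D (n + 2) (n + 1) = p ≫ t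

namespace TwistedResolution
variable {P E : Factorization W} {d₀ : P ⟶ E} (R : TwistedResolution d₀)

/-- The filtration of the kernel of `d₀`, with the inclusions into `P`. -/
def tower : ℕ → Σ F : Factorization W, F ⟶ P
  | 0 => ⟨kerFact d₀, kerFactι d₀⟩
  | n + 1 => ⟨kerFact ((tower n).2 ≫ cofreeLift (R.π n)), kerFactι _ ≫ (tower n).2⟩

/-- The `n`-th step of the filtration of the kernel of `d₀`. -/
abbrev fil (n : ℕ) : Factorization W := (R.tower n).1
/-- The inclusions of the steps of the filtration. -/
abbrev incl (n : ℕ) : R.fil n ⟶ P := (R.tower n).2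
/-- The inclusions between the steps of the filtration. -/
def trans (n : ℕ) : R.fil (n + 1) ⟶ R.fil n := kerFactι (R.incl n ≫ cofreeLift (R.π n))

instance (n : ℕ) : Mono (R.trans n).neg := inferInstanceAs (Mono (kerFactι _).neg)
instance (n : ℕ) : Mono (R.trans n).zero := inferInstanceAs (Mono (kerFactι _).zero)

theorem mono_incl (n : ℕ) : Mono (R.incl n).neg ∧ Mono (R.incl n).zero := by
  induction n with
  | zero =>
    exact ⟨inferInstanceAs (Mono (kerFactι d₀).neg), inferInstanceAs (Mono (kerFactι d₀).zero)⟩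
  | succ n ih =>
    have := ih.1
    have := ih.2
    exact ⟨inferInstanceAs (Mono ((R.trans n).neg ≫ (R.incl n).neg)),
      inferInstanceAs (Mono ((R.trans n).zero ≫ (R.incl n).zero))⟩

instance (n : ℕ) : Mono (R.incl n).neg := (R.mono_incl n).1
instance (n : ℕ) : Mono (R.incl n).zero := (R.mono_incl n).2
instance (n : ℕ) : Mono (Hom.pair (R.incl n)) :=
  have : Mono (Hom.pair (R.incl n)).1 := (R.mono_incl n).1
  have : Mono (Hom.pair (R.incl n)).2 := (R.mono_incl n).2
  pair_mono _

theorem map_comp_diff {M : Factorization W} (f : M ⟶ P) {T : A × A} (s : T ⟶ M.pair) {Y : A × A}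
    (κ : P.pair ⟶ Y) : (unshift W).map s ≫ M.diff ≫ Hom.pair f ≫ κ =
      (unshift W).map (s ≫ Hom.pair f) ≫ P.diff ≫ κ := by
  rw [reassoc_of% Hom.pair_comm f, Functor.map_comp, Category.assoc]

/-- Naturality of the passage from morphisms of pairs to morphisms into a cofree factorization. -/
theorem cofreeLift_precomp {M : Factorization W} (f : M ⟶ P) {Y : A × A} (κ : P.pair ⟶ Y) :
    f ≫ cofreeLift κ = cofreeLift (Hom.pair f ≫ κ) := by
  have h₁ := f.comm_zero
  have h₂ := counitInv_map_comm f (W.Φ.functor.map κ.1)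
  apply Factorization.hom_ext
  · apply cofreeNeg_ext
    · simp
    · simp [reassoc_of% h₁]
  · apply cofreeZero_ext
    · simp
    · simp only [comp_zero_eq, Category.assoc, cofreeLift_zero_snd]
      rw [Functor.map_comp, ← h₂]
      change _ = _ ≫ W.Φ.functor.map (_ ≫ f.neg ≫ κ.1)
      simp only [Functor.map_comp]

/-- Unwinding the iterated kernels describes the recursively defined filtration without recursion.
The facts about the filtration below are verified by this criterion. -/
theorem liftable_iff (n : ℕ) {T : A × A} (t : T ⟶ P.pair) :
    (∃ s : T ⟶ (R.fil n).pair, s ≫ Hom.pair (R.incl n) = t) ↔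
      t ≫ Hom.pair d₀ = 0 ∧ ∀ m < n, t ≫ R.π m = 0 ∧ (unshift W).map t ≫ P.diff ≫ R.π m = 0 := by
  induction n with
  | zero =>
    refine ⟨?_, fun h => exists_kerFact_lift _ t h.1⟩
    rintro ⟨s, rfl⟩
    refine ⟨?_, fun m hm => absurd hm (Nat.not_lt_zero m)⟩
    have : Hom.pair (R.incl 0) ≫ Hom.pair d₀ = 0 := congrArg Hom.pair (kerFactι_comp d₀)
    rw [Category.assoc, this, comp_zero]
  | succ n ih =>
    constructor
    · rintro ⟨s, rfl⟩
      have h : s ≫ Hom.pair (R.incl (n + 1)) =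
          (s ≫ Hom.pair (R.trans n)) ≫ Hom.pair (R.incl n) :=
        (Category.assoc s (Hom.pair (R.trans n)) (Hom.pair (R.incl n))).symm
      have h' := ih.1 ⟨_, h.symm⟩
      refine ⟨h'.1, fun m hm => ?_⟩
      rcases Nat.lt_succ_iff_lt_or_eq.1 hm with hm | rfl
      · exact h'.2 m hm
      · have e : Hom.pair (R.trans m) ≫ Hom.pair (R.incl m) ≫ Hom.pair (cofreeLift (R.π m)) = 0 :=
          congrArg Hom.pair (kerFactι_comp (R.incl m ≫ cofreeLift (R.π m)))
        rw [← pair_comp_cofreeLift_eq_zero_iff, h, Category.assoc, Category.assoc, e, comp_zero]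
    · rintro ⟨h₁, h₂⟩
      obtain ⟨s, rfl⟩ := ih.2 ⟨h₁, fun m hm => h₂ m (hm.trans (Nat.lt_succ_self n))⟩
      obtain ⟨u, hu⟩ := exists_kerFact_lift (R.incl n ≫ cofreeLift (R.π n)) s (by
        rw [pair_comp, ← Category.assoc, pair_comp_cofreeLift_eq_zero_iff]
        exact h₂ n (Nat.lt_succ_self n))
      exact ⟨u, (Category.assoc _ _ _).symm.trans (congrArg (· ≫ Hom.pair (R.incl n)) hu)⟩

/-- Coordinates beyond `n + 1` cannot reach the n-th one, and those up to `n` vanish, so only the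
leading term of the differential is left. -/
theorem map_diff_π_eq {T : A × A} (t : T ⟶ P.pair) (n : ℕ) (h : ∀ m ≤ n, t ≫ R.π m = 0) :
    (unshift W).map t ≫ P.diff ≫ R.π n = (unshift W).map (t ≫ R.π (n + 1)) ≫ R.D (n + 1) n := by
  rw [R.diff_π, Preadditive.comp_sum, Finset.sum_eq_single (n + 1)]
  · rw [Functor.map_comp, Category.assoc]
  · intro m hm hne
    rw [← Category.assoc, ← Functor.map_comp, h m (by simp at hm; lia), Functor.map_zero, zero_comp]
  · intro h
    simp at h

theorem incl_d₀ (n : ℕ) : Hom.pair (R.incl n) ≫ Hom.pair d₀ = 0 :=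
  ((R.liftable_iff n _).1 ⟨𝟙 _, Category.id_comp _⟩).1

theorem incl_π {m n : ℕ} (h : m < n) : Hom.pair (R.incl n) ≫ R.π m = 0 :=
  (((R.liftable_iff n _).1 ⟨𝟙 _, Category.id_comp _⟩).2 m h).1

theorem map_incl_diff_π {m n : ℕ} (h : m < n) :
    (unshift W).map (Hom.pair (R.incl n)) ≫ P.diff ≫ R.π m = 0 :=
  (((R.liftable_iff n _).1 ⟨𝟙 _, Category.id_comp _⟩).2 m h).2

theorem map_incl_π_D {m n : ℕ} (h : m < n) :
    (unshift W).map (Hom.pair (R.incl n) ≫ R.π (m + 1)) ≫ R.D (m + 1) m = 0 := by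
  rw [← R.map_diff_π_eq _ m fun k hk => R.incl_π (hk.trans_lt h), R.map_incl_diff_π h]

/-- The differential of an element concentrated in coordinate `n + 1` has no coordinate below `n`.
These elements later map onto the cycles in `X n`. -/
theorem exists_lift_ι (n : ℕ) : ∃ y : R.X (n + 1) ⟶ (R.fil n).pair,
    y ≫ Hom.pair (R.incl n) = R.ι (n + 1) := by
  refine (R.liftable_iff n _).2 ⟨?_, fun m hm => ⟨R.ι_π_ne _ _ (by lia), ?_⟩⟩
  · rw [R.pair_d₀, ← Category.assoc, R.ι_π_ne _ _ (by lia), zero_comp]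
  · rw [R.map_diff_π_eq _ m fun k hk => R.ι_π_ne _ _ (by lia), R.ι_π_ne _ _ (by lia),
      Functor.map_zero, zero_comp]

/-- For an element supported in coordinates from `n` on, membership in the n-th step only restricts
the coordinate `n`: it must be a cycle, or be killed by the augmentation when `n = 0`. So truncating
to that coordinate stays inside the step. -/
theorem exists_lift_π_ι (n : ℕ) : ∃ y : (R.fil n).pair ⟶ (R.fil n).pair,
    y ≫ Hom.pair (R.incl n) = Hom.pair (R.incl n) ≫ R.π n ≫ R.ι n := by
  refine (R.liftable_iff n _).2 ⟨?_, fun m hm => ⟨?_, ?_⟩⟩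
  · rw [R.pair_d₀]
    rcases Nat.eq_zero_or_pos n with rfl | hn
    · simp only [Category.assoc]
      rw [reassoc_of% R.ι_π_self 0, ← R.pair_d₀, R.incl_d₀]
    · simp only [Category.assoc]
      rw [reassoc_of% R.ι_π_ne n 0 (by lia), zero_comp, comp_zero, comp_zero]
  · simp only [Category.assoc]
    rw [R.ι_π_ne _ _ (by lia), comp_zero, comp_zero]
  · rw [R.map_diff_π_eq _ m fun k hk => by
      simp only [Category.assoc]
      rw [R.ι_π_ne _ _ (by lia), comp_zero, comp_zero]]
    -- Only `m = n - 1` imposes a condition, the cycle condition, which holds for elements of the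
    -- n-th step; smaller `m` see nothing.
    rcases Nat.eq_or_lt_of_le hm with rfl | hm'
    · simp only [Category.assoc]
      rw [R.ι_π_self, Category.comp_id, R.map_incl_π_D hm]
    · simp only [Category.assoc]
      rw [R.ι_π_ne _ _ (by lia), comp_zero, comp_zero, Functor.map_zero, zero_comp]

/-- An element of `X n` that lies in the n-th step is a cycle of the leading complex, so exactness
writes it as a boundary after an epimorphic refinement. -/
theorem exists_refinement (n : ℕ) {T : A × A} (z : T ⟶ R.X n) (r : T ⟶ (R.fil n).pair)
    (h : r ≫ Hom.pair (R.incl n) = z ≫ R.ι n) : ∃ (T' : A × A) (p : T' ⟶ T)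
    (s : T' ⟶ (unshift W).obj (R.X (n + 1))), Epi p.1 ∧ Epi p.2 ∧ s ≫ R.D (n + 1) n = p ≫ z := by
  have h' : r ≫ Hom.pair (R.incl n) ≫ R.π n = z := by
    rw [reassoc_of% h, R.ι_π_self, Category.comp_id]
  cases n with
  | zero =>
    refine R.exact_zero z ?_
    rw [← h', Category.assoc, Category.assoc, ← R.pair_d₀, R.incl_d₀, comp_zero]
  | succ n =>
    refine R.exact_succ n z ?_
    rw [← h', Functor.map_comp, Category.assoc, R.map_incl_π_D (Nat.lt_succ_self n), comp_zero]

/-- The quotient of two consecutive steps is cofree on the cycles `Z` in `X n`. The n-th coordinate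
maps the step to `Z` and is split by the inclusion of the cycles; on `X (n + 1)` the differential
followed by it is the leading differential, which exactness makes epimorphic onto `Z`. So
`epi_cofreeLift` applies. -/
theorem exists_isShortExact (n : ℕ) : ∃ (Z : A × A) (q : R.fil n ⟶ cofree W Z),
    IsShortExact (R.trans n) q := by
  -- The elements of `X n` whose inclusion into `P` lies in the n-th step, formed in each component.
  let Z : A × A := (pullback (R.ι n).1 (R.incl n).neg, pullback (R.ι n).2 (R.incl n).zero)
  let z : Z ⟶ R.X n := (pullback.fst _ _, pullback.fst _ _)
  let r : Z ⟶ (R.fil n).pair := (pullback.snd _ _, pullback.snd _ _)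
  have hz : z ≫ R.ι n = r ≫ Hom.pair (R.incl n) := Prod.ext pullback.condition pullback.condition
  have : Mono z.1 := inferInstanceAs (Mono (pullback.fst (R.ι n).1 (R.incl n).neg))
  have : Mono z.2 := inferInstanceAs (Mono (pullback.fst (R.ι n).2 (R.incl n).zero))
  have : Mono z := pair_mono z
  obtain ⟨y, hy⟩ := R.exists_lift_π_ι n
  have hy₁ : (Hom.pair (R.incl n) ≫ R.π n).1 ≫ (R.ι n).1 = y.1 ≫ (R.incl n).neg :=
    congrArg Prod.fst ((Category.assoc _ _ _).trans hy.symm)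
  have hy₂ : (Hom.pair (R.incl n) ≫ R.π n).2 ≫ (R.ι n).2 = y.2 ≫ (R.incl n).zero :=
    congrArg Prod.snd ((Category.assoc _ _ _).trans hy.symm)
  let κ : (R.fil n).pair ⟶ Z := (pullback.lift _ _ hy₁, pullback.lift _ _ hy₂)
  have hκ : κ ≫ z = Hom.pair (R.incl n) ≫ R.π n :=
    Prod.ext (pullback.lift_fst _ _ _) (pullback.lift_fst _ _ _)
  have hr : r ≫ κ = 𝟙 Z := by
    rw [← cancel_mono z, Category.assoc, hκ, ← Category.assoc, ← hz, Category.assoc, R.ι_π_self,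
      Category.comp_id, Category.id_comp]
  obtain ⟨b, hb⟩ := R.exists_lift_ι n
  have hbκ : b ≫ κ = 0 := by
    rw [← cancel_mono z, Category.assoc, hκ, ← Category.assoc, hb, R.ι_π_ne _ _ (by lia), zero_comp]
  have hD : ((unshift W).map b ≫ (R.fil n).diff ≫ κ) ≫ z = R.D (n + 1) n := by
    simp only [Category.assoc]
    rw [hκ, map_comp_diff, hb, R.diff_π, Preadditive.comp_sum, Finset.sum_eq_single (n + 1)]
    · rw [← Category.assoc, ← Functor.map_comp, R.ι_π_self, CategoryTheory.Functor.map_id,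
        Category.id_comp]
    · intro m _ hm
      rw [← Category.assoc, ← Functor.map_comp, R.ι_π_ne _ _ hm.symm, Functor.map_zero, zero_comp]
    · intro h
      simp at h
  obtain ⟨T', p, s, hp₁, hp₂, hs⟩ := R.exists_refinement n z r hz.symm
  have hsp : s ≫ (unshift W).map b ≫ (R.fil n).diff ≫ κ = p := by
    rw [← cancel_mono z, ← hs, ← hD, Category.assoc]
  have he := epi_cofreeLift κ r hr b hbκ
    (have : Epi (s.1 ≫ ((unshift W).map b ≫ (R.fil n).diff ≫ κ).1) := by
      rw [show s.1 ≫ ((unshift W).map b ≫ (R.fil n).diff ≫ κ).1 = p.1 from congrArg Prod.fst hsp]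
      exact hp₁
     epi_of_epi s.1 _)
    (have : Epi (s.2 ≫ ((unshift W).map b ≫ (R.fil n).diff ≫ κ).2) := by
      rw [show s.2 ≫ ((unshift W).map b ≫ (R.fil n).diff ≫ κ).2 = p.2 from congrArg Prod.snd hsp]
      exact hp₂
     epi_of_epi s.2 _)
  -- As `z` is a monomorphism, replacing the n-th coordinate by its corestriction `κ` to the cycles
  -- does not change the kernel, which is the next step by definition.
  have key : ∀ {T : A × A} (t : T ⟶ (R.fil n).pair), t ≫ Hom.pair (cofreeLift κ) = 0 ↔
      ∃ s, s ≫ Hom.pair (R.trans n) = t := by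
    intro T t
    have e : t ≫ Hom.pair (cofreeLift κ) = 0 ↔
        t ≫ Hom.pair (R.incl n ≫ cofreeLift (R.π n)) = 0 := by
      rw [cofreeLift_precomp, pair_comp_cofreeLift_eq_zero_iff, pair_comp_cofreeLift_eq_zero_iff,
        ← hκ, ← cancel_mono z (h := 0), zero_comp, Category.assoc, ← cancel_mono z (h := 0)]
      simp only [Category.assoc, zero_comp]
    rw [e]
    refine ⟨exists_kerFact_lift _ t, ?_⟩
    rintro ⟨s, rfl⟩
    have e : Hom.pair (R.trans n) ≫ Hom.pair (R.incl n ≫ cofreeLift (R.π n)) = 0 :=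
      congrArg Hom.pair (kerFactι_comp (R.incl n ≫ cofreeLift (R.π n)))
    rw [Category.assoc, e, comp_zero]
  refine ⟨Z, cofreeLift κ, pair_injective ((key _).2 ⟨𝟙 _, Category.id_comp _⟩), inferInstance,
    inferInstance, he.1, he.2, fun {T} t ht => ?_, fun {T} t ht => ?_⟩
  · obtain ⟨s, hs⟩ := (key (T := (T, (R.fil n).zero)) (t, 0)).1 (Prod.ext ht zero_comp)
    exact ⟨s.1, congrArg Prod.fst hs⟩
  · obtain ⟨s, hs⟩ := (key (T := ((R.fil n).neg, T)) (0, t)).1 (Prod.ext zero_comp ht)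
    exact ⟨s.2, congrArg Prod.snd hs⟩

/-- Separatedness holds because the n-th step has no coordinates below `n`. A series with n-th term
in the n-th step has finitely many contributions to each coordinate, so it converges in the product
of the `X k`. -/
theorem isCompleteTower :
    IsCompleteTower (fun n => (R.fil n).pair) fun n => Hom.pair (R.trans n) where
  eq_zero {T} u hu n := by
    have h : ∀ n, u n ≫ Hom.pair (R.incl n) = u 0 ≫ Hom.pair (R.incl 0) := fun n => by
      induction n with
      | zero => rfl
      | succ n ih => 
        rw [← ih, ← hu n, Category.assoc]
        rfl
    rw [← cancel_mono (Hom.pair (R.incl n)), zero_comp]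
    refine R.hom_ext _ _ fun m => ?_
    rw [h, ← h (m + 1), Category.assoc, R.incl_π (Nat.lt_succ_self m), comp_zero, zero_comp]
  exists_sum {T} a := by
    -- `σ n` is the tail of the series from its n-th term on; in coordinate `k` only terms with
    -- index at most `k` occur.
    choose σ hσ using fun n => R.exists_lift fun k =>
      ∑ m ∈ Finset.Ico n (k + 1), a m ≫ Hom.pair (R.incl m) ≫ R.π k
    have hσ0 : ∀ n k, k < n → σ n ≫ R.π k = 0 := fun n k hk => by
      rw [hσ, Finset.Ico_eq_empty (by lia), Finset.sum_empty]
    -- The conditions for the tail to lie in the n-th step can be checked on the finite sums, term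
    -- by term.
    choose τ hτ using fun n => (R.liftable_iff n (σ n)).2 ⟨by
        rw [R.pair_d₀, ← Category.assoc, hσ, Preadditive.sum_comp]
        refine Finset.sum_eq_zero fun m _ => ?_
        rw [Category.assoc, Category.assoc, ← R.pair_d₀, R.incl_d₀, comp_zero],
      fun m hm => ⟨hσ0 n m hm, by
        rw [R.map_diff_π_eq _ m fun k hk => hσ0 n k (hk.trans_lt hm), hσ, Functor.map_sum,
          Preadditive.sum_comp]
        refine Finset.sum_eq_zero fun l hl => ?_
        rw [Functor.map_comp, Category.assoc, R.map_incl_π_D (by simp at hl; lia), comp_zero]⟩⟩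
    refine ⟨τ, fun n => ?_⟩
    have e : Hom.pair (R.trans n) ≫ Hom.pair (R.incl n) = Hom.pair (R.incl (n + 1)) := rfl
    rw [← cancel_mono (Hom.pair (R.incl n)), Preadditive.sub_comp, hτ, Category.assoc, e, hτ]
    refine R.hom_ext _ _ fun k => ?_
    rw [Preadditive.sub_comp, hσ, hσ, Category.assoc]
    rcases Nat.lt_or_ge k n with hk | hk
    · rw [Finset.Ico_eq_empty (by lia), Finset.Ico_eq_empty (by lia), R.incl_π hk]
      simp
    · rw [Finset.sum_eq_sum_Ico_succ_bot (by lia), add_sub_cancel_right]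

theorem isShortExact_zero : IsShortExact (R.incl 0) d₀ := by
  have h₁ : d₀.neg = (R.π 0).1 ≫ R.aug.1 := congrArg Prod.fst R.pair_d₀
  have h₂ : d₀.zero = (R.π 0).2 ≫ R.aug.2 := congrArg Prod.snd R.pair_d₀
  have := R.epi_aug_fst
  have := R.epi_aug_snd
  have : IsSplitEpi (R.π 0).1 := ⟨⟨⟨(R.ι 0).1, congrArg Prod.fst (R.ι_π_self 0)⟩⟩⟩
  have : IsSplitEpi (R.π 0).2 := ⟨⟨⟨(R.ι 0).2, congrArg Prod.snd (R.ι_π_self 0)⟩⟩⟩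
  refine ⟨kerFactι_comp d₀, inferInstance, inferInstance, h₁ ▸ epi_comp _ _, h₂ ▸ epi_comp _ _,
    fun t ht => ⟨kernel.lift _ t ht, kernel.lift_ι _ _ _⟩,
    fun t ht => ⟨kernel.lift _ t ht, kernel.lift_ι _ _ _⟩⟩

variable [HasProducts.{v} A] {N : ObjectProperty (KFact W)}

include R in
/-- The cone of a twisted resolution is contra-acyclic. -/
theorem cone_mem (hN : IsThick N) (hT : ContainsTot N)
    (hP : ∀ J : Type v, N.IsClosedUnderLimitsOfShape (Discrete J)) :
    N ((toK W).obj (cone d₀)) := by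
  let j : ∀ n, R.fil n ⟶ R.fil 0 := fun n => Nat.rec (𝟙 _) (fun n j => R.trans n ≫ j) n
  have hj : ∀ n, N ((toK W).obj (cone (j n))) := by
    intro n
    induction n with
    | zero => exact hN.zero _ (isZero_toK_cone_id _)
    | succ n ih =>
      obtain ⟨Z, q, hq⟩ := R.exists_isShortExact n
      -- Passing to the next step changes the cone only by a contractible quotient.
      exact hq.mem_cone_comp hN hT (j n) (hN.zero _ (isZero_toK_cofree Z)) ih
  exact R.isShortExact_zero.mem_cone hN hT (mem_of_isCompleteTower (fun n => R.trans n) j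
    (fun _ => rfl) hN hT hP R.isCompleteTower.fst R.isCompleteTower.snd hj)

include R in
/-- The cone of a finite twisted resolution is totally acyclic. -/
theorem cone_mem_of_finite (hN : IsThick N) (hT : ContainsTot N) (M : ℕ)
    (hM : ∀ n, M ≤ n → IsZero (R.X n)) : N ((toK W).obj (cone d₀)) := by
  -- In the M-th step the coordinates below `M` vanish and the remaining ones lie in zero objects,
  -- so the filtration ends and the steps can be built up from there.
  have h0 : 𝟙 (R.fil M).pair = 0 := by
    rw [← cancel_mono (Hom.pair (R.incl M)), Category.id_comp, zero_comp]
    refine R.hom_ext _ _ fun n => ?_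
    rcases Nat.lt_or_ge n M with h | h
    · rw [R.incl_π h, zero_comp]
    · exact (hM n h).eq_of_tgt _ _
  have hmem : ∀ k, k ≤ M → N ((toK W).obj (R.fil (M - k))) := by
    intro k
    induction k with
    | zero =>
      intro _
      refine hN.zero _ (isZero_toK (E := R.fil M) 0 ?_)
      rw [comp_zero, Functor.map_zero, zero_comp, add_zero, ← CategoryTheory.Functor.map_id, h0,
        Functor.map_zero]
    | succ k ih =>
      intro hk
      obtain ⟨Z, q, hq⟩ := R.exists_isShortExact (M - (k + 1))
      refine hq.mem_middle hN hT ?_ (hN.zero _ (isZero_toK_cofree Z))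
      rw [show M - (k + 1) + 1 = M - k by lia]
      exact ih (by lia)
  have := hmem M le_rfl
  rw [Nat.sub_self] at this
  exact R.isShortExact_zero.mem_cone hN hT this

end TwistedResolution
end

/-! ### The leading part of the differential of a folding -/

section ShiftSystem
set_option linter.unusedSectionVars false
variable {B : Type*} [Category B] [Preadditive B] {I : Type}

/-- Functors `Θ i` indexed by a set `I` with a successor map `s`, such that `Θ (s i)` is both
`Θ i` followed by `Ω` and `Ω` followed by `Θ i`, with natural sign automorphisms `τ i`. -/
structure ShiftSystem (Ω : B ⥤ B) (w : ∀ X, Ω.obj (Ω.obj X) ⟶ X) (s : I → I) where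
  Θ : I → B ⥤ B
  additive : ∀ i, (Θ i).Additive
  ε : ∀ i, Θ i ⋙ Ω ≅ Θ (s i)
  η : ∀ i, Ω ⋙ Θ i ≅ Θ (s i)
  η_ε : ∀ i X, Ω.map ((η i).hom.app X) ≫ (ε (s i)).hom.app X =
    (ε i).hom.app (Ω.obj X) ≫ (η (s i)).hom.app X
  w_Θ : ∀ i X, Ω.map ((ε i).hom.app X ≫ (η i).inv.app X) ≫
    ((ε i).hom.app (Ω.obj X) ≫ (η i).inv.app (Ω.obj X)) ≫ (Θ i).map (w X) = w ((Θ i).obj X)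
  τ : I → ∀ X : B, X ⟶ X
  τ_comp : ∀ i {X Y : B} (f : X ⟶ Y), τ i X ≫ f = f ≫ τ i Y
  τ_τ : ∀ i (X : B), τ i X ≫ τ i X = 𝟙 X
  τ_succ : ∀ i (X : B), τ (s i) X = -τ i X
  map_τ : ∀ i (X : B), Ω.map (τ i X) = -τ i (Ω.obj X)

namespace ShiftSystem
variable {Ω : B ⥤ B} {w : ∀ X, Ω.obj (Ω.obj X) ⟶ X} {s : I → I} (S : ShiftSystem Ω w s)

instance (i : I) : (S.Θ i).Additive := S.additive i

/-- `Ω (Θ i X) ≅ Θ (s i) X`. -/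
def after (i : I) (X : B) : Ω.obj ((S.Θ i).obj X) ⟶ (S.Θ (s i)).obj X := (S.ε i).hom.app X
/-- The inverse of `after`. -/
def afterInv (i : I) (X : B) : (S.Θ (s i)).obj X ⟶ Ω.obj ((S.Θ i).obj X) := (S.ε i).inv.app X
/-- `Θ (s i) X ≅ Θ i (Ω X)`. -/
def before (i : I) (X : B) : (S.Θ (s i)).obj X ⟶ (S.Θ i).obj (Ω.obj X) := (S.η i).inv.app X
/-- `Ω (Θ i X) ≅ Θ i (Ω X)`. -/
def swap (i : I) (X : B) : Ω.obj ((S.Θ i).obj X) ⟶ (S.Θ i).obj (Ω.obj X) :=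
  S.after i X ≫ S.before i X

theorem after_afterInv (i : I) (X : B) : S.after i X ≫ S.afterInv i X = 𝟙 _ :=
  (S.ε i).hom_inv_id_app X
theorem afterInv_after (i : I) (X : B) : S.afterInv i X ≫ S.after i X = 𝟙 _ :=
  (S.ε i).inv_hom_id_app X

theorem after_naturality (i : I) {X Y : B} (f : X ⟶ Y) :
    Ω.map ((S.Θ i).map f) ≫ S.after i Y = S.after i X ≫ (S.Θ (s i)).map f :=
  (S.ε i).hom.naturality f

theorem before_naturality (i : I) {X Y : B} (f : X ⟶ Y) :
    (S.Θ (s i)).map f ≫ S.before i Y = S.before i X ≫ (S.Θ i).map (Ω.map f) :=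
  (S.η i).inv.naturality f

theorem swap_naturality (i : I) {X Y : B} (f : X ⟶ Y) :
    Ω.map ((S.Θ i).map f) ≫ S.swap i Y = S.swap i X ≫ (S.Θ i).map (Ω.map f) := by
  rw [swap, reassoc_of% S.after_naturality, before_naturality, swap, Category.assoc]

/-- The coherence `η_ε` of the two descriptions of the next functor, rewritten with inverses so that
it can be used from left to right. -/
theorem map_before_after (i : I) (X : B) :
    Ω.map (S.before i X) ≫ S.after i (Ω.obj X) = S.swap (s i) X := by
  have h1 : Ω.map ((S.η i).hom.app X) ≫ S.after (s i) X =
    S.after i (Ω.obj X) ≫ (S.η (s i)).hom.app X := S.η_ε i X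
  have h2 : Ω.map (S.before i X) ≫ Ω.map ((S.η i).hom.app X) = 𝟙 _ := by
    rw [← Functor.map_comp, before, Iso.inv_hom_id_app, CategoryTheory.Functor.map_id]
  have h3 : (S.η (s i)).hom.app X ≫ S.before (s i) X = 𝟙 ((S.Θ (s i)).obj (Ω.obj X)) := Iso.hom_inv_id_app _ _
  rw [swap, ← Category.comp_id (S.after i (Ω.obj X)), ← h3, ← reassoc_of% h1, reassoc_of% h2]

theorem map_after_swap (i : I) (X : B) :
    Ω.map (S.after i X) ≫ S.swap (s i) X = Ω.map (S.swap i X) ≫ S.after i (Ω.obj X) := by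
  rw [← map_before_after, swap, Functor.map_comp_assoc]

theorem map_swap_swap (i : I) (X : B) :
    Ω.map (S.swap i X) ≫ S.swap i (Ω.obj X) ≫ (S.Θ i).map (w X) = w ((S.Θ i).obj X) :=
  S.w_Θ i X

/-- Moving a sign out of Ω costs a minus. This one rule produces all the cancellations in the square
of the leading part. -/
theorem map_τ_comp [Ω.Additive] (i : I) {X Y : B} (f : Ω.obj X ⟶ Y) :
    Ω.map (S.τ i X) ≫ f = -(f ≫ S.τ i Y) := by
  rw [map_τ, Preadditive.neg_comp, τ_comp]

end ShiftSystem

/-- A complex indexed by `I` with an endomorphism `φ` of degree `0` over `Ω`, and a homotopy `h`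
from `φ ^ 2` to `w`. -/
structure HomotopySquare (Ω : B ⥤ B) (w : ∀ X, Ω.obj (Ω.obj X) ⟶ X) (s : I → I) where
  X : I → B
  d : ∀ i, X i ⟶ X (s i)
  φ : ∀ i, Ω.obj (X i) ⟶ X i
  h : ∀ i, Ω.obj (Ω.obj (X (s i))) ⟶ X i
  d_d : ∀ i, d i ≫ d (s i) = 0
  d_φ : ∀ i, Ω.map (d i) ≫ φ (s i) = φ i ≫ d i
  φ_φ : ∀ i, h i ≫ d i + Ω.map (φ (s i)) ≫ φ (s i) + Ω.map (Ω.map (d (s i))) ≫ h (s i) =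
    w (X (s i))

namespace ShiftSystem
variable {Ω : B ⥤ B} {w : ∀ X, Ω.obj (Ω.obj X) ⟶ X} {s : I → I} (S : ShiftSystem Ω w s)
  (C : HomotopySquare Ω w s)

/-- The objects `Θ i (X i)`. -/
abbrev obj (i : I) : B := (S.Θ i).obj (C.X i)

/-- The components of the leading part that raise the degree. -/
def up (i : I) : Ω.obj (S.obj C i) ⟶ S.obj C (s i) :=
  S.after i _ ≫ (S.Θ (s i)).map (C.d i) ≫ S.τ i _

/-- The components of the leading part that preserve the degree. -/
def diag (i : I) : Ω.obj (S.obj C i) ⟶ S.obj C i := S.swap i _ ≫ (S.Θ i).map (C.φ i)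

/-- The components of the leading part that lower the degree. -/
def down (i : I) : Ω.obj (S.obj C (s i)) ⟶ S.obj C i :=
  S.swap (s i) _ ≫ S.before i _ ≫ (S.Θ i).map (C.h i) ≫ S.τ (s i) _

/-- What factors through the image of `d` under `Θ (s i)` factors through `up`. -/
theorem exists_comp_up (i : I) {T : B} (u : T ⟶ (S.Θ (s i)).obj (C.X i)) :
    ∃ v : T ⟶ Ω.obj (S.obj C i), v ≫ S.up C i = u ≫ (S.Θ (s i)).map (C.d i) := by
  refine ⟨u ≫ S.τ i _ ≫ S.afterInv i _, ?_⟩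
  rw [up, Category.assoc, Category.assoc, reassoc_of% S.afterInv_after, ← S.τ_comp,
    reassoc_of% S.τ_τ]

/-- Up to isomorphisms and a sign that squares to the identity, `up` is the image of `d`; these are
removed, and then Ω by faithfulness. -/
theorem map_comp_up_eq_zero [Ω.Faithful] [Ω.Additive] (i : I) {T : B} (t : T ⟶ S.obj C i)
    (h : Ω.map t ≫ S.up C i = 0) : t ≫ (S.Θ i).map (C.d i) = 0 := by
  apply Ω.map_injective
  have h1 := congrArg (· ≫ S.τ i _ ≫ S.afterInv i _) h
  simp only [up, Category.assoc, zero_comp] at h1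
  rw [reassoc_of% S.τ_τ, ← reassoc_of% S.after_naturality, after_afterInv, Category.comp_id] at h1
  rw [Functor.map_comp, h1, Functor.map_zero]

open Classical in
/-- The leading part of the differential. -/
def leading (i j : I) : Ω.obj (S.obj C i) ⟶ S.obj C j :=
  if h : s i = j then S.up C i ≫ eqToHom (by rw [h]) else
  if h : i = j then S.diag C i ≫ eqToHom (by rw [h]) else
  if h : s j = i then eqToHom (by rw [h]) ≫ S.down C j else 0

variable (e : I ≃ ℤ) (hs : ∀ i, e (s i) = e i + 1)

theorem leading_up (i : I) : S.leading C i (s i) = S.up C i := by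
  rw [leading, dif_pos rfl, eqToHom_refl, Category.comp_id]

include hs

theorem leading_diag (i : I) : S.leading C i i = S.diag C i := by
  have h : s i ≠ i := fun h => by
    have := hs i
    rw [h] at this
    lia
  rw [leading, dif_neg h, dif_pos rfl, eqToHom_refl, Category.comp_id]

theorem leading_down (i : I) : S.leading C (s i) i = S.down C i := by
  have h : s (s i) ≠ i := fun h => by
    have := hs (s i)
    rw [h, hs] at this
    lia
  have h' : s i ≠ i := fun h => by
    have := hs i
    rw [h] at this
    lia
  rw [leading, dif_neg h, dif_neg h', dif_pos rfl, eqToHom_refl, Category.id_comp]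

theorem leading_of_lt {i j : I} (h : e i + 1 < e j ∨ e j < e i - 1) : S.leading C i j = 0 := by
  have h1 := hs i
  have h2 := hs j
  rw [leading, dif_neg, dif_neg, dif_neg]
  all_goals
    rintro h'
    have := congrArg e h'
    lia

theorem up_up [Ω.Additive] (i : I) : Ω.map (S.up C i) ≫ S.up C (s i) = 0 := by
  simp only [up, Functor.map_comp, Category.assoc, map_τ_comp]
  rw [Preadditive.comp_neg, reassoc_of% S.after_naturality]
  rw [← Functor.map_comp_assoc (S.Θ (s (s i))), C.d_d]
  simp

/-- Exactly one of the two orders moves a sign through Ω, so the chain map identity turns into a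
cancellation. -/
theorem up_diag [Ω.Additive] (i : I) :
    Ω.map (S.up C i) ≫ S.diag C (s i) + Ω.map (S.diag C i) ≫ S.up C i = 0 := by
  simp only [up, diag, Functor.map_comp, Category.assoc, map_τ_comp]
  rw [reassoc_of% S.after_naturality, Preadditive.comp_neg, Preadditive.comp_neg,
    reassoc_of% S.swap_naturality, reassoc_of% S.map_after_swap,
    ← Functor.map_comp_assoc, C.d_φ, Functor.map_comp_assoc, neg_add_cancel]

/-- The two mixed products acquire the sign + since the signs at neighbouring indices are opposite;
what remains is `φ_φ`, the equation that makes `h` a homotopy from φ² to w. -/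
theorem sq_zero [Ω.Additive] (i : I) :
    Ω.map (S.down C i) ≫ S.up C i + Ω.map (S.diag C (s i)) ≫ S.diag C (s i) +
      Ω.map (S.up C (s i)) ≫ S.down C (s i) = w _ := by
  have h1 : Ω.map (S.down C i) ≫ S.up C i = Ω.map (S.swap (s i) _) ≫ S.swap (s i) _ ≫
      (S.Θ (s i)).map (C.h i ≫ C.d i) := by
    simp only [up, down, Functor.map_comp, Category.assoc, map_τ_comp, Preadditive.comp_neg,
      S.τ_succ, Functor.map_neg, Preadditive.neg_comp, neg_neg, S.τ_τ, Category.comp_id]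
    rw [reassoc_of% S.after_naturality, reassoc_of% S.map_before_after]
  have h2 : Ω.map (S.diag C (s i)) ≫ S.diag C (s i) = Ω.map (S.swap (s i) _) ≫ S.swap (s i) _ ≫
      (S.Θ (s i)).map (Ω.map (C.φ (s i)) ≫ C.φ (s i)) := by
    simp only [diag, Functor.map_comp, Category.assoc]
    rw [reassoc_of% S.swap_naturality]
  have h3 : Ω.map (S.up C (s i)) ≫ S.down C (s i) = Ω.map (S.swap (s i) _) ≫ S.swap (s i) _ ≫
      (S.Θ (s i)).map (Ω.map (Ω.map (C.d (s i))) ≫ C.h (s i)) := by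
    simp only [up, down, Functor.map_comp, Category.assoc, map_τ_comp, Preadditive.comp_neg,
      S.τ_succ (s i), neg_neg, S.τ_τ, Category.comp_id]
    rw [reassoc_of% S.swap_naturality, reassoc_of% S.before_naturality,
      reassoc_of% S.map_after_swap]
    simp only [swap, Category.assoc]
  rw [h1, h2, h3, ← S.map_swap_swap, ← C.φ_φ]
  simp only [Functor.map_add, Preadditive.comp_add]

theorem diag_down [Ω.Additive] (hφ : ∀ i, Ω.map (C.h i) ≫ C.φ i =
      Ω.map (Ω.map (C.φ (s i))) ≫ C.h i) (i : I) :
    Ω.map (S.down C i) ≫ S.diag C i + Ω.map (S.diag C (s i)) ≫ S.down C i = 0 := by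
  have h1 (X : B) : Ω.map (S.before i X) ≫ S.swap i _ = S.swap (s i) _ ≫ S.before i _ := by
    rw [← map_before_after, Category.assoc]; rfl
  simp only [down, diag, Functor.map_comp, Category.assoc, map_τ_comp]
  rw [reassoc_of% S.swap_naturality, reassoc_of% S.before_naturality, Preadditive.comp_neg,
    Preadditive.comp_neg, Preadditive.comp_neg, reassoc_of% S.swap_naturality, reassoc_of% h1,
    ← Functor.map_comp_assoc (S.Θ i), ← Functor.map_comp_assoc (S.Θ i), hφ, neg_add_cancel]

theorem down_down [Ω.Additive] (hh : ∀ i, Ω.map (Ω.map (C.h (s i))) ≫ C.h i = 0) (i : I) :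
    Ω.map (S.down C (s i)) ≫ S.down C i = 0 := by
  simp only [down, Functor.map_comp, Category.assoc, map_τ_comp]
  rw [Preadditive.comp_neg, Preadditive.comp_neg, reassoc_of% S.swap_naturality,
    reassoc_of% S.before_naturality, ← Functor.map_comp_assoc (S.Θ i), hh]
  simp

theorem matSq_leading_succ [Ω.Additive] {a b : ℤ} (i k : I) (ha : a ≤ e i) (hb : e i + 2 ≤ b) :
    matSq Ω e (S.leading C) a b (s i) k = Ω.map (S.down C i) ≫ S.leading C i k +
      Ω.map (S.diag C (s i)) ≫ S.leading C (s i) k +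
        Ω.map (S.up C (s i)) ≫ S.leading C (s (s i)) k := by
  have h1 := hs i
  have h2 := hs (s i)
  classical
  have h : matSq Ω e (S.leading C) a b (s i) k = ∑ r ∈ ({i, s i, s (s i)} : Finset I),
      Ω.map (S.leading C (s i) r) ≫ S.leading C r k := by
    symm
    apply Finset.sum_subset
    · intro r hr
      simp only [Finset.mem_insert, Finset.mem_singleton] at hr
      rw [mem_indexIcc]
      rcases hr with rfl | rfl | rfl <;> lia
    · intro r _ hr
      simp only [Finset.mem_insert, Finset.mem_singleton, not_or, ← e.injective.eq_iff] at hr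
      rw [S.leading_of_lt C e hs (i := s i) (by lia)]
      simp
  rw [h, Finset.sum_insert, Finset.sum_insert, Finset.sum_singleton, S.leading_down C e hs,
    S.leading_diag C e hs, S.leading_up, add_assoc]
  all_goals
    simp only [Finset.mem_insert, Finset.mem_singleton, not_or, ← e.injective.eq_iff]
    lia

theorem exists_pred (i : I) : ∃ j, s j = i :=
  ⟨e.symm (e i - 1), e.injective (by rw [hs]; simp)⟩

theorem leading_of_add_lt (i j : I) (h : e i + 1 < e j) : S.leading C i j = 0 :=
  S.leading_of_lt C e hs (.inl h)

/-- By the difference of degrees: 0 is the homotopy equation, 1 the chain map property, 2 is d² = 0,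
and beyond that there are no paths. Nothing is known yet about components that lower the degree. -/
theorem matSq_leading [Ω.Additive] {i k : I} (h : e i ≤ e k) :
    matSq Ω e (S.leading C) (e k - 1) (e i + 1) i k = diagMat Ω w i k := by
  obtain ⟨i, rfl⟩ := exists_pred e hs i
  rw [← matSq_eq Ω e _ (S.leading_of_add_lt C e hs) (min_le_left (e k - 1) (e i))
    (le_refl (e (s i) + 1)), S.matSq_leading_succ C e hs i k (min_le_right _ _) (by rw [hs]; lia)]
  have h1 := hs i
  have h2 := hs (s i)
  obtain h3 | h3 | h3 | h3 : e k = e (s i) ∨ e k = e (s (s i)) ∨ e k = e (s (s (s i))) ∨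
      e (s (s (s i))) < e k := by rw [hs (s (s i))]; lia
  · obtain rfl := e.injective h3
    rw [diagMat_self, leading_up, S.leading_diag C e hs, S.leading_down C e hs, S.sq_zero C e hs]
  · obtain rfl := e.injective h3
    rw [diagMat_of_ne, S.leading_of_lt C e hs (i := i) (by lia), leading_up,
      S.leading_diag C e hs, comp_zero, zero_add, add_comm, S.up_diag C e hs]
    rw [ne_eq, ← e.injective.eq_iff]
    lia
  · obtain rfl := e.injective h3
    have h4 := hs (s (s i))
    rw [diagMat_of_ne, S.leading_of_lt C e hs (i := i) (by lia), leading_up,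
      S.leading_of_lt C e hs (i := s i) (by lia), comp_zero, comp_zero, zero_add, zero_add,
      S.up_up C e hs]
    rw [ne_eq, ← e.injective.eq_iff]
    lia
  · rw [hs (s (s i))] at h3
    rw [diagMat_of_ne, S.leading_of_lt C e hs (i := i) (by lia),
      S.leading_of_lt C e hs (i := s i) (by lia), S.leading_of_lt C e hs (i := s (s i)) (by lia),
      comp_zero, comp_zero, comp_zero, zero_add, zero_add]
    rw [ne_eq, ← e.injective.eq_iff]
    lia

/-- The components that lower the degree by 1 and by 2 are the only ones left, and they are exactly
the commutator of `φ` with `h` and the square of `h`. -/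
theorem matSq_leading_of_compatible [Ω.Additive]
    (hφ : ∀ i, Ω.map (C.h i) ≫ C.φ i = Ω.map (Ω.map (C.φ (s i))) ≫ C.h i)
    (hh : ∀ i, Ω.map (Ω.map (C.h (s i))) ≫ C.h i = 0) (i k : I) :
    matSq Ω e (S.leading C) (e k - 1) (e i + 1) i k = diagMat Ω w i k := by
  by_cases h : e i ≤ e k
  · exact S.matSq_leading C e hs h
  obtain ⟨i, rfl⟩ := exists_pred e hs i
  obtain ⟨i, rfl⟩ := exists_pred e hs i
  have h1 := hs i
  have h2 := hs (s i)
  have h3 := hs (s (s i))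
  rw [← matSq_eq Ω e _ (S.leading_of_add_lt C e hs) (min_le_left (e k - 1) (e (s i)))
    (le_refl (e (s (s i)) + 1)), S.matSq_leading_succ C e hs (s i) k (min_le_right _ _) (by lia),
    diagMat_of_ne Ω w (by rw [ne_eq, ← e.injective.eq_iff]; lia),
    S.leading_of_lt C e hs (i := s (s (s i))) (by lia), comp_zero, add_zero]
  obtain h4 | h4 | h4 : e k = e (s i) ∨ e k = e i ∨ e k < e i := by lia
  · obtain rfl := e.injective h4
    rw [S.leading_diag C e hs, S.leading_down C e hs, S.diag_down C e hs hφ]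
  · obtain rfl := e.injective h4
    rw [S.leading_down C e hs, S.leading_of_lt C e hs (i := s (s k)) (by lia), comp_zero,
      add_zero, S.down_down C e hs hh]
  · rw [S.leading_of_lt C e hs (i := s (s i)) (by lia), S.leading_of_lt C e hs (i := s i) (by lia),
      comp_zero, comp_zero, add_zero]

end ShiftSystem
end ShiftSystem

/-! ### The powers of `Φ` on pairs -/

/-- The indices of the factors of a totalization: `inl l` is `2l` and `inr l` is `2l + 1`. -/
def degree : ℤ ⊕ ℤ ≃ ℤ where
  toFun := Sum.elim (fun l => 2 * l) (fun l => 2 * l + 1)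
  invFun n := if n % 2 = 0 then Sum.inl (n / 2) else Sum.inr (n / 2)
  left_inv := by
    rintro (l | l)
    · simp
    · have h1 : (2 * l + 1) % 2 ≠ 0 := by lia
      have h2 : (2 * l + 1) / 2 = l := by lia
      simp only [Sum.elim_inr, h2, if_neg h1]
  right_inv n := by
    by_cases h : n % 2 = 0
    · simp only [if_pos h, Sum.elim_inl]
      lia
    · simp only [if_neg h, Sum.elim_inr]
      lia

/-- The index following `i`. -/
def succIndex : ℤ ⊕ ℤ → ℤ ⊕ ℤ
  | Sum.inl l => Sum.inr l
  | Sum.inr l => Sum.inl (l + 1)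

theorem degree_inl (l : ℤ) : degree (Sum.inl l) = 2 * l := rfl
theorem degree_inr (l : ℤ) : degree (Sum.inr l) = 2 * l + 1 := rfl

theorem degree_succIndex (i : ℤ ⊕ ℤ) : degree (succIndex i) = degree i + 1 := by
  rcases i with l | l
  · rfl
  · simp only [succIndex, degree_inl, degree_inr]
    lia

section
variable {A : Type u} [Category.{v} A]

theorem invMul_powEq (Φ : A ≌ A) {j j' k : ℤ} (h : j + 1 = k) (e : j = j') (h' : j' + 1 = k)
    (X : A) : (invMulIso Φ h).hom.app X ≫ (powEq Φ e).hom.app X = (invMulIso Φ h').hom.app X := by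
  subst e
  exact Category.comp_id _

theorem powEq_invMul (Φ : A ≌ A) {j j' k : ℤ} (h : j + 1 = k) (e : j = j') (h' : j' + 1 = k)
    (X : A) : (powEq Φ e).hom.app X ≫ (invMulIso Φ h').inv.app X = (invMulIso Φ h).inv.app X := by
  subst e
  exact Category.id_comp _

theorem mulInv_powEq_inv (Φ : A ≌ A) {j j' k : ℤ} (h : j + 1 = k) (e : j = j') (h' : j' + 1 = k)
    (X : A) : (mulInvIso Φ h').hom.app X ≫ (powEq Φ e).inv.app X = (mulInvIso Φ h).hom.app X := by
  subst e
  exact Category.comp_id _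

/-- The coherence `inv_coh` with the isomorphisms moved to the other sides. -/
theorem inv_coh_inv (Φ : A ≌ A) {i j k : ℤ} (h : i + 1 = j) (h' : j + 1 = k) (X : A) :
    Φ.inverse.map ((invMulIso Φ h').inv.app X) ≫ (mulInvIso Φ h').hom.app (Φ.inverse.obj X) =
      (mulInvIso Φ h).hom.app X ≫ (invMulIso Φ h).inv.app X := by
  have h1 := inv_coh Φ h h' X
  rw [← cancel_mono ((invMulIso Φ h).hom.app X), Category.assoc, ← h1, Category.assoc,
    Iso.inv_hom_id_app, Category.comp_id, ← Functor.map_comp_assoc, Iso.inv_hom_id_app,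
    Φ.inverse.map_id, Category.id_comp]

variable (W : Potential A)

/-- The functors whose values on `(A⁻¹_p, A⁰_p)` are the factors of index `p` of a totalization. -/
def powPair : ℤ ⊕ ℤ → A × A ⥤ A × A
  | Sum.inl l =>
    { obj X := ((W.Φ ^ (-l)).functor.obj X.1, (W.Φ ^ (-l)).functor.obj X.2)
      map f := ((W.Φ ^ (-l)).functor.map f.1, (W.Φ ^ (-l)).functor.map f.2)
      map_id X := Prod.ext ((W.Φ ^ (-l)).functor.map_id X.1) ((W.Φ ^ (-l)).functor.map_id X.2)
      map_comp f g := Prod.ext ((W.Φ ^ (-l)).functor.map_comp f.1 g.1)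
        ((W.Φ ^ (-l)).functor.map_comp f.2 g.2) }
  | Sum.inr l =>
    { obj X := ((W.Φ ^ (-l - 1)).functor.obj X.2, (W.Φ ^ (-l)).functor.obj X.1)
      map f := ((W.Φ ^ (-l - 1)).functor.map f.2, (W.Φ ^ (-l)).functor.map f.1)
      map_id X := Prod.ext ((W.Φ ^ (-l - 1)).functor.map_id X.2) ((W.Φ ^ (-l)).functor.map_id X.1)
      map_comp f g := Prod.ext ((W.Φ ^ (-l - 1)).functor.map_comp f.2 g.2)
        ((W.Φ ^ (-l)).functor.map_comp f.1 g.1) }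

/-- The isomorphisms of `powPair W i` followed by `unshift W` with `powPair W (succIndex i)`. -/
def powPairAfter : ∀ i, powPair W i ⋙ unshift W ≅ powPair W (succIndex i)
  | Sum.inl l => NatIso.ofComponents
      (fun X => Iso.prod ((mulInvIso W.Φ (show -l - 1 + 1 = -l by lia)).app X.2) (Iso.refl _))
      (fun f => Prod.ext ((mulInvIso W.Φ (show -l - 1 + 1 = -l by lia)).hom.naturality f.2)
        ((Category.comp_id _).trans (Category.id_comp _).symm))
  | Sum.inr l => NatIso.ofComponents
      (fun X => Iso.prod ((mulInvIso W.Φ (show -(l + 1) + 1 = -l by lia)).app X.1)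
        ((powEq W.Φ (show -l - 1 = -(l + 1) by lia)).app X.2))
      (fun f => Prod.ext ((mulInvIso W.Φ (show -(l + 1) + 1 = -l by lia)).hom.naturality f.1)
        ((powEq W.Φ (show -l - 1 = -(l + 1) by lia)).hom.naturality f.2))

/-- The isomorphisms of `unshift W` followed by `powPair W i` with `powPair W (succIndex i)`. -/
def powPairBefore : ∀ i, unshift W ⋙ powPair W i ≅ powPair W (succIndex i)
  | Sum.inl l => NatIso.ofComponents
      (fun X => Iso.prod ((invMulIso W.Φ (show -l - 1 + 1 = -l by lia)).app X.2) (Iso.refl _))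
      (fun f => Prod.ext ((invMulIso W.Φ (show -l - 1 + 1 = -l by lia)).hom.naturality f.2)
        ((Category.comp_id _).trans (Category.id_comp _).symm))
  | Sum.inr l => NatIso.ofComponents
      (fun X => Iso.prod ((powEq W.Φ (show -l - 1 = -(l + 1) by lia)).app X.1)
        ((invMulIso W.Φ (show -(l + 1) + 1 = -l by lia)).app X.2))
      (fun f => Prod.ext ((powEq W.Φ (show -l - 1 = -(l + 1) by lia)).hom.naturality f.1)
        ((invMulIso W.Φ (show -(l + 1) + 1 = -l by lia)).hom.naturality f.2))

/-- The signs in the leading part of a folding. -/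
def pairSign [Preadditive A] : ℤ ⊕ ℤ → ∀ X : A × A, X ⟶ X
  | Sum.inl _, X => (-𝟙 X.1, 𝟙 X.2)
  | Sum.inr _, X => (𝟙 X.1, -𝟙 X.2)

end

section
variable {A : Type u} [Category.{v} A] [Abelian A] (W : Potential A)

instance powPair_additive (i : ℤ ⊕ ℤ) : (powPair W i).Additive where
  map_add {X Y f g} := by
    rcases i with l | l
    · exact Prod.ext ((W.Φ ^ (-l)).functor.map_add) ((W.Φ ^ (-l)).functor.map_add)
    · exact Prod.ext ((W.Φ ^ (-l - 1)).functor.map_add) ((W.Φ ^ (-l)).functor.map_add)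

/-- The powers of `Φ` on pairs, with their signs. -/
def powSystem : ShiftSystem (unshift W) (wPair W) succIndex where
  Θ := powPair W
  additive := powPair_additive W
  ε := powPairAfter W
  η := powPairBefore W
  η_ε i X := by
    rcases i with l | l
    · refine Prod.ext ?_ ((invMul_powEq W.Φ _ _ _ X.2).trans (Category.id_comp _).symm)
      exact ((congrArg (· ≫ _) (W.Φ.inverse.map_id _)).trans (Category.id_comp _)).trans
        (mulInv_powEq W.Φ _ _ _ X.1).symm
    · refine Prod.ext (inv_coh W.Φ _ _ X.2) ?_
      rfl
  -- After the transports along equal exponents cancel, this is the compatibility `wInv_pow` of w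
  -- with the powers of Φ.
  w_Θ i X := by
    rcases i with l | l
    · refine Prod.ext ?_ ?_
      · have h : -l - 1 + 1 = -l := by lia
        change W.Φ.inverse.map (𝟙 _ ≫ 𝟙 _) ≫ ((mulInvIso W.Φ h).hom.app X.1 ≫
          (invMulIso W.Φ h).inv.app X.1) ≫ (W.Φ ^ (-l)).functor.map (wInv W.Φ W.w X.1) =
            wInv W.Φ W.w ((W.Φ ^ (-l)).functor.obj X.1)
        rw [wInv_pow W.Φ W.w W.w_comm h, Category.comp_id]
        simp
      · have h : -l - 1 + 1 = -l := by lia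
        change ((mulInvIso W.Φ h).hom.app X.2 ≫ (invMulIso W.Φ h).inv.app X.2) ≫ (𝟙 _ ≫ 𝟙 _) ≫
          (W.Φ ^ (-l)).functor.map (wInv W.Φ W.w X.2) =
            wInv W.Φ W.w ((W.Φ ^ (-l)).functor.obj X.2)
        rw [wInv_pow W.Φ W.w W.w_comm h, Category.comp_id]
        simp
    · have h : -l - 1 + 1 = -l := by lia
      have h' : -(l + 1) + 1 = -l := by lia
      have h₀ : -l - 2 + 1 = -l - 1 := by lia
      have e : -l - 1 = -(l + 1) := by lia
      refine Prod.ext ?_ ?_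
      · change W.Φ.inverse.map ((powEq W.Φ e).hom.app X.2 ≫ (invMulIso W.Φ h').inv.app X.2) ≫
          ((mulInvIso W.Φ h').hom.app (W.Φ.inverse.obj X.2) ≫
            (powEq W.Φ e).inv.app (W.Φ.inverse.obj X.2)) ≫
              (W.Φ ^ (-l - 1)).functor.map (wInv W.Φ W.w X.2) =
            wInv W.Φ W.w ((W.Φ ^ (-l - 1)).functor.obj X.2)
        rw [wInv_pow W.Φ W.w W.w_comm h₀, powEq_invMul W.Φ h e h', mulInv_powEq_inv W.Φ h e h',
          reassoc_of% inv_coh_inv W.Φ h₀ h]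
      · change ((mulInvIso W.Φ h').hom.app X.1 ≫ (powEq W.Φ e).inv.app X.1) ≫
          ((powEq W.Φ e).hom.app X.1 ≫
            (invMulIso W.Φ h').inv.app (X.1)) ≫
              (W.Φ ^ (-l)).functor.map (wInv W.Φ W.w X.1) =
            wInv W.Φ W.w ((W.Φ ^ (-l)).functor.obj X.1)
        rw [wInv_pow W.Φ W.w W.w_comm h, mulInv_powEq_inv W.Φ h e h', powEq_invMul W.Φ h e h']
  τ := pairSign
  τ_comp i X Y f := by
    rcases i with l | l
    · exact Prod.ext (by simp [pairSign]) (by simp [pairSign])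
    · exact Prod.ext (by simp [pairSign]) (by simp [pairSign])
  τ_τ i X := by
    rcases i with l | l
    · exact Prod.ext (by simp [pairSign]) (by simp [pairSign])
    · exact Prod.ext (by simp [pairSign]) (by simp [pairSign])
  τ_succ i X := by
    rcases i with l | l
    · exact Prod.ext (by simp [pairSign, succIndex]) (by simp [pairSign, succIndex])
    · exact Prod.ext (by simp [pairSign, succIndex]) (by simp [pairSign, succIndex])
  -- Ω interchanges the two components, and these carry opposite signs.
  map_τ i X := by
    rcases i with l | l
    · refine Prod.ext ?_ rfl
      change W.Φ.inverse.map (𝟙 _) = - -𝟙 _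
      simp
    · refine Prod.ext ?_ (neg_neg _).symm
      change W.Φ.inverse.map (-𝟙 _) = -𝟙 _
      simp

end

/-! ### The complexes of pairs of a choice of resolutions -/

section
variable {A : Type u} [Category.{v} A] {W : Potential A}

/-- The morphism `Φ⁻¹ X ⟶ Y` that corresponds to `X ⟶ Φ Y`. -/
def invMate {X Y : A} (f : X ⟶ W.Φ.functor.obj Y) : W.Φ.inverse.obj X ⟶ Y :=
  W.Φ.inverse.map f ≫ W.Φ.unitIso.inv.app Y

/-- The morphism `w_X`. -/
def wObj (W : Potential A) (X : A) : X ⟶ W.Φ.functor.obj X := W.w.app X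

theorem invMate_w (X : A) : invMate (wObj W X) = wInv W.Φ W.w X := rfl

theorem invMate_comp_map {X Y Z : A} (f : X ⟶ W.Φ.functor.obj Y) (g : Y ⟶ Z) :
    invMate (f ≫ W.Φ.functor.map g) = invMate f ≫ g := by
  have h := W.Φ.unitIso.inv.naturality g
  simp only [Functor.comp_obj, Functor.id_obj, Functor.comp_map, Functor.id_map] at h
  rw [invMate, invMate, Functor.map_comp, Category.assoc, h, Category.assoc]

theorem invMate_comp {X Y Z : A} (g : Z ⟶ X) (f : X ⟶ W.Φ.functor.obj Y) :
    invMate (g ≫ f) = W.Φ.inverse.map g ≫ invMate f := by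
  rw [invMate, invMate, Functor.map_comp, Category.assoc]

theorem invMate_counitInv {X Y : A} (f : W.Φ.inverse.obj X ⟶ Y) :
    invMate (W.Φ.counitIso.inv.app X ≫ W.Φ.functor.map f) = f :=
  Factorization.inverse_map_mate f

theorem invMate_add [Abelian A] {X Y : A} (f g : X ⟶ W.Φ.functor.obj Y) :
    invMate (f + g) = invMate f + invMate g := by
  rw [invMate, Functor.map_add, Preadditive.add_comp]; rfl

theorem invMate_sub [Abelian A] {X Y : A} (f g : X ⟶ W.Φ.functor.obj Y) :
    invMate (f - g) = invMate f - invMate g := by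
  rw [invMate, Functor.map_sub, Preadditive.sub_comp]; rfl

theorem invMate_zero [Abelian A] {X Y : A} : invMate (0 : X ⟶ W.Φ.functor.obj Y) = 0 := by
  rw [invMate, Functor.map_zero, zero_comp]

end

section
variable {A : Type u} [Category.{v} A] [Abelian A] {W : Potential A} {E : Factorization W}

namespace ResolutionData
variable (D : ResolutionData E)

/-- The components of the resolution of `E⁻¹`. -/
abbrev Xneg (n : ℤ) : A := D.Pneg.cochainComplex.X n
/-- The components of the resolution of `E⁰`. -/
abbrev Xzero (n : ℤ) : A := D.Pzero.cochainComplex.X n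
/-- The components of the lift of `φ⁻¹`. -/
def liftNeg (n : ℤ) : W.Φ.inverse.obj (D.Xzero n) ⟶ D.Xneg n := D.fneg.f n
/-- The components of the lift of `φ⁰`. -/
def liftZero (n : ℤ) : D.Xneg n ⟶ D.Xzero n := D.fzero.f n
/-- The components of the null-homotopy of `β⁻¹`. -/
def homNeg (q p : ℤ) : D.Xneg q ⟶ W.Φ.functor.obj (D.Xneg p) := D.hneg.hom q p
/-- The components of the null-homotopy of `β⁰`. -/
def homZero (q p : ℤ) : W.Φ.inverse.obj (D.Xzero q) ⟶ D.Xzero p := D.hzero.hom q p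

theorem homNeg_comm {n p q : ℤ} (h : p + 1 = n) (h' : n + 1 = q) :
    wObj W (D.Xneg n) - D.liftZero n ≫ W.Φ.counitIso.inv.app (D.Xzero n) ≫
        W.Φ.functor.map (D.liftNeg n) =
      D.Pneg.cochainComplex.d n q ≫ D.homNeg q n +
        D.homNeg n p ≫ W.Φ.functor.map (D.Pneg.cochainComplex.d p n) := by
  have h1 := D.hneg.comm n
  rw [dNext_eq D.hneg.hom (i' := q) h', prevD_eq D.hneg.hom (j' := p) h] at h1
  exact h1.trans (add_zero _)

theorem homZero_comm {n p q : ℤ} (h : p + 1 = n) (h' : n + 1 = q) :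
    wInv W.Φ W.w (D.Xzero n) - D.liftNeg n ≫ D.liftZero n =
      W.Φ.inverse.map (D.Pzero.cochainComplex.d n q) ≫ D.homZero q n +
        D.homZero n p ≫ D.Pzero.cochainComplex.d p n := by
  have h1 := D.hzero.comm n
  rw [dNext_eq D.hzero.hom (i' := q) h', prevD_eq D.hzero.hom (j' := p) h] at h1
  exact h1.trans (add_zero _)

/-- Transposition brings the homotopy on the components of degree -1 to the same shape as the one on
degree 0, so that both form a single homotopy on pairs. -/
theorem invMate_homNeg_comm {n p q : ℤ} (h : p + 1 = n) (h' : n + 1 = q) :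
    wInv W.Φ W.w (D.Xneg n) - W.Φ.inverse.map (D.liftZero n) ≫ D.liftNeg n =
      W.Φ.inverse.map (D.Pneg.cochainComplex.d n q) ≫ invMate (D.homNeg q n) +
        invMate (D.homNeg n p) ≫ D.Pneg.cochainComplex.d p n := by
  have h1 := congrArg invMate (D.homNeg_comm h h')
  rwa [invMate_add, invMate_sub, invMate_comp (D.liftZero n), invMate_counitInv, invMate_comp,
    invMate_comp_map, invMate_w] at h1

/-- The pairs of components of the resolutions with their differentials, lifts and homotopies. -/
def square : HomotopySquare (unshift W) (wPair W) succIndex where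
  X i := (D.Xneg (degree i), D.Xzero (degree i))
  d i := (D.Pneg.cochainComplex.d (degree i) (degree (succIndex i)),
    D.Pzero.cochainComplex.d (degree i) (degree (succIndex i)))
  φ i := (D.liftNeg (degree i), D.liftZero (degree i))
  h i := (invMate (D.homNeg (degree (succIndex i)) (degree i)),
      D.homZero (degree (succIndex i)) (degree i))
  d_d i := Prod.ext (D.Pneg.cochainComplex.d_comp_d _ _ _) (D.Pzero.cochainComplex.d_comp_d _ _ _)
  d_φ i := Prod.ext (D.fneg.comm (degree i) (degree (succIndex i))).symm
    (D.fzero.comm (degree i) (degree (succIndex i))).symm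
  φ_φ i := by
    have h := (degree_succIndex i).symm
    have h' := (degree_succIndex (succIndex i)).symm
    refine Prod.ext ?_ ?_
    · have h1 := D.invMate_homNeg_comm h h'
      rw [sub_eq_iff_eq_add] at h1
      refine Eq.trans ?_ h1.symm
      rw [add_right_comm, add_comm (W.Φ.inverse.map _ ≫ _)]
      rfl
    · have h1 := D.homZero_comm h h'
      rw [sub_eq_iff_eq_add] at h1
      refine Eq.trans ?_ h1.symm
      rw [add_right_comm, add_comm (W.Φ.inverse.map _ ≫ _)]
      rfl

variable {D}

/-- The two mixed conditions, transposed along Φ, are the two components of one identity on pairs.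
-/
theorem IsCompatible.square_φ (hD : D.IsCompatible) (i : ℤ ⊕ ℤ) :
    (unshift W).map (D.square.h i) ≫ D.square.φ i =
      (unshift W).map ((unshift W).map (D.square.φ (succIndex i))) ≫ D.square.h i := by
  have h₁ (p q : ℤ) (h : q = p + 1) : D.liftNeg q ≫ D.homNeg q p =
      D.homZero q p ≫ W.Φ.counitIso.inv.app (D.Xzero p) ≫ W.Φ.functor.map (D.liftNeg p) := by
    subst h
    exact hD.hneg_fneg p
  have h₂ (p q : ℤ) (h : q = p + 1) : D.liftZero q ≫ W.Φ.counitIso.inv.app (D.Xzero q) ≫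
      W.Φ.functor.map (D.homZero q p) = D.homNeg q p ≫ W.Φ.functor.map (D.liftZero p) := by
    subst h
    exact hD.hzero_fzero p
  have k₁ := congrArg invMate (h₁ _ _ (degree_succIndex i))
  have k₂ := congrArg invMate (h₂ _ _ (degree_succIndex i))
  rw [invMate_comp, invMate_comp, invMate_counitInv] at k₁
  rw [invMate_comp_map, invMate_comp, invMate_counitInv] at k₂
  exact Prod.ext k₁.symm k₂.symm

/-- The condition on `hneg` has to be transposed twice, the one on `hzero` once, since the latter
already starts at Φ⁻¹. -/
theorem IsCompatible.square_h (hD : D.IsCompatible) (i : ℤ ⊕ ℤ) :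
    (unshift W).map ((unshift W).map (D.square.h (succIndex i))) ≫ D.square.h i = 0 := by
  have h₁ (p q r : ℤ) (h : q = p + 1) (h' : r = q + 1) :
      D.homNeg r q ≫ W.Φ.functor.map (D.homNeg q p) = 0 := by
    obtain rfl : p = q - 1 := by lia
    subst h'
    exact hD.hneg_hneg q
  have h₂ (p q r : ℤ) (h : q = p + 1) (h' : r = q + 1) : D.homZero r q ≫
      W.Φ.counitIso.inv.app (D.Xzero q) ≫ W.Φ.functor.map (D.homZero q p) = 0 := by
    obtain rfl : p = q - 1 := by lia
    subst h'
    exact hD.hzero_hzero q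
  have k₁ := congrArg invMate (congrArg invMate
    (h₁ _ _ _ (degree_succIndex i) (degree_succIndex (succIndex i))))
  have k₂ := congrArg invMate (h₂ _ _ _ (degree_succIndex i) (degree_succIndex (succIndex i)))
  rw [invMate_comp_map, invMate_comp, invMate_zero, invMate_zero] at k₁
  rw [invMate_comp, invMate_counitInv, invMate_zero] at k₂
  exact Prod.ext k₁ k₂

end ResolutionData
end

/-! ### Exactness and projectivity of the resolutions -/

section
variable {A : Type u} [Category.{v} A] [Abelian A]

/-- The augmentation is a quasi-isomorphism to a complex concentrated in degree 0, which is exact at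
`q < 0`. -/
theorem resolution_exact {X : A} (R : ProjectiveResolution X) (p q r : ℤ) (h : p + 1 = q)
    (h' : q + 1 = r) (hq : q < 0) :
    (ShortComplex.mk (R.cochainComplex.d p q) (R.cochainComplex.d q r)
      (R.cochainComplex.d_comp_d _ _ _)).Exact := by
  have h1 : ((CochainComplex.singleFunctor A 0).obj X).ExactAt q :=
    HomologicalComplex.exactAt_single_obj _ _ _ _ hq.ne
  have h2 : R.cochainComplex.ExactAt q :=
    (quasiIsoAt_iff_exactAt' R.π' q h1).1 inferInstance
  exact (HomologicalComplex.exactAt_iff' _ p q r (by simp [← h]) (by simp [h'])).1 h2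

/-- The augmentation of a projective resolution. -/
def augComplex {X : A} (R : ProjectiveResolution X) : R.complex.X 0 ⟶ X := R.π.f 0

theorem augComplex_exact {X : A} (R : ProjectiveResolution X) :
    (ShortComplex.mk (R.complex.d 1 0) (augComplex R) R.complex_d_comp_π_f_zero).Exact := R.exact₀

theorem aug_eq {X : A} (R : ProjectiveResolution X) :
    aug R = (R.cochainComplexXIso 0 0).hom ≫ augComplex R := by
  rw [aug, ProjectiveResolution.π'_f_zero]
  have h {P Q Y Z : A} (a : P ⟶ Q) (b : Q ⟶ Y) (i : Z ≅ Y) : (a ≫ b ≫ i.inv) ≫ i.hom = a ≫ b := by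
    simp
  exact h _ _ _

instance {X : A} (R : ProjectiveResolution X) : Epi (aug R) := by
  have : Epi (augComplex R) := inferInstanceAs (Epi (R.π.f 0))
  rw [aug_eq]
  exact epi_comp _ _

theorem d_aug {X : A} (R : ProjectiveResolution X) (p : ℤ) (h : p = -1) :
    R.cochainComplex.d p 0 ≫ aug R = 0 := by
  have h1 : R.complex.d 1 0 ≫ augComplex R = 0 := R.complex_d_comp_π_f_zero
  rw [aug_eq, R.cochainComplex_d p 0 1 0]
  simp [h1]

theorem resolution_exact_zero {X : A} (R : ProjectiveResolution X) (p : ℤ) (h : p = -1) :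
    (ShortComplex.mk (R.cochainComplex.d p 0) (aug R) (d_aug R p h)).Exact := by
  refine (ShortComplex.exact_iff_of_iso ?_).1 (augComplex_exact R)
  refine ShortComplex.isoMk (R.cochainComplexXIso p 1).symm (R.cochainComplexXIso 0 0).symm
    (Iso.refl _) ?_ ?_
  · simp [R.cochainComplex_d p 0 1 0]
  · simp [aug_eq]

theorem isZero_resolution {X : A} (R : ProjectiveResolution X) (n : ℤ) (h : 0 < n) :
    IsZero (R.cochainComplex.X n) := R.cochainComplex.isZero_of_isStrictlyLE 0 n h

theorem isZero_resolution_of_le {X : A} (R : ProjectiveResolution X) (N : ℕ)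
    (hN : ∀ n : ℕ, N ≤ n → IsZero (R.complex.X n)) (n : ℤ) (h : n ≤ -N) :
    IsZero (R.cochainComplex.X n) :=
  (hN n.natAbs (by lia)).of_iso (R.cochainComplexXIso n n.natAbs)

/-- Equivalences preserve exactness; stating it by refinements allows the two components of a pair
to be treated together without kernels. -/
theorem exists_refinement_map (Φ : A ≌ A) {X Y Z : A} {f : X ⟶ Y} {g : Y ⟶ Z} {w : f ≫ g = 0}
    (h : (ShortComplex.mk f g w).Exact) {T : A} (t : T ⟶ Φ.functor.obj Y)
    (ht : t ≫ Φ.functor.map g = 0) : ∃ (T' : A) (p : T' ⟶ T) (s : T' ⟶ Φ.functor.obj X), Epi p ∧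
      s ≫ Φ.functor.map f = p ≫ t := by
  have h1 := h.map Φ.functor
  obtain ⟨T', p, hp, s, hs⟩ := (ShortComplex.exact_iff_exact_up_to_refinements _).1 h1 t ht
  exact ⟨T', p, s, hp, hs.symm⟩

omit [Abelian A] in
theorem projective_map (Φ : A ≌ A) (X : A) [Projective X] : Projective (Φ.functor.obj X) :=
  (Φ.map_projective_iff X).2 inferInstance

theorem isZero_map (Φ : A ≌ A) {X : A} (h : IsZero X) : IsZero (Φ.functor.obj X) :=
  Φ.functor.map_isZero h

variable (W : Potential A)

omit [Abelian A] in
theorem projective_unshift (X : A × A) [Projective X.1] [Projective X.2] :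
    Projective ((unshift W).obj X).1 ∧ Projective ((unshift W).obj X).2 :=
  ⟨projective_map W.Φ.symm X.2, ‹Projective X.1›⟩

omit [Abelian A] in
theorem projective_powPair (i : ℤ ⊕ ℤ) (X : A × A) [Projective X.1] [Projective X.2] :
    Projective ((powPair W i).obj X).1 ∧ Projective ((powPair W i).obj X).2 := by
  rcases i with l | l
  · exact ⟨projective_map _ X.1, projective_map _ X.2⟩
  · exact ⟨projective_map _ X.2, projective_map _ X.1⟩

theorem isZero_powPair (i : ℤ ⊕ ℤ) {X : A × A} (h₁ : IsZero X.1) (h₂ : IsZero X.2) :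
    IsZero ((powPair W i).obj X) := by
  rcases i with l | l
  · exact pair_isZero (isZero_map _ h₁) (isZero_map _ h₂)
  · exact pair_isZero (isZero_map _ h₂) (isZero_map _ h₁)

theorem exists_refinement_powPair (i : ℤ ⊕ ℤ) {X Y Z : A × A} {f : X ⟶ Y} {g : Y ⟶ Z}
    {w₁ : f.1 ≫ g.1 = 0} {w₂ : f.2 ≫ g.2 = 0} (h₁ : (ShortComplex.mk f.1 g.1 w₁).Exact)
    (h₂ : (ShortComplex.mk f.2 g.2 w₂).Exact) {T : A × A} (t : T ⟶ (powPair W i).obj Y)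
    (ht : t ≫ (powPair W i).map g = 0) : ∃ (T' : A × A) (p : T' ⟶ T)
      (s : T' ⟶ (powPair W i).obj X), Epi p.1 ∧ Epi p.2 ∧ s ≫ (powPair W i).map f = p ≫ t := by
  rcases i with l | l
  · obtain ⟨T₁, p₁, s₁, hp₁, hs₁⟩ := exists_refinement_map (W.Φ ^ (-l)) h₁ t.1 (congrArg Prod.fst ht)
    obtain ⟨T₂, p₂, s₂, hp₂, hs₂⟩ := exists_refinement_map (W.Φ ^ (-l)) h₂ t.2 (congrArg Prod.snd ht)
    exact ⟨(T₁, T₂), (p₁, p₂), (s₁, s₂), hp₁, hp₂, Prod.ext hs₁ hs₂⟩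
  · obtain ⟨T₁, p₁, s₁, hp₁, hs₁⟩ :=
      exists_refinement_map (W.Φ ^ (-l - 1)) h₂ t.1 (congrArg Prod.fst ht)
    obtain ⟨T₂, p₂, s₂, hp₂, hs₂⟩ := exists_refinement_map (W.Φ ^ (-l)) h₁ t.2 (congrArg Prod.snd ht)
    exact ⟨(T₁, T₂), (p₁, p₂), (s₁, s₂), hp₁, hp₂, Prod.ext hs₁ hs₂⟩

/-! ### Exactness and lifting for the leading part of the folding -/

variable {W} {E : Factorization W}

namespace ResolutionData
variable (D : ResolutionData E)

theorem exists_refinement (i k : ℤ ⊕ ℤ) (h : degree i < -1) {T : A × A}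
    (t : T ⟶ ((powSystem W).Θ k).obj (D.square.X (succIndex i)))
    (ht : t ≫ ((powSystem W).Θ k).map (D.square.d (succIndex i)) = 0) :
    ∃ (T' : A × A) (p : T' ⟶ T) (s : T' ⟶ ((powSystem W).Θ k).obj (D.square.X i)),
      Epi p.1 ∧ Epi p.2 ∧ s ≫ ((powSystem W).Θ k).map (D.square.d i) = p ≫ t := by
  have h1 := degree_succIndex i
  have h2 := degree_succIndex (succIndex i)
  exact exists_refinement_powPair W k
    (resolution_exact D.Pneg (degree i) (degree (succIndex i)) (degree (succIndex (succIndex i)))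
      h1.symm h2.symm (by lia))
    (resolution_exact D.Pzero (degree i) (degree (succIndex i)) (degree (succIndex (succIndex i)))
      h1.symm h2.symm (by lia)) t ht

/-- The factors of the folding. -/
abbrev factor (i : ℤ ⊕ ℤ) : A × A := (powSystem W).obj D.square i

/-- The leading part of the differential of the folding. -/
abbrev leading (i j : ℤ ⊕ ℤ) : (unshift W).obj (D.factor i) ⟶ D.factor j :=
  (powSystem W).leading D.square i j

theorem projective_factor (i : ℤ ⊕ ℤ) : Projective (D.factor i).1 ∧ Projective (D.factor i).2 :=
  have : Projective (D.square.X i).1 := inferInstanceAs (Projective (D.Xneg _))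
  have : Projective (D.square.X i).2 := inferInstanceAs (Projective (D.Xzero _))
  projective_powPair W i _

theorem isZero_factor (i : ℤ ⊕ ℤ) (h : 0 < degree i) : IsZero (D.factor i) :=
  isZero_powPair W i (isZero_resolution D.Pneg _ h) (isZero_resolution D.Pzero _ h)

/-- The degree-raising entries are the resolution differentials up to isomorphism and sign. The
bound on the degree keeps the middle term away from degree 0, where the augmentation takes over. -/
theorem leading_exact (i : ℤ ⊕ ℤ) (h : degree i < -1) {T : A × A}
    (t : T ⟶ D.factor (succIndex i))
    (ht : (unshift W).map t ≫ D.leading (succIndex i) (succIndex (succIndex i)) = 0) :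
    ∃ (T' : A × A) (p : T' ⟶ T) (s : T' ⟶ (unshift W).obj (D.factor i)),
      Epi p.1 ∧ Epi p.2 ∧ s ≫ D.leading i (succIndex i) = p ≫ t := by
  rw [leading, ShiftSystem.leading_up] at ht
  obtain ⟨T', p, u, h₁, h₂, hu⟩ := D.exists_refinement i (succIndex i) h t
    ((powSystem W).map_comp_up_eq_zero D.square _ t ht)
  obtain ⟨s, hs⟩ := (powSystem W).exists_comp_up D.square i u
  refine ⟨T', p, s, h₁, h₂, ?_⟩
  rw [leading, ShiftSystem.leading_up, hs, hu]

/-- The augmentations on the factor of index `0`. -/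
def augPair : D.factor (Sum.inl 0) ⟶ E.pair := (aug D.Pneg, aug D.Pzero)

theorem leading_exact_zero {T : A × A} (t : T ⟶ D.factor (Sum.inl 0)) (ht : t ≫ D.augPair = 0) :
    ∃ (T' : A × A) (p : T' ⟶ T) (s : T' ⟶ (unshift W).obj (D.factor (Sum.inr (-1)))),
      Epi p.1 ∧ Epi p.2 ∧ s ≫ D.leading (Sum.inr (-1)) (Sum.inl 0) = p ≫ t := by
  obtain ⟨T', p, u, h₁, h₂, hu⟩ := exists_refinement_powPair W (Sum.inl 0)
    (f := D.square.d (Sum.inr (-1))) (g := ((aug D.Pneg, aug D.Pzero) :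
      ((D.Xneg 0, D.Xzero 0) : A × A) ⟶ (E.neg, E.zero)))
    (resolution_exact_zero D.Pneg (-1) rfl) (resolution_exact_zero D.Pzero (-1) rfl) t ht
  obtain ⟨s, hs⟩ := (powSystem W).exists_comp_up D.square (Sum.inr (-1)) u
  exact ⟨T', p, s, h₁, h₂, ((congrArg (s ≫ ·)
    ((powSystem W).leading_up D.square (Sum.inr (-1)))).trans hs).trans hu⟩

/-- The last differential is killed by the augmentation, past which the natural sign can be moved.
-/
theorem leading_augPair : D.leading (Sum.inr (-1)) (Sum.inl 0) ≫ D.augPair = 0 := by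
  have h : ((powSystem W).Θ (Sum.inl 0)).map (D.square.d (Sum.inr (-1))) ≫ D.augPair = 0 :=
    Prod.ext (d_aug D.Pneg (-1) rfl) (d_aug D.Pzero (-1) rfl)
  refine (congrArg (· ≫ D.augPair) ((powSystem W).leading_up D.square (Sum.inr (-1)))).trans ?_
  have h1 := (powSystem W).τ_comp (Sum.inr (-1)) D.augPair
  have key {P Q R S : A × A} (a : P ⟶ Q) (m : Q ⟶ R) (t : R ⟶ R) (g : R ⟶ S) (t' : S ⟶ S)
      (hm : m ≫ g = 0) (ht : t ≫ g = g ≫ t') : (a ≫ m ≫ t) ≫ g = 0 := by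
    rw [Category.assoc, Category.assoc, ht, reassoc_of% hm, zero_comp, comp_zero]
  exact key _ _ _ _ _ h h1

/-- At index 0 only the exponents -1 and 0 occur and the canonical isomorphisms are identities, so
this is the statement that the lifts cover the structure morphisms of `E`. -/
theorem leading_zero_augPair :
    D.leading (Sum.inl 0) (Sum.inl 0) ≫ D.augPair = (unshift W).map D.augPair ≫ E.diff := by
  rw [leading, (powSystem W).leading_diag D.square degree degree_succIndex, ShiftSystem.diag]
  refine Prod.ext ?_ ?_
  · have h : -(0 : ℤ) - 1 + 1 = -0 := by lia
    change (((mulInvIso W.Φ h).hom.app (D.Xzero 0) ≫ (invMulIso W.Φ h).inv.app (D.Xzero 0)) ≫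
      (W.Φ ^ (-0 : ℤ)).functor.map (D.liftNeg 0)) ≫ aug D.Pneg =
        W.Φ.inverse.map (aug D.Pzero) ≫ E.φneg
    rw [← D.fneg_aug]
    refine congrArg (· ≫ aug D.Pneg) ?_
    have h1 := mulInvIso_neg_one_zero (W := W) (by lia) (D.Xzero 0)
    have h2 := invMulIso_neg_one_zero (W := W) (by lia) (D.Xzero 0)
    refine (congrArg₂ (fun a b => (a ≫ b) ≫ D.liftNeg 0) h1 h2).trans ?_
    exact (congrArg (· ≫ D.liftNeg 0) (Category.comp_id _)).trans (Category.id_comp _)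
  · change ((𝟙 _ ≫ 𝟙 _) ≫ D.liftZero 0) ≫ aug D.Pzero = aug D.Pneg ≫ E.φzero
    rw [← D.fzero_aug]
    exact congrArg (· ≫ aug D.Pzero)
      ((congrArg (· ≫ D.liftZero 0) (Category.comp_id _)).trans (Category.id_comp _))

theorem exact_of_succIndex {i j k : ℤ ⊕ ℤ} (h : degree i < -1) (hij : succIndex i = j)
    (hjk : succIndex j = k) {T : A × A} (t : T ⟶ D.factor j)
    (ht : (unshift W).map t ≫ D.leading j k = 0) :
    ∃ (T' : A × A) (p : T' ⟶ T) (s : T' ⟶ (unshift W).obj (D.factor i)),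
      Epi p.1 ∧ Epi p.2 ∧ s ≫ D.leading i j = p ≫ t := by
  subst hij
  subst hjk
  exact D.leading_exact i h t ht

/-- Exactness lifts a cycle after an epimorphic refinement, and projectivity of the source splits
the refinement. This is the only use of projectivity in the perturbation. -/
theorem exists_lift_leading (i j : ℤ ⊕ ℤ) (h : degree j < -1)
    (R : (unshift W).obj ((unshift W).obj (D.factor i)) ⟶ D.factor (succIndex j))
    (hR : (unshift W).map R ≫ D.leading (succIndex j) (succIndex (succIndex j)) = 0) :
    ∃ f : (unshift W).obj (D.factor i) ⟶ D.factor j,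
      (unshift W).map f ≫ D.leading j (succIndex j) = R := by
  obtain ⟨T', p, s, h₁, h₂, hs⟩ := D.leading_exact j h R hR
  have := (D.projective_factor i).1
  have := (D.projective_factor i).2
  have := (projective_unshift W (D.factor i)).1
  have := (projective_unshift W (D.factor i)).2
  have := (projective_unshift W ((unshift W).obj (D.factor i))).1
  have := (projective_unshift W ((unshift W).obj (D.factor i))).2
  let r : (unshift W).obj ((unshift W).obj (D.factor i)) ⟶ T' :=
    (Projective.factorThru (𝟙 _) p.1, Projective.factorThru (𝟙 _) p.2)
  have hr : r ≫ p = 𝟙 _ :=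
    Prod.ext (Projective.factorThru_comp _ _) (Projective.factorThru_comp _ _)
  -- Ω is full because Φ⁻¹ is.
  obtain ⟨f, hf⟩ : ∃ f, (unshift W).map f = r ≫ s :=
    ⟨((r ≫ s).2, W.Φ.inverse.preimage (r ≫ s).1),
      Prod.ext (W.Φ.inverse.map_preimage _) rfl⟩
  exact ⟨f, by rw [hf, Category.assoc, hs, ← Category.assoc, hr, Category.id_comp]⟩

end ResolutionData
end

/-! ### The factors of totalizations as pairs -/

section
variable {A : Type u} [Category.{v} A] [Abelian A] [HasProducts.{v} A] (W : Potential A)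
  (Xn Xz : ℤ → A)

/-- The pair of components of a totalization. -/
abbrev totPair : A × A := (totNeg W Xn Xz, totZero W Xn Xz)

/-- The pair of factors of index `i` of a totalization. -/
abbrev totFactor (i : ℤ ⊕ ℤ) : A × A := (powPair W i).obj (Xn (degree i), Xz (degree i))

/-- The projections to the factors of a totalization. -/
def totProj : ∀ i, totPair W Xn Xz ⟶ totFactor W Xn Xz i
  | Sum.inl l => (πnegE W Xn Xz l, πzeroE W Xn Xz l)
  | Sum.inr l => (πnegO W Xn Xz l, πzeroO W Xn Xz l)

/-- The inclusions of the factors of a totalization. -/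
def totIncl : ∀ i, totFactor W Xn Xz i ⟶ totPair W Xn Xz
  | Sum.inl l => (ιnegE W Xn Xz l, ιzeroE W Xn Xz l)
  | Sum.inr l => (ιnegO W Xn Xz l, ιzeroO W Xn Xz l)

variable {W Xn Xz}

/-- The morphism to a totalization with given components. -/
def totLift {T : A × A} (s : ∀ i, T ⟶ totFactor W Xn Xz i) : T ⟶ totPair W Xn Xz :=
  (totNegLift (fun l => (s (Sum.inl l)).1) (fun l => (s (Sum.inr l)).1),
    totZeroLift (fun l => (s (Sum.inl l)).2) (fun l => (s (Sum.inr l)).2))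

theorem totLift_totProj {T : A × A} (s : ∀ i, T ⟶ totFactor W Xn Xz i) (i : ℤ ⊕ ℤ) :
    totLift s ≫ totProj W Xn Xz i = s i := by
  rcases i with l | l
  · exact Prod.ext (totNegLift_πE _ _ _) (totZeroLift_πE _ _ _)
  · exact Prod.ext (totNegLift_πO _ _ _) (totZeroLift_πO _ _ _)

theorem tot_hom_ext {T : A × A} {s t : T ⟶ totPair W Xn Xz}
    (h : ∀ i, s ≫ totProj W Xn Xz i = t ≫ totProj W Xn Xz i) : s = t := by
  refine Prod.ext ?_ ?_
  · refine biprod.hom_ext _ _ (Pi.hom_ext _ _ fun l => ?_) (Pi.hom_ext _ _ fun l => ?_)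
    · exact (Category.assoc _ _ _).trans
        ((congrArg Prod.fst (h (Sum.inl l))).trans (Category.assoc _ _ _).symm)
    · exact (Category.assoc _ _ _).trans
        ((congrArg Prod.fst (h (Sum.inr l))).trans (Category.assoc _ _ _).symm)
  · refine biprod.hom_ext _ _ (Pi.hom_ext _ _ fun l => ?_) (Pi.hom_ext _ _ fun l => ?_)
    · exact (Category.assoc _ _ _).trans
        ((congrArg Prod.snd (h (Sum.inl l))).trans (Category.assoc _ _ _).symm)
    · exact (Category.assoc _ _ _).trans
        ((congrArg Prod.snd (h (Sum.inr l))).trans (Category.assoc _ _ _).symm)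

section
variable (F G : ℤ → A) (l m : ℤ)

theorem piι_inl_fst_π : (Pi.ι F l ≫ (biprod.inl : ∏ᶜ F ⟶ ∏ᶜ F ⊞ ∏ᶜ G)) ≫ biprod.fst ≫ Pi.π F l =
    𝟙 _ := by simp
theorem piι_inr_snd_π : (Pi.ι G l ≫ (biprod.inr : ∏ᶜ G ⟶ ∏ᶜ F ⊞ ∏ᶜ G)) ≫ biprod.snd ≫ Pi.π G l =
    𝟙 _ := by simp
theorem piι_inl_fst_π_ne (h : l ≠ m) :
    (Pi.ι F l ≫ (biprod.inl : ∏ᶜ F ⟶ ∏ᶜ F ⊞ ∏ᶜ G)) ≫ biprod.fst ≫ Pi.π F m = 0 := by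
  simp [Pi.ι_π_of_ne _ h]
theorem piι_inr_snd_π_ne (h : l ≠ m) :
    (Pi.ι G l ≫ (biprod.inr : ∏ᶜ G ⟶ ∏ᶜ F ⊞ ∏ᶜ G)) ≫ biprod.snd ≫ Pi.π G m = 0 := by
  simp [Pi.ι_π_of_ne _ h]
theorem piι_inl_snd_π :
    (Pi.ι F l ≫ (biprod.inl : ∏ᶜ F ⟶ ∏ᶜ F ⊞ ∏ᶜ G)) ≫ biprod.snd ≫ Pi.π G m = 0 := by simp
theorem piι_inr_fst_π :
    (Pi.ι G l ≫ (biprod.inr : ∏ᶜ G ⟶ ∏ᶜ F ⊞ ∏ᶜ G)) ≫ biprod.fst ≫ Pi.π F m = 0 := by simp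

end

theorem totIncl_totProj_self (i : ℤ ⊕ ℤ) :
    totIncl W Xn Xz i ≫ totProj W Xn Xz i = 𝟙 _ := by
  rcases i with l | l
  · exact Prod.ext (piι_inl_fst_π _ _ _) (piι_inl_fst_π _ _ _)
  · exact Prod.ext (piι_inr_snd_π _ _ _) (piι_inr_snd_π _ _ _)

theorem totIncl_totProj_ne (i j : ℤ ⊕ ℤ) (h : i ≠ j) :
    totIncl W Xn Xz i ≫ totProj W Xn Xz j = 0 := by
  rcases i with l | l <;> rcases j with m | m
  · have h' : l ≠ m := fun h' => h (by rw [h'])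
    exact Prod.ext (piι_inl_fst_π_ne _ _ _ _ h') (piι_inl_fst_π_ne _ _ _ _ h')
  · exact Prod.ext (piι_inl_snd_π _ _ _ _) (piι_inl_snd_π _ _ _ _)
  · exact Prod.ext (piι_inr_fst_π _ _ _ _) (piι_inr_fst_π _ _ _ _)
  · have h' : l ≠ m := fun h' => h (by rw [h'])
    exact Prod.ext (piι_inr_snd_π_ne _ _ _ _ h') (piι_inr_snd_π_ne _ _ _ _ h')

variable (D : ∀ i j, (unshift W).obj (totFactor W Xn Xz i) ⟶ totFactor W Xn Xz j)

/-- The morphism given by a matrix, for families that vanish in positive degrees. -/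
def totMatrix : (unshift W).obj (totPair W Xn Xz) ⟶ totPair W Xn Xz :=
  totLift fun j => ∑ r ∈ indexIcc degree (degree j - 1) 0, (unshift W).map (totProj W Xn Xz r) ≫ D r j

theorem totMatrix_totProj (j : ℤ ⊕ ℤ) : totMatrix D ≫ totProj W Xn Xz j =
    ∑ r ∈ indexIcc degree (degree j - 1) 0, (unshift W).map (totProj W Xn Xz r) ≫ D r j :=
  totLift_totProj _ j

variable (hzero : ∀ i, 0 < degree i → IsZero (totFactor W Xn Xz i))
  (hup : ∀ i j, degree i + 1 < degree j → D i j = 0)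

include hzero hup

/-- A row only sums over degrees from `degree j - 1` to 0; outside this range either the entry or
its source is zero, so no entry is lost. -/
theorem totIncl_totMatrix (i j : ℤ ⊕ ℤ) :
    (unshift W).map (totIncl W Xn Xz i) ≫ totMatrix D ≫ totProj W Xn Xz j = D i j := by
  rw [totMatrix_totProj, Preadditive.comp_sum]
  by_cases h0 : 0 < degree i
  · exact (((unshift W).map_isZero (hzero i h0))).eq_of_src _ _
  · by_cases h1 : i ∈ indexIcc degree (degree j - 1) 0
    · rw [Finset.sum_eq_single_of_mem i h1, ← Functor.map_comp_assoc, totIncl_totProj_self,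
        CategoryTheory.Functor.map_id, Category.id_comp]
      intro r _ hr
      rw [← Functor.map_comp_assoc, totIncl_totProj_ne _ _ hr.symm, Functor.map_zero, zero_comp]
    · rw [hup i j (by rw [mem_indexIcc] at h1; lia)]
      apply Finset.sum_eq_zero
      intro r hr
      rw [← Functor.map_comp_assoc, totIncl_totProj_ne _ _ (by rintro rfl; exact h1 hr),
        Functor.map_zero, zero_comp]

/-- Each coordinate of the square is a finite double sum; exchanging the sums gives the matrix
square, and naturality of w absorbs the projection. -/
theorem totMatrix_sq (hsq : ∀ i k, matSq (unshift W) degree D (degree k - 1) (degree i + 1) i k =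
      diagMat (unshift W) (wPair W) i k) :
    (unshift W).map (totMatrix D) ≫ totMatrix D = wPair W _ := by
  apply tot_hom_ext
  intro k
  by_cases hk : 0 < degree k
  · exact (hzero k hk).eq_of_tgt _ _
  -- The inner range is enlarged to start at `degree k - 2`, independently of `r`, which makes the
  -- exchange of sums possible.
  have h1 : ∀ r ∈ indexIcc degree (degree k - 1) 0,
      (unshift W).map (totMatrix D ≫ totProj W Xn Xz r) ≫ D r k =
        ∑ i ∈ indexIcc degree (degree k - 2) 0,
          (unshift W).map ((unshift W).map (totProj W Xn Xz i)) ≫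
            (unshift W).map (D i r) ≫ D r k := by
    intro r hr
    rw [mem_indexIcc] at hr
    rw [totMatrix_totProj, Functor.map_sum, Preadditive.sum_comp]
    simp only [Functor.map_comp, Category.assoc]
    symm
    apply sum_indexIcc_of_eq_zero degree (by lia) le_rfl
    intro i hi
    by_cases h : degree i + 1 < degree r
    · rw [hup i r h, Functor.map_zero, zero_comp, comp_zero]
    · rw [((unshift W).map_isZero ((unshift W).map_isZero (hzero i (by lia)))).eq_of_tgt
        ((unshift W).map ((unshift W).map (totProj W Xn Xz i))) 0, zero_comp]
  have h2 : ∀ i ∈ indexIcc degree (degree k - 2) 0, ∑ r ∈ indexIcc degree (degree k - 1) 0,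
      (unshift W).map (D i r) ≫ D r k = diagMat (unshift W) (wPair W) i k := by
    intro i hi
    rw [mem_indexIcc] at hi
    rw [← hsq, ← matSq_eq (unshift W) degree D hup le_rfl (by lia : degree i + 1 ≤ 1)]
    symm
    apply sum_indexIcc_of_eq_zero degree le_rfl (by lia)
    rintro r (hr | hr)
    · rw [hup r k (by lia), comp_zero]
    · rw [((unshift W).map_isZero (hzero r hr)).eq_of_tgt ((unshift W).map (D i r)) 0, zero_comp]
  have h3 : k ∈ indexIcc degree (degree k - 2) 0 := by
    rw [mem_indexIcc]
    lia
  rw [Category.assoc, totMatrix_totProj, Preadditive.comp_sum]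
  simp only [← Functor.map_comp_assoc]
  rw [Finset.sum_congr rfl h1, Finset.sum_comm]
  simp only [← Preadditive.comp_sum]
  rw [Finset.sum_congr rfl fun i hi => by rw [h2 i hi], Finset.sum_eq_single_of_mem k h3,
    diagMat_self, wPair_naturality]
  intro i _ hi
  rw [diagMat_of_ne _ _ hi, comp_zero]

end

/-! ### The folding given by a matrix -/

section
variable {A : Type u} [Category.{v} A]

theorem mulInv_inv_mulInv (Φ : A ≌ A) {j j' k : ℤ} (h : j + 1 = k) (e : j = j') (h' : j' + 1 = k)
    (X : A) : (mulInvIso Φ h).inv.app X ≫ (mulInvIso Φ h').hom.app X = (powEq Φ e).hom.app X := by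
  rw [← mulInv_powEq Φ h e h', Iso.inv_hom_id_app_assoc]

theorem powEq_inv (Φ : A ≌ A) {a b : ℤ} (e : a = b) : (powEq Φ e).inv = (powEq Φ e.symm).hom := by
  subst e
  rfl

theorem invMulIso_inv_mulIso (Φ : A ≌ A) {j k : ℤ} (h : j + 1 = k) (X : A) :
    (invMulIso Φ h).inv.app (Φ.functor.obj X) ≫ (Φ ^ k).functor.map (Φ.unitIso.inv.app X) =
      (mulIso Φ h).hom.app X := by
  have h1 := (mulIso Φ h).hom.naturality (Φ.unitIso.inv.app X)
  simp only [Functor.comp_obj, Functor.id_obj, Functor.comp_map] at h1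
  simp only [invMulIso, Iso.trans_inv, Iso.symm_inv, Functor.isoWhiskerLeft_inv,
    Functor.isoWhiskerRight_inv, NatTrans.comp_app, Functor.whiskerLeft_app,
    Functor.whiskerRight_app, Functor.leftUnitor_inv_app, Functor.associator_hom_app,
    Functor.comp_obj, Functor.id_obj, Category.id_comp, Category.assoc]
  rw [← h1, ← Functor.map_comp_assoc, Equivalence.counitInv_functor_comp]
  simp

/-- On pairs the homotopy on degree -1 occurs transposed; this translates its entries back to the
untransposed form used for components of a folding. -/
theorem invMulIso_inv_map_invMate {W : Potential A} {j k : ℤ} (h : j + 1 = k) {X Y : A}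
    (f : X ⟶ W.Φ.functor.obj Y) : (invMulIso W.Φ h).inv.app X ≫ (W.Φ ^ k).functor.map (invMate f) =
      (W.Φ ^ j).functor.map f ≫ (mulIso W.Φ h).hom.app Y := by
  have h1 := (invMulIso W.Φ h).inv.naturality f
  simp only [Functor.comp_map] at h1
  rw [invMate, Functor.map_comp, ← reassoc_of% h1, invMulIso_inv_mulIso]

end

section
variable {A : Type u} [Category.{v} A] [Abelian A] {W : Potential A} {E : Factorization W}

/-- A differential on the factors of a folding with the prescribed leading part. -/
structure FoldingMatrix (D : ResolutionData E) where
  mat : ∀ i j, (unshift W).obj (D.factor i) ⟶ D.factor j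
  mat_up : ∀ i j, degree i + 1 < degree j → mat i j = 0
  mat_leading : ∀ i j, degree i - degree j ≤ 1 → mat i j = D.leading i j
  mat_sq : ∀ i k, matSq (unshift W) degree mat (degree k - 1) (degree i + 1) i k =
    diagMat (unshift W) (wPair W) i k

theorem nextIndex_degree : nextIndex degree = succIndex :=
  funext fun i => (eq_nextIndex degree (degree_succIndex i)).symm

/-- The differential that extends the leading part by higher homotopies. -/
def ResolutionData.foldingMatrix (D : ResolutionData E) : FoldingMatrix D where
  mat := perturb (unshift W) degree D.leading
  mat_leading i j h := perturb_of_le _ _ _ h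
  mat_up i j h := by
    rw [perturb_of_le _ _ _ (by lia)]
    exact (powSystem W).leading_of_add_lt D.square degree degree_succIndex i j h
  mat_sq := by
    apply matSq_perturb (unshift W) degree D.leading (wPair W) wPair_unshift wPair_naturality
    · exact (powSystem W).leading_of_add_lt D.square degree degree_succIndex
    · exact D.isZero_factor
    · intro i k h
      exact (powSystem W).matSq_leading D.square degree degree_succIndex h
    · rw [nextIndex_degree]
      intro i j h _ R hR
      exact D.exists_lift_leading i j h R hR

/-- For compatible homotopies the leading part is a differential. -/
def ResolutionData.IsCompatible.foldingMatrix {D : ResolutionData E} (h : D.IsCompatible) :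
    FoldingMatrix D where
  mat := D.leading
  mat_leading _ _ _ := rfl
  mat_up := (powSystem W).leading_of_add_lt D.square degree degree_succIndex
  mat_sq := (powSystem W).matSq_leading_of_compatible D.square degree degree_succIndex h.square_φ
    h.square_h

end

section
variable {A : Type u} [Category.{v} A] [Abelian A] [HasProducts.{v} A] {W : Potential A}
  {E : Factorization W} {D : ResolutionData E}

namespace FoldingMatrix
variable (M : FoldingMatrix D)

/-- The projections to the factors of the folding. -/
abbrev proj (i : ℤ ⊕ ℤ) : totPair W D.Xneg D.Xzero ⟶ D.factor i := totProj W D.Xneg D.Xzero i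
/-- The inclusions of the factors of the folding. -/
abbrev incl (i : ℤ ⊕ ℤ) : D.factor i ⟶ totPair W D.Xneg D.Xzero := totIncl W D.Xneg D.Xzero i

/-- The differential of the folding. -/
def diff : (unshift W).obj (totPair W D.Xneg D.Xzero) ⟶ totPair W D.Xneg D.Xzero :=
  totMatrix (Xn := D.Xneg) (Xz := D.Xzero) M.mat

theorem diff_proj (j : ℤ ⊕ ℤ) : M.diff ≫ proj j =
    ∑ r ∈ indexIcc degree (degree j - 1) 0, (unshift W).map (proj r) ≫ M.mat r j :=
  totMatrix_totProj (Xn := D.Xneg) (Xz := D.Xzero) M.mat j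

theorem incl_diff_proj (i j : ℤ ⊕ ℤ) :
    (unshift W).map (incl i) ≫ M.diff ≫ proj j = M.mat i j :=
  totIncl_totMatrix (Xn := D.Xneg) (Xz := D.Xzero) M.mat D.isZero_factor M.mat_up i j

theorem diff_sq : (unshift W).map M.diff ≫ M.diff = wPair W _ :=
  totMatrix_sq (Xn := D.Xneg) (Xz := D.Xzero) M.mat D.isZero_factor M.mat_up M.mat_sq

/-- The factorization underlying the folding. -/
def fact : Factorization W := Factorization.ofDiff _ M.diff M.diff_sq

/-- The structure morphism `φ⁻¹` of the folding. -/
def φneg : W.Φ.inverse.obj (totZero W D.Xneg D.Xzero) ⟶ totNeg W D.Xneg D.Xzero := M.diff.1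
/-- The structure morphism `φ⁰` of the folding. -/
def φzero : totNeg W D.Xneg D.Xzero ⟶ totZero W D.Xneg D.Xzero := M.diff.2

section
variable (l j : ℤ)

/-- In each of these formulas a component of the folding is a coordinate of a matrix entry; for φ⁻¹
the source is moreover rewritten from Φ⁻¹Φ^(-l) to Φ^(-l-1). -/
theorem negOO_eq : negOO M.φneg l j = (mulInvIso W.Φ (show -l - 1 + 1 = -l by lia)).inv.app _ ≫
    (M.mat (Sum.inr l) (Sum.inr j)).1 :=
  congrArg (_ ≫ ·) (congrArg Prod.fst (M.incl_diff_proj (Sum.inr l) (Sum.inr j)))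
theorem negOE_eq : negOE M.φneg l j = (mulInvIso W.Φ (show -l - 1 + 1 = -l by lia)).inv.app _ ≫
    (M.mat (Sum.inr l) (Sum.inl j)).1 :=
  congrArg (_ ≫ ·) (congrArg Prod.fst (M.incl_diff_proj (Sum.inr l) (Sum.inl j)))
theorem negEO_eq : negEO M.φneg l j = (mulInvIso W.Φ (show -l - 1 + 1 = -l by lia)).inv.app _ ≫
    (M.mat (Sum.inl l) (Sum.inr j)).1 :=
  congrArg (_ ≫ ·) (congrArg Prod.fst (M.incl_diff_proj (Sum.inl l) (Sum.inr j)))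
theorem negEE_eq : negEE M.φneg l j = (mulInvIso W.Φ (show -l - 1 + 1 = -l by lia)).inv.app _ ≫
    (M.mat (Sum.inl l) (Sum.inl j)).1 :=
  congrArg (_ ≫ ·) (congrArg Prod.fst (M.incl_diff_proj (Sum.inl l) (Sum.inl j)))
theorem zeroOO_eq : zeroOO M.φzero l j = (M.mat (Sum.inr l) (Sum.inr j)).2 :=
  congrArg Prod.snd (M.incl_diff_proj (Sum.inr l) (Sum.inr j))
theorem zeroOE_eq : zeroOE M.φzero l j = (M.mat (Sum.inr l) (Sum.inl j)).2 :=
  congrArg Prod.snd (M.incl_diff_proj (Sum.inr l) (Sum.inl j))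
theorem zeroEO_eq : zeroEO M.φzero l j = (M.mat (Sum.inl l) (Sum.inr j)).2 :=
  congrArg Prod.snd (M.incl_diff_proj (Sum.inl l) (Sum.inr j))
theorem zeroEE_eq : zeroEE M.φzero l j = (M.mat (Sum.inl l) (Sum.inl j)).2 :=
  congrArg Prod.snd (M.incl_diff_proj (Sum.inl l) (Sum.inl j))

end

theorem componentsVanish {R : ℤ → ℤ → Prop} (h : ∀ i j, R (degree i) (degree j) → M.mat i j = 0) :
    ComponentsVanish M.φneg M.φzero R where
  negOO l j hR := by
    rw [negOO_eq, h _ _ hR]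
    exact comp_zero
  negOE l j hR := by
    rw [negOE_eq, h _ _ hR]
    exact comp_zero
  negEO l j hR := by
    rw [negEO_eq, h _ _ hR]
    exact comp_zero
  negEE l j hR := by
    rw [negEE_eq, h _ _ hR]
    exact comp_zero
  zeroOO l j hR := by
    rw [zeroOO_eq, h _ _ hR]
    rfl
  zeroOE l j hR := by
    rw [zeroOE_eq, h _ _ hR]
    rfl
  zeroEO l j hR := by
    rw [zeroEO_eq, h _ _ hR]
    rfl
  zeroEE l j hR := by
    rw [zeroEE_eq, h _ _ hR]
    rfl

omit [HasProducts.{v} A] in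
theorem mat_up_eq (i : ℤ ⊕ ℤ) : M.mat i (succIndex i) = (powSystem W).up D.square i := by
  rw [M.mat_leading i _ (by rw [degree_succIndex]; lia)]
  exact (powSystem W).leading_up D.square i

omit [HasProducts.{v} A] in
theorem mat_diag_eq (i : ℤ ⊕ ℤ) : M.mat i i = (powSystem W).diag D.square i := by
  rw [M.mat_leading i _ (by lia)]
  exact (powSystem W).leading_diag D.square degree degree_succIndex i

omit [HasProducts.{v} A] in
theorem mat_down_eq (i : ℤ ⊕ ℤ) : M.mat (succIndex i) i = (powSystem W).down D.square i := by
  rw [M.mat_leading _ _ (by rw [degree_succIndex]; lia)]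
  exact (powSystem W).leading_down D.square degree degree_succIndex i

section
variable (l : ℤ)

/-- Here and for the other prescribed components the matrix entry unfolds to a conjugate of the
given datum, and only powers of Φ along equal exponents remain to be matched. -/
theorem negOE_succ : negOE M.φneg l (l + 1) =
    (W.Φ ^ (-l - 1)).functor.map (D.Pneg.cochainComplex.d (2 * l + 1) (2 * (l + 1))) ≫
      (powEq W.Φ (show -l - 1 = -(l + 1) by lia)).hom.app _ := by
  have h' : -(l + 1) + 1 = -l := by lia
  refine (M.negOE_eq l (l + 1)).trans ?_
  refine (congrArg (_ ≫ ·) (congrArg Prod.fst (M.mat_up_eq (Sum.inr l)))).trans ?_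
  change (mulInvIso W.Φ _).inv.app _ ≫ (mulInvIso W.Φ h').hom.app _ ≫
    (W.Φ ^ (-(l + 1))).functor.map (D.Pneg.cochainComplex.d (2 * l + 1) (2 * (l + 1))) ≫ 𝟙 _ = _
  rw [Category.comp_id, ← Category.assoc, mulInv_inv_mulInv W.Φ _ _ h']
  exact ((powEq W.Φ _).hom.naturality _).symm

theorem zeroOE_succ : zeroOE M.φzero l (l + 1) =
    -((W.Φ ^ (-l - 1)).functor.map (D.Pzero.cochainComplex.d (2 * l + 1) (2 * (l + 1))) ≫
      (powEq W.Φ (show -l - 1 = -(l + 1) by lia)).hom.app _) := by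
  refine (M.zeroOE_eq l (l + 1)).trans ((congrArg Prod.snd (M.mat_up_eq (Sum.inr l))).trans ?_)
  change (powEq W.Φ _).hom.app _ ≫ (W.Φ ^ (-(l + 1))).functor.map
    (D.Pzero.cochainComplex.d (2 * l + 1) (2 * (l + 1))) ≫ (-𝟙 _) = _
  rw [Preadditive.comp_neg, Category.comp_id, Preadditive.comp_neg, neg_inj]
  exact ((powEq W.Φ _).hom.naturality _).symm

theorem negEO_succ : negEO M.φneg l l =
    -(W.Φ ^ (-l - 1)).functor.map (D.Pzero.cochainComplex.d (2 * l) (2 * l + 1)) := by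
  refine (M.negEO_eq l l).trans ?_
  refine (congrArg (_ ≫ ·) (congrArg Prod.fst (M.mat_up_eq (Sum.inl l)))).trans ?_
  change (mulInvIso W.Φ _).inv.app _ ≫ (mulInvIso W.Φ _).hom.app _ ≫
    (W.Φ ^ (-l - 1)).functor.map (D.Pzero.cochainComplex.d (2 * l) (2 * l + 1)) ≫ (-𝟙 _) = _
  rw [Iso.inv_hom_id_app_assoc, Preadditive.comp_neg, Category.comp_id]

theorem zeroEO_succ : zeroEO M.φzero l l =
    (W.Φ ^ (-l)).functor.map (D.Pneg.cochainComplex.d (2 * l) (2 * l + 1)) := by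
  refine (M.zeroEO_eq l l).trans ((congrArg Prod.snd (M.mat_up_eq (Sum.inl l))).trans ?_)
  change 𝟙 _ ≫ (W.Φ ^ (-l)).functor.map
    (D.Pneg.cochainComplex.d (2 * l) (2 * l + 1)) ≫ 𝟙 _ = _
  rw [Category.comp_id, Category.id_comp]

theorem negOO_diag : negOO M.φneg l l = (W.Φ ^ (-l - 1)).functor.map (D.liftZero (2 * l + 1)) := by
  have h' : -(l + 1) + 1 = -l := by lia
  have e : -l - 1 = -(l + 1) := by lia
  refine (M.negOO_eq l l).trans ?_
  refine (congrArg (_ ≫ ·) (congrArg Prod.fst (M.mat_diag_eq (Sum.inr l)))).trans ?_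
  change (mulInvIso W.Φ _).inv.app _ ≫ ((mulInvIso W.Φ h').hom.app _ ≫ (powEq W.Φ e).inv.app _) ≫
    (W.Φ ^ (-l - 1)).functor.map (D.liftZero (2 * l + 1)) = _
  rw [mulInv_powEq_inv W.Φ (show -l - 1 + 1 = -l by lia) e h', Iso.inv_hom_id_app_assoc]

theorem negEE_diag : negEE M.φneg l l =
    (invMulIso W.Φ (show -l - 1 + 1 = -l by lia)).inv.app _ ≫
      (W.Φ ^ (-l)).functor.map (D.liftNeg (2 * l)) := by
  refine (M.negEE_eq l l).trans ?_
  refine (congrArg (_ ≫ ·) (congrArg Prod.fst (M.mat_diag_eq (Sum.inl l)))).trans ?_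
  change (mulInvIso W.Φ _).inv.app _ ≫ ((mulInvIso W.Φ _).hom.app _ ≫ (invMulIso W.Φ _).inv.app _) ≫
    (W.Φ ^ (-l)).functor.map (D.liftNeg (2 * l)) = _
  rw [Category.assoc, Iso.inv_hom_id_app_assoc]

theorem zeroOO_diag : zeroOO M.φzero l l =
    (invMulIso W.Φ (show -l - 1 + 1 = -l by lia)).inv.app _ ≫
      (W.Φ ^ (-l)).functor.map (D.liftNeg (2 * l + 1)) := by
  have h' : -(l + 1) + 1 = -l := by lia
  have e : -l - 1 = -(l + 1) := by lia
  refine (M.zeroOO_eq l l).trans ((congrArg Prod.snd (M.mat_diag_eq (Sum.inr l))).trans ?_)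
  change ((powEq W.Φ e).hom.app _ ≫ (invMulIso W.Φ h').inv.app _) ≫
    (W.Φ ^ (-l)).functor.map (D.liftNeg (2 * l + 1)) = _
  rw [powEq_invMul W.Φ (show -l - 1 + 1 = -l by lia) e h']

theorem zeroEE_diag : zeroEE M.φzero l l = (W.Φ ^ (-l)).functor.map (D.liftZero (2 * l)) := by
  refine (M.zeroEE_eq l l).trans ((congrArg Prod.snd (M.mat_diag_eq (Sum.inl l))).trans ?_)
  change (𝟙 _ ≫ 𝟙 _) ≫ (W.Φ ^ (-l)).functor.map (D.liftZero (2 * l)) = _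
  rw [Category.comp_id, Category.id_comp]

theorem negOE_pred : negOE M.φneg l l =
    (W.Φ ^ (-l - 1)).functor.map (D.homNeg (2 * l + 1) (2 * l)) ≫
      (mulIso W.Φ (show -l - 1 + 1 = -l by lia)).hom.app _ := by
  have h' : -(l + 1) + 1 = -l := by lia
  have e : -l - 1 = -(l + 1) := by lia
  refine (M.negOE_eq l l).trans ?_
  refine (congrArg (_ ≫ ·) (congrArg Prod.fst (M.mat_down_eq (Sum.inl l)))).trans ?_
  change (mulInvIso W.Φ _).inv.app _ ≫ ((mulInvIso W.Φ h').hom.app _ ≫ (powEq W.Φ e).inv.app _) ≫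
    (invMulIso W.Φ _).inv.app _ ≫
      (W.Φ ^ (-l)).functor.map (invMate (D.homNeg (2 * l + 1) (2 * l))) ≫ 𝟙 _ = _
  rw [mulInv_powEq_inv W.Φ (show -l - 1 + 1 = -l by lia) e h', Iso.inv_hom_id_app_assoc, Category.comp_id,
    invMulIso_inv_map_invMate]

theorem zeroOE_pred : zeroOE M.φzero l l =
    -((invMulIso W.Φ (show -l - 1 + 1 = -l by lia)).inv.app _ ≫
      (W.Φ ^ (-l)).functor.map (D.homZero (2 * l + 1) (2 * l))) := by
  have h' : -(l + 1) + 1 = -l := by lia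
  have e : -l - 1 = -(l + 1) := by lia
  refine (M.zeroOE_eq l l).trans ((congrArg Prod.snd (M.mat_down_eq (Sum.inl l))).trans ?_)
  change ((powEq W.Φ e).hom.app _ ≫ (invMulIso W.Φ h').inv.app _) ≫ 𝟙 _ ≫
    (W.Φ ^ (-l)).functor.map (D.homZero (2 * l + 1) (2 * l)) ≫ (-𝟙 _) = _
  rw [powEq_invMul W.Φ (show -l - 1 + 1 = -l by lia) e h', Category.id_comp, Preadditive.comp_neg, Category.comp_id,
    Preadditive.comp_neg]

/-- The hypothesis `k + 1 = l` allows `l` to be substituted, so that the entry is literally that of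
consecutive indices; the case k = l - 1 is used later. -/
theorem negEO_pred {k l : ℤ} (hkl : k + 1 = l) : negEO M.φneg l k =
    -((invMulIso W.Φ (show -l - 1 + 1 = -l by lia)).inv.app _ ≫
      (W.Φ ^ (-l)).functor.map (D.homZero (2 * l) (2 * k + 1)) ≫
        (powEq W.Φ (show -l = -k - 1 by lia)).hom.app _) := by
  subst hkl
  refine (M.negEO_eq (k + 1) k).trans ?_
  refine (congrArg (_ ≫ ·) (congrArg Prod.fst (M.mat_down_eq (Sum.inr k)))).trans ?_
  have e : -k - 1 = -(k + 1) := by lia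
  change (mulInvIso W.Φ _).inv.app _ ≫ ((mulInvIso W.Φ _).hom.app _ ≫
    (invMulIso W.Φ _).inv.app _) ≫ (powEq W.Φ e).inv.app _ ≫
      (W.Φ ^ (-k - 1)).functor.map (D.homZero (2 * (k + 1)) (2 * k + 1)) ≫ (-𝟙 _) = _
  rw [Category.assoc, Iso.inv_hom_id_app_assoc, Preadditive.comp_neg, Category.comp_id,
    Preadditive.comp_neg, Preadditive.comp_neg, neg_inj]
  rw [powEq_inv]
  exact congrArg (_ ≫ ·) ((powEq W.Φ e.symm).hom.naturality _).symm

theorem zeroEO_pred {k l : ℤ} (hkl : k + 1 = l) : zeroEO M.φzero l k =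
    (W.Φ ^ (-l)).functor.map (D.homNeg (2 * l) (2 * k + 1)) ≫
      (mulIso W.Φ (show -l + 1 = -k by lia)).hom.app _ := by
  subst hkl
  refine (M.zeroEO_eq (k + 1) k).trans ((congrArg Prod.snd (M.mat_down_eq (Sum.inr k))).trans ?_)
  have h' : -(k + 1) + 1 = -k := by lia
  change (𝟙 _ ≫ 𝟙 _) ≫ (invMulIso W.Φ h').inv.app _ ≫
    (W.Φ ^ (-k)).functor.map (invMate (D.homNeg (2 * (k + 1)) (2 * k + 1))) ≫ 𝟙 _ = _
  rw [Category.comp_id, Category.id_comp, Category.comp_id, invMulIso_inv_map_invMate]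

end

/-- The folding. -/
def folding : ProdFolding W D.Pneg.cochainComplex D.Pzero.cochainComplex where
  φneg := M.φneg
  φzero := M.φzero
  φneg_φzero := M.fact.φneg_φzero
  φzero_φneg := M.fact.φzero_φneg
  vanish := M.componentsVanish M.mat_up
  neg_odd_succ := M.negOE_succ
  neg_even_succ := M.negEO_succ
  zero_odd_succ := M.zeroOE_succ
  zero_even_succ := M.zeroEO_succ

end FoldingMatrix
end

/-! ### The folding as a twisted resolution -/

section
open Factorization
variable {A : Type u} [Category.{v} A] [Abelian A] [HasProducts.{v} A] {W : Potential A}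
  {E : Factorization W} {D : ResolutionData E}

namespace FoldingMatrix
variable (M : FoldingMatrix D)

theorem comp_diff_proj {T : A × A} (t : T ⟶ (unshift W).obj (totPair W D.Xneg D.Xzero))
    (j : ℤ ⊕ ℤ) (h : ∀ r, degree j - 1 ≤ degree r → t ≫ (unshift W).map (proj r) = 0) :
    t ≫ M.diff ≫ proj j = 0 := by
  rw [diff_proj, Preadditive.comp_sum]
  apply Finset.sum_eq_zero
  intro r hr
  rw [mem_indexIcc] at hr
  rw [← Category.assoc, h r hr.1, zero_comp]

theorem comp_φneg_proj {Z : A} (t : Z ⟶ W.Φ.inverse.obj (totZero W D.Xneg D.Xzero)) (j : ℤ ⊕ ℤ)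
    (h : ∀ r, degree j - 1 ≤ degree r → t ≫ W.Φ.inverse.map (proj (D := D) r).2 = 0) :
    t ≫ M.φneg ≫ (proj j).1 = 0 :=
  congrArg Prod.fst (M.comp_diff_proj (T := (Z, Z)) (t, 0) j fun r hr =>
    Prod.ext (h r hr) zero_comp)

theorem comp_φzero_proj {Z : A} (t : Z ⟶ totNeg W D.Xneg D.Xzero) (j : ℤ ⊕ ℤ)
    (h : ∀ r, degree j - 1 ≤ degree r → t ≫ (proj (D := D) r).1 = 0) :
    t ≫ M.φzero ≫ (proj j).2 = 0 :=
  congrArg Prod.snd (M.comp_diff_proj (T := (Z, Z)) (0, t) j fun r hr =>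
    Prod.ext zero_comp (h r hr))

theorem isMatrix : IsMatrix M.φneg M.φzero where
  negE j Z t hE hO := by
    refine M.comp_φneg_proj t (Sum.inl j) ?_
    rintro (l | l) hr
    · exact hE l hr
    · exact hO l hr
  negO j Z t hE hO := by
    refine M.comp_φneg_proj t (Sum.inr j) ?_
    rintro (l | l) hr
    · exact hE l (by rw [degree_inr, degree_inl] at hr; lia)
    · exact hO l (by rw [degree_inr, degree_inr] at hr; lia)
  zeroE j Z t hE hO := by
    refine M.comp_φzero_proj t (Sum.inl j) ?_
    rintro (l | l) hr
    · exact hE l hr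
    · exact hO l hr
  zeroO j Z t hE hO := by
    refine M.comp_φzero_proj t (Sum.inr j) ?_
    rintro (l | l) hr
    · exact hE l (by rw [degree_inr, degree_inl] at hr; lia)
    · exact hO l (by rw [degree_inr, degree_inr] at hr; lia)

/-- The coordinate of index 0 of the differential receives contributions from the indices -1 and 0
only; the augmentation kills the first and intertwines the second with the differential of `E`. -/
theorem diff_proj_augPair : M.diff ≫ proj (Sum.inl 0) ≫ D.augPair =
    (unshift W).map (proj (Sum.inl 0) ≫ D.augPair) ≫ E.diff := by
  have h : indexIcc degree (degree (Sum.inl 0) - 1) 0 = {Sum.inr (-1), Sum.inl 0} := by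
    ext i
    rw [mem_indexIcc, Finset.mem_insert, Finset.mem_singleton, ← degree.injective.eq_iff,
      ← degree.injective.eq_iff, degree_inl, degree_inr]
    lia
  have h1 := M.mat_leading (Sum.inr (-1)) (Sum.inl 0) (by rw [degree_inl, degree_inr]; lia)
  have h2 := M.mat_leading (Sum.inl 0) (Sum.inl 0) (by lia)
  rw [← Category.assoc, diff_proj, h, Finset.sum_pair (by simp), h1, h2, Preadditive.add_comp,
    Category.assoc, Category.assoc, D.leading_augPair, D.leading_zero_augPair, comp_zero, zero_add,
    Functor.map_comp, Category.assoc]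

/-- The morphism from the folding to `E`. -/
def toFact : M.folding.fact ⟶ E := Factorization.homOfPair (proj (Sum.inl 0) ≫ D.augPair)
  M.diff_proj_augPair

/-- The index of degree `-n`. -/
def negIndex : ℕ → ℤ ⊕ ℤ
  | 0 => Sum.inl 0
  | n + 1 => match negIndex n with
    | Sum.inl l => Sum.inr (l - 1)
    | Sum.inr l => Sum.inl l

theorem succIndex_negIndex (n : ℕ) : succIndex (negIndex (n + 1)) = negIndex n := by
  rw [negIndex]
  rcases negIndex n with l | l
  · exact congrArg Sum.inl (sub_add_cancel l 1)
  · rfl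

theorem degree_negIndex (n : ℕ) : degree (negIndex n) = -n := by
  induction n with
  | zero => rfl
  | succ n ih =>
    have := degree_succIndex (negIndex (n + 1))
    rw [succIndex_negIndex, ih] at this
    push_cast
    lia

theorem negIndex_injective : Function.Injective negIndex := fun m n h => by
  have := congrArg degree h
  rw [degree_negIndex, degree_negIndex] at this
  lia

theorem exists_negIndex {i : ℤ ⊕ ℤ} (h : degree i ≤ 0) : ∃ n, negIndex n = i :=
  ⟨(degree i).natAbs, degree.injective (by rw [degree_negIndex]; lia)⟩

/-- The folding as a twisted resolution of `E`. -/
def twistedResolution : TwistedResolution M.toFact where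
  X n := D.factor (negIndex n)
  π n := proj (negIndex n)
  ι n := incl (negIndex n)
  D m n := M.mat (negIndex m) (negIndex n)
  aug := D.augPair
  hom_ext s t h := by
    apply tot_hom_ext
    intro i
    by_cases hi : degree i ≤ 0
    · obtain ⟨n, rfl⟩ := exists_negIndex hi
      exact h n
    · exact (D.isZero_factor i (by lia)).eq_of_tgt _ _
  -- Coordinates in positive degrees are filled with zeros; the equality of indices in the auxiliary
  -- statement transports the type of the n-th coordinate.
  exists_lift {T} s := by
    have h : ∀ i, ∃ f : T ⟶ D.factor i, ∀ n (hn : negIndex n = i),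
        f = s n ≫ eqToHom (by rw [hn]) := by
      intro i
      by_cases hi : ∃ n, negIndex n = i
      · obtain ⟨n, rfl⟩ := hi
        refine ⟨s n, fun m hm => ?_⟩
        obtain rfl := negIndex_injective hm
        exact (Category.comp_id _).symm
      · exact ⟨0, fun n hn => (hi ⟨n, hn⟩).elim⟩
    choose f hf using h
    refine ⟨totLift f, fun n => ?_⟩
    refine (totLift_totProj (Xn := D.Xneg) (Xz := D.Xzero) f (negIndex n)).trans ?_
    exact (hf _ n rfl).trans (Category.comp_id _)
  ι_π_self n := totIncl_totProj_self _
  ι_π_ne m n h := totIncl_totProj_ne _ _ fun h' => h (negIndex_injective h')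
  -- The range of `m` below `n + 2` corresponds, under m ↦ degree -m, to the degrees from -n - 1 to
  -- 0.
  diff_π n := by
    refine (M.diff_proj _).trans ?_
    symm
    refine Finset.sum_nbij negIndex ?_ ?_ ?_ ?_
    · intro m hm
      rw [Finset.mem_range] at hm
      rw [mem_indexIcc, degree_negIndex, degree_negIndex]
      lia
    · exact negIndex_injective.injOn
    · intro i hi
      rw [Finset.mem_coe, mem_indexIcc] at hi
      obtain ⟨m, rfl⟩ := exists_negIndex hi.2
      rw [degree_negIndex, degree_negIndex] at hi
      exact ⟨m, by simp only [Finset.coe_range, Set.mem_Iio]; lia, rfl⟩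
    · intros
      rfl
  pair_d₀ := rfl
  epi_aug_fst := inferInstanceAs (Epi (aug D.Pneg))
  epi_aug_snd := inferInstanceAs (Epi (aug D.Pzero))
  exact_zero t ht := by
    obtain ⟨T', p, s, h₁, h₂, hs⟩ := D.leading_exact_zero t ht
    refine ⟨T', p, s, h₁, h₂, ?_⟩
    exact (congrArg (s ≫ ·) (M.mat_leading (Sum.inr (-1)) (Sum.inl 0)
      (by rw [degree_inl, degree_inr]; lia))).trans hs
  exact_succ n T t ht := by
    have h (m : ℕ) : M.mat (negIndex (m + 1)) (negIndex m) =
        D.leading (negIndex (m + 1)) (negIndex m) :=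
      M.mat_leading _ _ (by rw [degree_negIndex, degree_negIndex]; push_cast; lia)
    rw [h] at ht ⊢
    exact D.exact_of_succIndex (by rw [degree_negIndex]; push_cast; lia)
      (succIndex_negIndex (n + 1)) (succIndex_negIndex n) t ht

/-- Contra-acyclicity of the cone is tested against every thick subcategory with the required
closure properties, and the filtration argument works inside each of them. -/
theorem toFact_isContraQuasiIso : IsContraQuasiIso M.toFact :=
  isIso_of_cone_mem _ fun _ hN hP hT => M.twistedResolution.cone_mem hN hT hP

theorem toFact_isQuasiIso (h₁ : IsFiniteResolution D.Pneg) (h₂ : IsFiniteResolution D.Pzero) :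
    IsQuasiIso M.toFact := by
  obtain ⟨M₁, hM₁⟩ := h₁
  obtain ⟨M₂, hM₂⟩ := h₂
  refine isIso_of_cone_mem _ fun _ hN hT =>
    -- A factor vanishes as soon as both resolutions do, whence the maximum of the two lengths.
    M.twistedResolution.cone_mem_of_finite hN hT (max M₁ M₂) fun n hn => ?_
  refine isZero_powPair W _ (isZero_resolution_of_le D.Pneg M₁ hM₁ _ ?_)
    (isZero_resolution_of_le D.Pzero M₂ hM₂ _ ?_)
  · rw [degree_negIndex]
    lia
  · rw [degree_negIndex]
    lia

theorem isStrictification : IsStrictification D M.folding M.toFact where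
  negOO_diag := M.negOO_diag
  negEE_diag := M.negEE_diag
  zeroOO_diag := M.zeroOO_diag
  zeroEE_diag := M.zeroEE_diag
  negOE_pred := M.negOE_pred
  negEO_pred _ := M.negEO_pred (sub_add_cancel _ _)
  zeroOE_pred := M.zeroOE_pred
  zeroEO_pred _ := M.zeroEO_pred (sub_add_cancel _ _)
  isMatrix := M.isMatrix
  d₀_neg := congrArg (πnegE W D.Xneg D.Xzero 0 ≫ ·) (Category.id_comp _).symm
  d₀_zero := congrArg (πzeroE W D.Xneg D.Xzero 0 ≫ ·) (Category.id_comp _).symm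
  contraQuasiIso := M.toFact_isContraQuasiIso
  quasiIso := M.toFact_isQuasiIso

end FoldingMatrix
end

end Factorizations
end

theorem mainTheorem11 {A : Type u} [Category.{v} A] [Abelian A] [HasProducts.{v} A]
    [EnoughProjectives A] (W : Potential A) (E : Factorization W) (D : ResolutionData E) :
    (∃ (P : ProdFolding W D.Pneg.cochainComplex D.Pzero.cochainComplex) (d₀ : P.fact ⟶ E),
      IsStrictification D P d₀) ∧
    (D.IsCompatible →
      ∃ (P : ProdFolding W D.Pneg.cochainComplex D.Pzero.cochainComplex) (d₀ : P.fact ⟶ E),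
        IsStrictification D P d₀ ∧
          ComponentsVanish P.φneg P.φzero (fun p q => q < p - 1)) :=
  -- In general the matrix is completed by higher homotopies; for compatible homotopies the leading
  -- part is itself a curved differential and has no entries lowering the degree by more than one.
  ⟨⟨_, _, D.foldingMatrix.isStrictification⟩, fun h =>
    ⟨_, _, h.foldingMatrix.isStrictification, h.foldingMatrix.componentsVanish fun _ _ hij =>
      (powSystem W).leading_of_lt D.square degree degree_succIndex (.inr hij)⟩⟩
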